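/- Consider planar piecewise linear differential systems $Z=(X^-,X^+)$: a straight line $\Sigma$ divides the plane into two closed half--planes $S^-$ and $S^+$, with $\dot p=X^-(p)=A^-p+b^-$ on $S^-$ and $\dot p=X^+(p)=A^+p+b^+$ on $S^+$, where $\det A^\pm\neq 0$ (each linear system, extended to the plane, is a focus, a center, a node or a saddle) and $X^-\neq X^+$ at some point of $\Sigma$. Let the sliding set be the set of points of $\Sigma$ at which $X^-$ and $X^+$ either both point strictly towards $\Sigma$ or both point strictly away from $\Sigma$; its connected components are called sliding segments. An equilibrium point of $Z$ is a point of $S^-$ where $X^-$ vanishes or a point of $S^+$ where $X^+$ vanishes. A periodic orbit of $Z$ is a closed orbit that does not meet the sliding set and consists of finitely many arcs, each an orbit of $X^-$ in $S^-$ or of $X^+$ in $S^+$, meeting $\Sigma$ at finitely many instants per period; a limit cycle is a periodic orbit that has a neighbourhood containing no other periodic orbit. Count only the limit cycles that surround (have in the bounded part of their complement) a unique equilibrium point or a unique sliding segment. Theorem. Over all such systems $Z$ for which at least one of the two linear systems $X^-$, $X^+$ has its equilibrium point on $\Sigma$, the number of these limit cycles has a maximum $N$, and $2\le N\le 3$.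 -/

import Mathlib

open Matrix

/-- The plane. (All notions below are topological, so the choice of a norm is immaterial.) -/
abbrev Plane : Type := Fin 2 → ℝ

/-- A planar linear differential system `p' = A p + b`. -/
structure LinearSystem where
  A : Matrix (Fin 2) (Fin 2) ℝ
  b : Plane

/-- The vector field of a linear differential system. -/
def LinearSystem.field (L : LinearSystem) (p : Plane) : Plane := L.A *ᵥ p + L.b

/-- A planar piecewise linear differential system with two pieces separated by the straight line
`n ⬝ p = d`: the system `minus` acts on the half-plane `n ⬝ p ≤ d`,
the system `plus` acts on the half-plane `n ⬝ p ≥ d`. -/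
structure PiecewiseLinearSystem where
  n : Plane
  d : ℝ
  n_ne_zero : n ≠ 0
  minus : LinearSystem
  plus : LinearSystem

namespace PiecewiseLinearSystem

variable (Z : PiecewiseLinearSystem)

/-- The affine function that is negative, zero, positive on the open minus half-plane,
on the separation line, and on the open plus half-plane, respectively. -/
def level (p : Plane) : ℝ := Z.n ⬝ᵥ p - Z.d

/-- The separation line. -/
def line : Set Plane := {p | Z.level p = 0}

/-- Both linear systems, extended to the whole plane, have a unique and nondegenerate singular
point, that is, a focus (or a center), a node, or a saddle. -/
def Nondegenerate : Prop := Z.minus.A.det ≠ 0 ∧ Z.plus.A.det ≠ 0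

/-- The two vector fields do not agree on the separation line. -/
def Discontinuous : Prop := ∃ p ∈ Z.line, Z.minus.field p ≠ Z.plus.field p

/-- One (at least) of the two linear systems has its equilibrium point on the separation line. -/
def HasEquilibriumOnLine : Prop :=
  ∃ p ∈ Z.line, Z.minus.field p = 0 ∨ Z.plus.field p = 0

/-- The real equilibrium points: an equilibrium of one of the linear systems that lies in the
closed half-plane where that system is defined. -/
def IsEquilibrium (p : Plane) : Prop :=
  (Z.level p ≤ 0 ∧ Z.minus.field p = 0) ∨ (0 ≤ Z.level p ∧ Z.plus.field p = 0)

/-- The sliding region: both vectors point towards the separation line. -/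
def slidingRegion : Set Plane :=
  {p | p ∈ Z.line ∧ 0 < Z.n ⬝ᵥ Z.minus.field p ∧ Z.n ⬝ᵥ Z.plus.field p < 0}

/-- The escaping region: both vectors point away from the separation line. -/
def escapingRegion : Set Plane :=
  {p | p ∈ Z.line ∧ Z.n ⬝ᵥ Z.minus.field p < 0 ∧ 0 < Z.n ⬝ᵥ Z.plus.field p}

/-- The union of the escaping and the sliding region. -/
def slidingSet : Set Plane := Z.escapingRegion ∪ Z.slidingRegion

/-- The (maximal) sliding segments: the connected components of the sliding set. -/
def IsSlidingSegment (S : Set Plane) : Prop :=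
  ∃ p ∈ Z.slidingSet, S = connectedComponentIn Z.slidingSet p

/-- `γ` is a nonconstant periodic solution, of period `T`, that does not meet the sliding set:
a closed curve made of finitely many arcs of orbits of the minus system in the minus half-plane
and of the plus system in the plus half-plane. Finitely many instants per period may be spent
on the separation line, at points outside the sliding set. -/
structure IsPeriodicSolution (γ : ℝ → Plane) (T : ℝ) : Prop where
  period_pos : 0 < T
  continuous : Continuous γ
  periodic : Function.Periodic γ T
  nonconstant : ∃ t, γ t ≠ γ 0
  finite_line : {t | t ∈ Set.Ico 0 T ∧ γ t ∈ Z.line}.Finite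
  minus_deriv : ∀ t, Z.level (γ t) < 0 → HasDerivAt γ (Z.minus.field (γ t)) t
  plus_deriv : ∀ t, 0 < Z.level (γ t) → HasDerivAt γ (Z.plus.field (γ t)) t
  avoids_sliding : ∀ t, γ t ∉ Z.slidingSet

/-- Periodic orbits, as subsets of the plane. -/
def IsPeriodicOrbit (C : Set Plane) : Prop :=
  ∃ (γ : ℝ → Plane) (T : ℝ), Z.IsPeriodicSolution γ T ∧ C = Set.range γ

/-- Limit cycles: periodic orbits that are isolated in the set of all periodic orbits. -/
def IsLimitCycle (C : Set Plane) : Prop :=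
  Z.IsPeriodicOrbit C ∧
    ∃ U : Set Plane, IsOpen U ∧ C ⊆ U ∧ ∀ C', Z.IsPeriodicOrbit C' → C' ⊆ U → C' = C

/-- The set of the points surrounded by the closed curve `C`: those in the bounded part of the
complement of `C`. -/
def inside (C : Set Plane) : Set Plane :=
  {p | p ∉ C ∧ Bornology.IsBounded (connectedComponentIn Cᶜ p)}

/-- `C` surrounds a unique equilibrium point. -/
def SurroundsUniqueEquilibrium (C : Set Plane) : Prop :=
  ∃! p, Z.IsEquilibrium p ∧ p ∈ inside C

/-- `C` surrounds a unique sliding segment. -/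
def SurroundsUniqueSlidingSegment (C : Set Plane) : Prop :=
  ∃! S, Z.IsSlidingSegment S ∧ S ⊆ inside C

/-- The limit cycles that are counted. -/
def limitCycles : Set (Set Plane) :=
  {C | Z.IsLimitCycle C ∧
    (Z.SurroundsUniqueEquilibrium C ∨ Z.SurroundsUniqueSlidingSegment C)}

end PiecewiseLinearSystem

/-! Let the minus system have its equilibrium on the line. Along its orbits from the line the level
is a multiple of a single function `Sm`, so every minus arc lasts until the first positive zero `z`
of `Sm`, and the minus half-map multiplies the normal slope by the negative constant `Rm z`. For a
plus equilibrium off the line, both end slopes of a plus excursion are explicit functions of its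
duration, monotone in opposite directions (`slopes_of_lt`). So both half-maps reverse order and the
return map is increasing. A periodic orbit crosses the line finitely often per period, and an
increasing map permits this only if each turn closes up (`exists_cycle`). Orbits inside one closed
half-plane are never isolated, because homotheties about the equilibrium move them to further
periodic orbits.

Upper bound: a cycle with plus duration `τ` closes up if and only if `F τ = 0`, where `F` is a
combination of `1`, `exp (T τ)`, `S` and `R`. Four zeros of `F` give, by Rolle for `F / S`, three
zeros of the Wronskian of `F` and `S`. Multiplied by `exp (-T t)`, this Wronskian has the derivative
`exp (-T t) * h D S (1 - κ exp (T t))`, so Rolle again gives two solutions of `κ exp (T t) = 1`,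
whence `T = 0` and `κ = 1` (`degenerate_of_four`). Such a system is reversible and its cycles belong
to a continuous family, so none is isolated (`not_isLimitCycle_of_reversible`). If the plus
equilibrium is on the line too, the closing equation is linear in the slope and leaves at most one
limit cycle.

Lower bound: a focus on the line that contracts by `1/8` per half turn is combined with a virtual
node with eigenvalues `1` and `2`. With `w = exp τ` the closing equation is `w ^ 2 - 6 w + 8 = 0`,
and its roots `2` and `4` give two limit cycles around the origin, the only equilibrium. -/

open Set Filter Topology

/-! ### Zeros and signs of functions of one variable -/

/-- A function continuous and positive at `x` and nonpositive at `t ≥ x` has a first zero. -/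
theorem exists_first_zero {f : ℝ → ℝ} (hf : Continuous f) {x t : ℝ} (hx : 0 < f x) (hxt : x ≤ t)
    (ht : f t ≤ 0) : ∃ b, x < b ∧ b ≤ t ∧ f b = 0 ∧ ∀ s ∈ Ico x b, 0 < f s := by
  have hcl : IsClosed {s | f s ≤ 0} := isClosed_le hf continuous_const
  have hcomp : IsCompact (Icc x t ∩ {s | f s ≤ 0}) := isCompact_Icc.inter_right hcl
  obtain ⟨b, ⟨⟨hxb, hbt⟩, hb⟩, hleast⟩ := hcomp.exists_isLeast ⟨t, ⟨hxt, le_rfl⟩, ht⟩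
  have hb' : f b ≤ 0 := hb
  have hpos : ∀ s ∈ Ico x b, 0 < f s := by
    intro s hs
    by_contra hcon
    exact absurd (hleast ⟨⟨hs.1, hs.2.le.trans hbt⟩, not_lt.1 hcon⟩) (not_le.2 hs.2)
  have hne : x ≠ b := by rintro rfl; linarith
  have hlt : x < b := lt_of_le_of_ne hxb hne
  refine ⟨b, hlt, hbt, le_antisymm hb' ?_, hpos⟩
  have : b ∈ closure (Ico x b) := by rw [closure_Ico hne]; exact right_mem_Icc.2 hxb
  exact closure_minimal (fun s hs => (hpos s hs).le) (isClosed_le continuous_const hf) this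

theorem HasDerivAt.exists_pos_right {f : ℝ → ℝ} {c a : ℝ} (hf : HasDerivAt f c a) (hc : 0 < c)
    (ha : f a = 0) : ∃ ε > 0, ∀ t ∈ Ioo a (a + ε), 0 < f t := by
  have h := (hasDerivAt_iff_tendsto_slope.1 hf).eventually (lt_mem_nhds hc)
  rw [eventually_nhdsWithin_iff, Metric.eventually_nhds_iff] at h
  obtain ⟨ε, hε, h⟩ := h
  refine ⟨ε, hε, fun t ht => ?_⟩
  have h1 := h (y := t) (by rw [Real.dist_eq, abs_lt]; constructor <;> linarith [ht.1, ht.2])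
    (by simpa using ht.1.ne')
  rw [slope_def_field, ha, sub_zero] at h1
  exact (div_pos_iff_of_pos_right (by linarith [ht.1])).1 h1

theorem HasDerivAt.nonneg_of_nonneg_right {f : ℝ → ℝ} {c a b : ℝ} (hf : HasDerivAt f c a)
    (hab : a < b) (ha : f a = 0) (h : ∀ t ∈ Ioo a b, 0 ≤ f t) : 0 ≤ c := by
  by_contra hc
  obtain ⟨ε, hε, h1⟩ := hf.neg.exists_pos_right (by linarith) (by simp [ha])
  obtain ⟨t, ht⟩ : (Ioo a (min b (a + ε))).Nonempty :=
    nonempty_Ioo.2 (lt_min hab (by linarith))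
  have h2 := h1 t ⟨ht.1, ht.2.trans_le (min_le_right _ _)⟩
  have h3 := h t ⟨ht.1, ht.2.trans_le (min_le_left _ _)⟩
  simp only [Pi.neg_apply] at h2
  linarith

theorem HasDerivAt.nonpos_of_nonneg_left {f : ℝ → ℝ} {c a b : ℝ} (hf : HasDerivAt f c b)
    (hab : a < b) (hb : f b = 0) (h : ∀ t ∈ Ioo a b, 0 ≤ f t) : c ≤ 0 := by
  have h1 : HasDerivAt (fun t => f (-t)) (-c) (-b) := by
    have := HasDerivAt.scomp (-b) (by simpa using hf) (hasDerivAt_neg (-b))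
    simpa [Function.comp_def] using this
  have := h1.nonneg_of_nonneg_right (b := -a) (by linarith) (by simpa using hb)
    (fun t ht => h _ ⟨by linarith [ht.2], by linarith [ht.1]⟩)
  linarith

theorem eq_of_forall_hasDerivAt_zero {f : ℝ → ℝ} (hf : ∀ t, HasDerivAt f 0 t) (a b : ℝ) :
    f a = f b :=
  is_const_of_deriv_eq_zero (fun t => (hf t).differentiableAt) (fun t => (hf t).deriv) a b

theorem first_zero_unique {f : ℝ → ℝ} {z w : ℝ} (hz : 0 < z) (hw : 0 < w) (hz0 : f z = 0)
    (hw0 : f w = 0) (hzp : ∀ t ∈ Ioo 0 z, 0 < f t) (hwp : ∀ t ∈ Ioo 0 w, 0 < f t) : z = w := by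
  rcases lt_trichotomy z w with h | h | h
  · exact absurd hz0 (hwp z ⟨hz, h⟩).ne'
  · exact h
  · exact absurd hw0 (hzp w ⟨hw, h⟩).ne'

/-! ### Fundamental pairs of a second-order linear equation -/

/-- `S` is the solution of `S'' = T S' - D S` with `S 0 = 0`, `S' 0 = 1`, and `R` is its
derivative. -/
structure IsFundamental (T D : ℝ) (S R : ℝ → ℝ) : Prop where
  deriv_S : ∀ t, HasDerivAt S (R t) t
  deriv_R : ∀ t, HasDerivAt R (T * R t - D * S t) t
  S_zero : S 0 = 0
  R_zero : R 0 = 1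

/-- The factor `exp (T t / 2)` removes the first-order term and leaves `s'' = (T ^ 2 / 4 - D) s`,
which sine, identity or hyperbolic sine solves according to the sign of the coefficient. -/
theorem exists_isFundamental_of_pair {T D : ℝ} {s c : ℝ → ℝ} (hs : ∀ t, HasDerivAt s (c t) t)
    (hc : ∀ t, HasDerivAt c ((T ^ 2 / 4 - D) * s t) t) (hs0 : s 0 = 0) (hc0 : c 0 = 1) :
    ∃ S R, IsFundamental T D S R := by
  have he : ∀ t, HasDerivAt (fun t => Real.exp (T / 2 * t)) (T / 2 * Real.exp (T / 2 * t)) t := by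
    intro t
    have := ((hasDerivAt_id t).const_mul (T / 2)).exp
    simpa [mul_comm] using this
  refine ⟨fun t => Real.exp (T / 2 * t) * s t,
    fun t => Real.exp (T / 2 * t) * (c t + T / 2 * s t), ?_, ?_, by simp [hs0], by simp [hs0, hc0]⟩
  · intro t
    refine HasDerivAt.congr_deriv ((he t).mul (hs t)) ?_; ring
  · intro t
    refine HasDerivAt.congr_deriv ((he t).mul ((hc t).add ((hs t).const_mul (T / 2)))) ?_
    ring

theorem exists_isFundamental (T D : ℝ) : ∃ S R, IsFundamental T D S R := by
  rcases lt_trichotomy (T ^ 2 / 4 - D) 0 with hd | hd | hd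
  · set w := Real.sqrt (-(T ^ 2 / 4 - D)) with hw
    have hw0 : 0 < w := Real.sqrt_pos.2 (by linarith)
    have hw2 : w ^ 2 = -(T ^ 2 / 4 - D) := Real.sq_sqrt (by linarith)
    have hl : ∀ t, HasDerivAt (fun t => w * t) w t := fun t => by
      simpa using (hasDerivAt_id t).const_mul w
    refine exists_isFundamental_of_pair (s := fun t => Real.sin (w * t) / w)
      (c := fun t => Real.cos (w * t)) (fun t => ?_) (fun t => ?_) (by simp) (by simp)
    · refine HasDerivAt.congr_deriv (((hl t).sin).div_const w) ?_; field_simp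
    · refine HasDerivAt.congr_deriv ((hl t).cos) ?_
      rw [show T ^ 2 / 4 - D = - w ^ 2 by linarith]; field_simp
  · refine exists_isFundamental_of_pair (s := fun t => t)
      (c := fun _ => 1) (fun t => hasDerivAt_id t) (fun t => ?_) (by simp) (by simp)
    rw [hd, zero_mul]; exact hasDerivAt_const t 1
  · set w := Real.sqrt (T ^ 2 / 4 - D) with hw
    have hw0 : 0 < w := Real.sqrt_pos.2 (by linarith)
    have hw2 : w ^ 2 = T ^ 2 / 4 - D := Real.sq_sqrt (by linarith)
    have hl : ∀ t, HasDerivAt (fun t => w * t) w t := fun t => by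
      simpa using (hasDerivAt_id t).const_mul w
    refine exists_isFundamental_of_pair (s := fun t => Real.sinh (w * t) / w)
      (c := fun t => Real.cosh (w * t)) (fun t => ?_) (fun t => ?_) (by simp) (by simp)
    · refine HasDerivAt.congr_deriv (((hl t).sinh).div_const w) ?_; field_simp
    · refine HasDerivAt.congr_deriv ((hl t).cosh) ?_
      rw [show T ^ 2 / 4 - D = w ^ 2 by linarith]; field_simp

theorem hasDerivAt_exp_mul (T t : ℝ) :
    HasDerivAt (fun t => Real.exp (T * t)) (T * Real.exp (T * t)) t := by
  have := ((hasDerivAt_id t).const_mul T).exp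
  simpa [mul_comm] using this

namespace IsFundamental

variable {T D : ℝ} {S R : ℝ → ℝ}

theorem continuous_S (hS : IsFundamental T D S R) : Continuous S :=
  continuous_iff_continuousAt.2 fun t => (hS.deriv_S t).continuousAt

theorem continuous_R (hS : IsFundamental T D S R) : Continuous R :=
  continuous_iff_continuousAt.2 fun t => (hS.deriv_R t).continuousAt

/-- Liouville's formula: up to sign the left side is the Wronskian of `S` and `R`, so its product
with `exp (-T t)` is constant. -/
theorem wronskian (hS : IsFundamental T D S R) (t : ℝ) :
    R t ^ 2 - T * R t * S t + D * S t ^ 2 = Real.exp (T * t) := by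
  have h := eq_of_forall_hasDerivAt_zero
    (f := fun t => Real.exp (-T * t) * (R t ^ 2 - T * R t * S t + D * S t ^ 2)) (fun s => by
      refine HasDerivAt.congr_deriv ((hasDerivAt_exp_mul (-T) s).mul ((((hS.deriv_R s).pow 2).sub
        (((hS.deriv_R s).const_mul T).mul (hS.deriv_S s))).add
          (((hS.deriv_S s).pow 2).const_mul D))) ?_
      push_cast
      ring) t 0
  simp only [hS.S_zero, hS.R_zero, mul_zero, Real.exp_zero] at h
  have h2 : Real.exp (T * t) * Real.exp (-T * t) = 1 := by
    rw [← Real.exp_add]; simp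
  calc _ = (Real.exp (T * t) * Real.exp (-T * t)) *
        (R t ^ 2 - T * R t * S t + D * S t ^ 2) := by rw [h2, one_mul]
    _ = _ := by rw [mul_assoc, h]; ring

theorem R_ne_zero (hS : IsFundamental T D S R) {t : ℝ} (ht : S t = 0) : R t ≠ 0 := by
  intro h
  have := hS.wronskian t
  rw [h, ht] at this
  have h2 := Real.exp_pos (T * t)
  norm_num at this
  linarith

/-- The expression in `S (t + s - x)`, `R (t + s - x)`, `S x`, `R x` used here has derivative zero
in `x`; its values at `x = 0` and `x = s` are the two sides. -/
theorem S_add (hS : IsFundamental T D S R) (t s : ℝ) :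
    S (t + s) = S t * R s + (R t - T * S t) * S s := by
  have hl : ∀ x, HasDerivAt (fun x => t + s - x) (-1) x := fun x => by
    simpa using (hasDerivAt_id x).const_sub (t + s)
  have h := eq_of_forall_hasDerivAt_zero
    (f := fun x => S (t + s - x) * R x + (R (t + s - x) - T * S (t + s - x)) * S x) (fun x => by
      have h1 := (hS.deriv_S (t + s - x)).comp x (hl x)
      have h2 := (hS.deriv_R (t + s - x)).comp x (hl x)
      refine HasDerivAt.congr_deriv ((h1.mul (hS.deriv_R x)).add ((h2.sub (h1.const_mul T)).mul (hS.deriv_S x))) ?_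
      simp only [Function.comp_apply, Pi.sub_apply]
      ring) 0 s
  simpa [hS.S_zero, hS.R_zero] using h

theorem R_add (hS : IsFundamental T D S R) (t s : ℝ) :
    R (t + s) = S t * (T * R s - D * S s) + (R t - T * S t) * R s := by
  have hl : ∀ x, HasDerivAt (fun x => t + s - x) (-1) x := fun x => by
    simpa using (hasDerivAt_id x).const_sub (t + s)
  have h := eq_of_forall_hasDerivAt_zero
    (f := fun x => S (t + s - x) * (T * R x - D * S x)
      + (R (t + s - x) - T * S (t + s - x)) * R x) (fun x => by
      have h1 := (hS.deriv_S (t + s - x)).comp x (hl x)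
      have h2 := (hS.deriv_R (t + s - x)).comp x (hl x)
      refine HasDerivAt.congr_deriv ((h1.mul (((hS.deriv_R x).const_mul T).sub ((hS.deriv_S x).const_mul D))).add
        ((h2.sub (h1.const_mul T)).mul (hS.deriv_R x))) ?_
      simp only [Function.comp_apply, Pi.sub_apply]
      ring) 0 s
  simp only [sub_zero, hS.S_zero, hS.R_zero, add_sub_cancel_right] at h
  linarith

theorem S_add_of_zero (hS : IsFundamental T D S R) {s : ℝ} (hs : S s = 0) (t : ℝ) :
    S (t + s) = R s * S t := by rw [hS.S_add, hs]; ring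

theorem R_add_of_zero (hS : IsFundamental T D S R) {s : ℝ} (hs : S s = 0) (t : ℝ) :
    R (t + s) = R s * R t := by rw [hS.R_add, hs]; ring

theorem exists_pos_near_zero (hS : IsFundamental T D S R) :
    ∃ ε > 0, ∀ t ∈ Ioo 0 ε, 0 < S t := by
  have h := (hS.deriv_S 0).exists_pos_right (by rw [hS.R_zero]; exact one_pos) hS.S_zero
  simpa using h

/-- Either `S` has no positive zero or it has a first one. -/
theorem pos_or_first_zero (hS : IsFundamental T D S R) :
    (∀ t, 0 < t → 0 < S t) ∨ ∃ z, 0 < z ∧ S z = 0 ∧ ∀ t ∈ Ioo 0 z, 0 < S t := by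
  by_cases hpos : ∀ t, 0 < t → 0 < S t
  · exact Or.inl hpos
  · right
    push Not at hpos
    obtain ⟨t, ht, hSt⟩ := hpos
    obtain ⟨ε, hε, hε2⟩ := hS.exists_pos_near_zero
    have hm : 0 < min ε t / 2 := half_pos (lt_min hε ht)
    have hmε : min ε t / 2 < ε := (half_lt_self (lt_min hε ht)).trans_le (min_le_left _ _)
    have hmt : min ε t / 2 < t := (half_lt_self (lt_min hε ht)).trans_le (min_le_right _ _)
    obtain ⟨z, hz, -, hz0, hz1⟩ := exists_first_zero hS.continuous_S
      (hε2 _ ⟨hm, hmε⟩) hmt.le hSt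
    refine ⟨z, hm.trans hz, hz0, fun s hs => ?_⟩
    rcases lt_or_ge s (min ε t / 2) with h | h
    · exact hε2 _ ⟨hs.1, h.trans hmε⟩
    · exact hz1 _ ⟨h, hs.2⟩

theorem R_neg_of_first_zero (hS : IsFundamental T D S R) {z : ℝ} (hz : 0 < z) (hz0 : S z = 0)
    (hpos : ∀ t ∈ Ioo 0 z, 0 < S t) : R z < 0 :=
  lt_of_le_of_ne ((hS.deriv_S z).nonpos_of_nonneg_left hz hz0 fun t ht => (hpos t ht).le)
    (hS.R_ne_zero hz0)

/-- A zero at which `S` has not yet been negative is the first zero. -/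
theorem first_zero_of_nonneg (hS : IsFundamental T D S R) {z : ℝ}
    (hnn : ∀ t ∈ Icc 0 z, 0 ≤ S t) : ∀ t ∈ Ioo 0 z, 0 < S t := by
  intro t ht
  refine lt_of_le_of_ne (hnn t ⟨ht.1.le, ht.2.le⟩) fun h => ?_
  have h1 := (hS.deriv_S t).nonneg_of_nonneg_right ht.2 h.symm
    fun s hs => hnn s ⟨(ht.1.trans hs.1).le, hs.2.le⟩
  have h2 := (hS.deriv_S t).nonpos_of_nonneg_left ht.1 h.symm
    fun s hs => hnn s ⟨hs.1.le, (hs.2.trans ht.2).le⟩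
  exact hS.R_ne_zero h.symm (le_antisymm h2 h1)

/-- The end slopes of an excursion are `h g / S` and `-h exp (T t) k / S`, with this function as `g`
and the one in `deriv_k` as `k`. Both derivatives have the sign of `D * S`, which is how the signs
of the slopes are controlled. -/
theorem deriv_g (hS : IsFundamental T D S R) (t : ℝ) :
    HasDerivAt (fun t => 1 - R t + T * S t) (D * S t) t := by
  refine HasDerivAt.congr_deriv (((hS.deriv_R t).const_sub 1).add ((hS.deriv_S t).const_mul T)) ?_
  ring

theorem deriv_k (hS : IsFundamental T D S R) (t : ℝ) :
    HasDerivAt (fun t => 1 - Real.exp (-T * t) * R t) (Real.exp (-T * t) * (D * S t)) t := by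
  refine HasDerivAt.congr_deriv (((hasDerivAt_exp_mul (-T) t).mul (hS.deriv_R t)).const_sub 1) ?_
  ring

theorem k_eq (T r t : ℝ) : Real.exp (T * t) - r =
    Real.exp (T * t) * (1 - Real.exp (-T * t) * r) := by
  have h2 : Real.exp (T * t) * Real.exp (-T * t) = 1 := by
    rw [← Real.exp_add]; simp
  rw [mul_sub, ← mul_assoc, h2]; ring

end IsFundamental

/-! ### Excursions and the monotonicity of their end slopes -/

/-- The function `t ↦ m₀ S t + h (R t - T S t - 1)` is the level along an orbit that starts at
level zero with slope `m₀`, where `-h` is the level of the equilibrium. An excursion of duration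
`τ` stays at nonnegative level and comes back to level zero with slope `m₁`. -/
structure IsExcursion (T D h : ℝ) (S R : ℝ → ℝ) (τ m₀ m₁ : ℝ) : Prop where
  pos : 0 < τ
  nonneg : ∀ t ∈ Icc 0 τ, 0 ≤ m₀ * S t + h * (R t - T * S t - 1)
  zero : m₀ * S τ + h * (R τ - T * S τ - 1) = 0
  slope : m₁ = m₀ * R τ - h * D * S τ
  start_nonneg : 0 ≤ m₀
  end_nonpos : m₁ ≤ 0
  ne : m₀ ≠ m₁

namespace IsExcursion

variable {T D h : ℝ} {S R : ℝ → ℝ} {τ m₀ m₁ : ℝ}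

/-- With the equilibrium on the line the level is `m₀ * S`, so the duration does not depend on `m₀`.
-/
theorem first_zero_of_h_eq_zero (hS : IsFundamental T D S R) (e : IsExcursion T D 0 S R τ m₀ m₁) :
    S τ = 0 ∧ ∀ t ∈ Ioo 0 τ, 0 < S t := by
  have hm : 0 < m₀ := by
    refine lt_of_le_of_ne e.start_nonneg fun h0 => e.ne ?_
    rw [e.slope, ← h0]; ring
  have hz : S τ = 0 := by
    have := e.zero
    rw [zero_mul, add_zero] at this
    exact (mul_eq_zero.1 this).resolve_left hm.ne'
  refine ⟨hz, hS.first_zero_of_nonneg fun t ht => ?_⟩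
  have := e.nonneg t ht
  rw [zero_mul, add_zero] at this
  exact nonneg_of_mul_nonneg_right this hm

/-- If `S τ = 0`, the level condition forces `R τ = 1`; then both end slopes agree, against `ne`. -/
theorem S_ne_zero (hh : h ≠ 0) (e : IsExcursion T D h S R τ m₀ m₁) :
    S τ ≠ 0 := by
  intro hz
  have h1 := e.zero
  rw [hz] at h1
  have hR : R τ = 1 := by
    have : h * (R τ - 1) = 0 := by linarith
    linarith [(mul_eq_zero.1 this).resolve_left hh]
  exact e.ne (by rw [e.slope, hz, hR]; ring)

theorem start_eq (e : IsExcursion T D h S R τ m₀ m₁) (hz : S τ ≠ 0) :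
    m₀ = h * (1 - R τ + T * S τ) / S τ := by
  rw [eq_div_iff hz]; linarith [e.zero]

theorem end_eq (hS : IsFundamental T D S R) (e : IsExcursion T D h S R τ m₀ m₁) (hz : S τ ≠ 0) :
    m₁ = -(h * (Real.exp (T * τ) - R τ) / S τ) := by
  rw [e.slope, e.start_eq hz, ← hS.wronskian]
  field_simp
  ring

/-- For a saddle, `exp (-T t) * R t` would grow from `1` while `S` is positive, whereas `R` is
negative at the first zero of `S`. -/
theorem D_pos_of_zero (hS : IsFundamental T D S R) (hD : D ≠ 0) {z : ℝ} (hz : 0 < z)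
    (hz0 : S z = 0) (hp : ∀ t ∈ Ioo 0 z, 0 < S t) : 0 < D := by
  by_contra hcon
  have hD' : D < 0 := lt_of_le_of_ne (not_lt.1 hcon) hD
  have hmono : MonotoneOn (fun t => -(1 - Real.exp (-T * t) * R t)) (Icc 0 z) := by
    refine monotoneOn_of_hasDerivWithinAt_nonneg (convex_Icc 0 z)
      (fun t _ => (hS.deriv_k t).neg.continuousAt.continuousWithinAt)
      (fun t _ => (hS.deriv_k t).neg.hasDerivWithinAt) fun t ht => ?_
    rw [interior_Icc] at ht
    have h1 : D * S t ≤ 0 := mul_nonpos_of_nonpos_of_nonneg hD'.le (hp t ht).le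
    have h2 := mul_nonpos_of_nonneg_of_nonpos (Real.exp_pos (-T * t)).le h1
    linarith
  have h1 := hmono ⟨le_rfl, hz.le⟩ ⟨hz.le, le_rfl⟩ hz.le
  simp only [hS.R_zero, mul_zero, Real.exp_zero] at h1
  have h2 := hS.R_neg_of_first_zero hz hz0 hp
  have h3 := mul_neg_of_pos_of_neg (Real.exp_pos (-T * z)) h2
  linarith

/-- At the first zero of `S` the level is `h * (R z - 1)`, which is negative. -/
theorem lt_first_zero (hS : IsFundamental T D S R) (hh : 0 < h) {z : ℝ} (hz : 0 < z)
    (hz0 : S z = 0) (hp : ∀ t ∈ Ioo 0 z, 0 < S t) (e : IsExcursion T D h S R τ m₀ m₁) : τ < z := by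
  by_contra hcon
  have h1 := e.nonneg z ⟨hz.le, not_lt.1 hcon⟩
  have h2 := hS.R_neg_of_first_zero hz hz0 hp
  rw [hz0] at h1
  nlinarith

theorem g_pos (hS : IsFundamental T D S R) (hD : 0 < D) {z : ℝ}
    (hp : ∀ t ∈ Ioo 0 z, 0 < S t) {t : ℝ} (ht : t ∈ Ioc 0 z) : 0 < 1 - R t + T * S t := by
  have hmono : StrictMonoOn (fun t => 1 - R t + T * S t) (Icc 0 z) := by
    refine strictMonoOn_of_hasDerivWithinAt_pos (convex_Icc 0 z)
      (fun t _ => (hS.deriv_g t).continuousAt.continuousWithinAt)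
      (fun t _ => (hS.deriv_g t).hasDerivWithinAt) fun t ht => ?_
    rw [interior_Icc] at ht
    exact mul_pos hD (hp t ht)
  have h1 := hmono ⟨le_rfl, ht.1.le.trans ht.2⟩ ⟨ht.1.le, ht.2⟩ ht.1
  simpa [hS.S_zero, hS.R_zero] using h1

theorem g_neg (hS : IsFundamental T D S R) (hD : D < 0) {z : ℝ}
    (hp : ∀ t ∈ Ioo 0 z, 0 < S t) {t : ℝ} (ht : t ∈ Ioc 0 z) : 1 - R t + T * S t < 0 := by
  have hmono : StrictAntiOn (fun t => 1 - R t + T * S t) (Icc 0 z) := by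
    refine strictAntiOn_of_hasDerivWithinAt_neg (convex_Icc 0 z)
      (fun t _ => (hS.deriv_g t).continuousAt.continuousWithinAt)
      (fun t _ => (hS.deriv_g t).hasDerivWithinAt) fun t ht => ?_
    rw [interior_Icc] at ht
    exact mul_neg_of_neg_of_pos hD (hp t ht)
  have h1 := hmono ⟨le_rfl, ht.1.le.trans ht.2⟩ ⟨ht.1.le, ht.2⟩ ht.1
  simpa [hS.S_zero, hS.R_zero] using h1

theorem k_pos (hS : IsFundamental T D S R) (hD : 0 < D) {z : ℝ}
    (hp : ∀ t ∈ Ioo 0 z, 0 < S t) {t : ℝ} (ht : t ∈ Ioc 0 z) : 0 < Real.exp (T * t) - R t := by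
  have hmono : StrictMonoOn (fun t => 1 - Real.exp (-T * t) * R t) (Icc 0 z) := by
    refine strictMonoOn_of_hasDerivWithinAt_pos (convex_Icc 0 z)
      (fun t _ => (hS.deriv_k t).continuousAt.continuousWithinAt)
      (fun t _ => (hS.deriv_k t).hasDerivWithinAt) fun t ht => ?_
    rw [interior_Icc] at ht
    exact mul_pos (Real.exp_pos _) (mul_pos hD (hp t ht))
  have h1 := hmono ⟨le_rfl, ht.1.le.trans ht.2⟩ ⟨ht.1.le, ht.2⟩ ht.1
  rw [IsFundamental.k_eq]
  refine mul_pos (Real.exp_pos _) ?_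
  simpa [hS.R_zero] using h1

theorem k_neg (hS : IsFundamental T D S R) (hD : D < 0) {z : ℝ}
    (hp : ∀ t ∈ Ioo 0 z, 0 < S t) {t : ℝ} (ht : t ∈ Ioc 0 z) : Real.exp (T * t) - R t < 0 := by
  have hmono : StrictAntiOn (fun t => 1 - Real.exp (-T * t) * R t) (Icc 0 z) := by
    refine strictAntiOn_of_hasDerivWithinAt_neg (convex_Icc 0 z)
      (fun t _ => (hS.deriv_k t).continuousAt.continuousWithinAt)
      (fun t _ => (hS.deriv_k t).hasDerivWithinAt) fun t ht => ?_
    rw [interior_Icc] at ht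
    exact mul_neg_of_pos_of_neg (Real.exp_pos _) (mul_neg_of_neg_of_pos hD (hp t ht))
  have h1 := hmono ⟨le_rfl, ht.1.le.trans ht.2⟩ ⟨ht.1.le, ht.2⟩ ht.1
  rw [IsFundamental.k_eq]
  refine mul_neg_of_pos_of_neg (Real.exp_pos _) ?_
  simpa [hS.R_zero] using h1

/-- Up to `z` the level condition `m₀ * S τ = h * (1 - R τ + T * S τ)` would have a nonnegative left
side and a negative right side. -/
theorem first_zero_lt (hS : IsFundamental T D S R) (hh : h < 0) (hD : 0 < D) {z : ℝ}
    (hz0 : S z = 0) (hp : ∀ t ∈ Ioo 0 z, 0 < S t) (e : IsExcursion T D h S R τ m₀ m₁) : z < τ := by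
  by_contra hcon
  have hτ : τ ∈ Ioc 0 z := ⟨e.pos, not_lt.1 hcon⟩
  have hSτ : 0 ≤ S τ := by
    rcases hτ.2.lt_or_eq with h1 | h1
    · exact (hp τ ⟨e.pos, h1⟩).le
    · rw [h1, hz0]
  have h1 := g_pos hS hD hp hτ
  have h2 := mul_nonneg e.start_nonneg hSτ
  have h3 := mul_neg_of_neg_of_pos hh h1
  have := e.zero
  linarith

/-- A full turn `z + z` multiplies `S` and `R` by `r = R z ^ 2`. The nonnegative levels at the
instants `z + z` and `τ - (z + z)` bound `r` by one from above and from below. For `r = 1` both are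
interior zeros of a nonnegative level, so the slope vanishes there; by periodicity both end slopes
vanish, against `ne`. -/
theorem lt_two_mul_first_zero (hS : IsFundamental T D S R) (hh : h < 0) {z : ℝ}
    (hz : 0 < z) (hz0 : S z = 0) (e : IsExcursion T D h S R τ m₀ m₁) : τ < z + z := by
  by_contra hcon
  have h2z : S (z + z) = 0 := by rw [hS.S_add_of_zero hz0, hz0, mul_zero]
  have hR2 : R (z + z) = R z * R z := hS.R_add_of_zero hz0 z
  have hne : z + z ≠ τ := by
    intro h1
    exact e.S_ne_zero hh.ne (by rw [← h1, h2z])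
  have hlt : z + z < τ := lt_of_le_of_ne (not_lt.1 hcon) hne
  set r := R z * R z with hr
  have hr0 : 0 < r := mul_self_pos.2 (hS.R_ne_zero hz0)
  have hS' : ∀ t, S (t + (z + z)) = r * S t := fun t => by
    rw [hS.S_add_of_zero h2z, hR2]
  have hR' : ∀ t, R (t + (z + z)) = r * R t := fun t => by
    rw [hS.R_add_of_zero h2z, hR2]
  have hmem : τ - (z + z) ∈ Icc 0 τ := ⟨by linarith, by linarith⟩
  have h1 := e.nonneg (z + z) ⟨by linarith, hlt.le⟩
  rw [h2z, hR2] at h1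
  have h2 := e.nonneg _ hmem
  have h3 := e.zero
  have hSτ := hS' (τ - (z + z))
  have hRτ := hR' (τ - (z + z))
  rw [sub_add_cancel] at hSτ hRτ
  rw [hSτ, hRτ] at h3
  have hr1 : r = 1 := by nlinarith
  have hl : ∀ t, HasDerivAt (fun t => m₀ * S t + h * (R t - T * S t - 1))
      (m₀ * R t - h * D * S t) t := fun t => by
    refine HasDerivAt.congr_deriv (((hS.deriv_S t).const_mul m₀).add
      ((((hS.deriv_R t).sub ((hS.deriv_S t).const_mul T)).sub_const 1).const_mul h)) ?_
    ring
  have key : ∀ t ∈ Ioo 0 τ, m₀ * S t + h * (R t - T * S t - 1) = 0 →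
      m₀ * R t - h * D * S t = 0 := by
    intro t ht h0
    refine le_antisymm ((hl t).nonpos_of_nonneg_left ht.1 h0 fun s hs => ?_)
      ((hl t).nonneg_of_nonneg_right ht.2 h0 fun s hs => ?_)
    · exact e.nonneg s ⟨hs.1.le, (hs.2.trans ht.2).le⟩
    · exact e.nonneg s ⟨(ht.1.trans hs.1).le, hs.2.le⟩
  have k1 := key (z + z) ⟨by linarith, hlt⟩ (by rw [h2z, hR2, hr1]; ring)
  rw [h2z, hR2, hr1] at k1
  rw [hr1] at hSτ hRτ h3
  have k2 := key (τ - (z + z)) ⟨by linarith, by linarith⟩ (by linarith)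
  refine e.ne ?_
  rw [e.slope, hSτ, hRτ]
  linarith

/-- Any two excursions of one system have durations in an interval where `S` does not vanish. -/
theorem S_sign (hS : IsFundamental T D S R) (hD : D ≠ 0) (hh : h ≠ 0) {τ' m₀' m₁' : ℝ}
    (e : IsExcursion T D h S R τ m₀ m₁) (e' : IsExcursion T D h S R τ' m₀' m₁') :
    (∀ t ∈ Ioc 0 τ', 0 < S t) ∨ (0 < D ∧ h < 0 ∧ ∃ z, 0 < z ∧ z < τ ∧ S z = 0 ∧
      (∀ t ∈ Ioo 0 z, 0 < S t) ∧ ∀ t ∈ Ioc z τ', S t < 0) := by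
  rcases hS.pos_or_first_zero with hp | ⟨z, hz, hz0, hp⟩
  · exact Or.inl fun t ht => hp t ht.1
  · rcases lt_or_gt_of_ne hh with hh | hh
    · right
      have hDp := D_pos_of_zero hS hD hz hz0 hp
      refine ⟨hDp, hh, z, hz, e.first_zero_lt hS hh hDp hz0 hp, hz0, hp, fun t ht => ?_⟩
      have h1 := e'.lt_two_mul_first_zero hS hh hz hz0
      have h2 := hS.S_add_of_zero hz0 (t - z)
      rw [sub_add_cancel] at h2
      rw [h2]
      exact mul_neg_of_neg_of_pos (hS.R_neg_of_first_zero hz hz0 hp)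
        (hp _ ⟨by linarith [ht.1], by linarith [ht.2]⟩)
    · left
      have h1 := e'.lt_first_zero hS hh hz hz0 hp
      exact fun t ht => hp t ⟨ht.1, ht.2.trans_lt h1⟩

/-- The Wronskian identity collapses the numerator: the derivative of the start slope carries the
numerator of the end slope, and in `deriv_end` the roles are exchanged. Signs of the slopes
therefore give monotonicity. -/
theorem deriv_start (hS : IsFundamental T D S R) (h : ℝ) {t : ℝ} (ht : S t ≠ 0) :
    HasDerivAt (fun t => h * (1 - R t + T * S t) / S t)
      (h * (Real.exp (T * t) - R t) / S t ^ 2) t := by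
  refine HasDerivAt.congr_deriv (((hS.deriv_g t).const_mul h).div (hS.deriv_S t) ht) ?_
  rw [← hS.wronskian]
  ring

theorem deriv_end (hS : IsFundamental T D S R) (h : ℝ) {t : ℝ} (ht : S t ≠ 0) :
    HasDerivAt (fun t => -(h * (Real.exp (T * t) - R t) / S t))
      (-(Real.exp (T * t) * (h * (1 - R t + T * S t)) / S t ^ 2)) t := by
  refine HasDerivAt.congr_deriv (((((hasDerivAt_exp_mul T t).sub (hS.deriv_R t)).const_mul h).div
    (hS.deriv_S t) ht).neg) ?_
  simp only [Pi.sub_apply]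
  rw [← hS.wronskian]
  ring

/-- The slopes at both ends of an excursion, as functions of the duration, are monotone in
opposite directions. -/
theorem slopes_of_lt (hS : IsFundamental T D S R) (hD : D ≠ 0) (hh : h ≠ 0) {τ' m₀' m₁' : ℝ}
    (e : IsExcursion T D h S R τ m₀ m₁) (e' : IsExcursion T D h S R τ' m₀' m₁') (hlt : τ < τ') :
    (m₀ < m₀' ∧ m₁' < m₁) ∨ (m₀' < m₀ ∧ m₁ < m₁') := by
  have hz := e.S_ne_zero hh
  have hz' := e'.S_ne_zero hh
  have h0 := e.start_eq hz
  have h1 := e.end_eq hS hz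
  have h0' := e'.start_eq hz'
  have h1' := e'.end_eq hS hz'
  rcases e.S_sign hS hD hh e' with hp | ⟨hDp, hneg, z, hz, hzτ, hz0, hpz, hp⟩
  · left
    have hp' : ∀ t ∈ Ioo 0 τ', 0 < S t := fun t ht => hp t ⟨ht.1, ht.2.le⟩
    have hne : ∀ t ∈ Icc τ τ', S t ≠ 0 := fun t ht => (hp t ⟨e.pos.trans_le ht.1, ht.2⟩).ne'
    have hsgn : ∀ t ∈ Ioc 0 τ', 0 < h * (1 - R t + T * S t) ∧ 0 < h * (Real.exp (T * t) - R t) := by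
      have hSτ := hp τ ⟨e.pos, hlt.le⟩
      -- The nonnegative start slope forces `h` to have the sign of `D`, and this fixes both signs
      -- for all durations.
      have hnn : 0 ≤ h * (1 - R τ + T * S τ) := by
        have := mul_nonneg e.start_nonneg hSτ.le
        linarith [e.zero]
      intro t ht
      rcases lt_or_gt_of_ne hD with hD | hD
      · have hneg : h < 0 := by
          refine lt_of_le_of_ne ?_ hh
          exact nonpos_of_mul_nonneg_left hnn (g_neg hS hD hp' ⟨e.pos, hlt.le⟩)
        exact ⟨mul_pos_of_neg_of_neg hneg (g_neg hS hD hp' ht),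
          mul_pos_of_neg_of_neg hneg (k_neg hS hD hp' ht)⟩
      · have hpos : 0 < h := by
          refine lt_of_le_of_ne ?_ hh.symm
          exact nonneg_of_mul_nonneg_left hnn (g_pos hS hD hp' ⟨e.pos, hlt.le⟩)
        exact ⟨mul_pos hpos (g_pos hS hD hp' ht), mul_pos hpos (k_pos hS hD hp' ht)⟩
    have hmono := strictMonoOn_of_hasDerivWithinAt_pos (convex_Icc τ τ')
      (fun t ht => (deriv_start hS h (hne t ht)).continuousAt.continuousWithinAt)
      (fun t ht => (deriv_start hS h (hne t (interior_subset ht))).hasDerivWithinAt)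
      fun t ht => by
        have ht' := interior_subset ht
        exact div_pos (hsgn t ⟨e.pos.trans_le ht'.1, ht'.2⟩).2 (by have := hne t ht'; positivity)
    have hanti := strictAntiOn_of_hasDerivWithinAt_neg (convex_Icc τ τ')
      (fun t ht => (deriv_end hS h (hne t ht)).continuousAt.continuousWithinAt)
      (fun t ht => (deriv_end hS h (hne t (interior_subset ht))).hasDerivWithinAt)
      fun t ht => by
        have ht' := interior_subset ht
        exact neg_neg_of_pos (div_pos (mul_pos (Real.exp_pos _)
          (hsgn t ⟨e.pos.trans_le ht'.1, ht'.2⟩).1) (by have := hne t ht'; positivity))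
    have a0 := hmono ⟨le_rfl, hlt.le⟩ ⟨hlt.le, le_rfl⟩ hlt
    have a1 := hanti ⟨le_rfl, hlt.le⟩ ⟨hlt.le, le_rfl⟩ hlt
    rw [h0, h0', h1, h1']
    exact ⟨a0, a1⟩
  · right
    have hne : ∀ t ∈ Icc τ τ', S t ≠ 0 := fun t ht => (hp t ⟨hzτ.trans_le ht.1, ht.2⟩).ne
    have hSτ' := hp τ' ⟨hzτ.trans hlt, le_rfl⟩
    have hg : StrictAntiOn (fun t => 1 - R t + T * S t) (Icc τ τ') := by
      refine strictAntiOn_of_hasDerivWithinAt_neg (convex_Icc τ τ')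
        (fun t _ => (hS.deriv_g t).continuousAt.continuousWithinAt)
        (fun t _ => (hS.deriv_g t).hasDerivWithinAt) fun t ht => ?_
      rw [interior_Icc] at ht
      exact mul_neg_of_pos_of_neg hDp (hp t ⟨hzτ.trans ht.1, ht.2.le⟩)
    have hk : StrictAntiOn (fun t => 1 - Real.exp (-T * t) * R t) (Icc τ τ') := by
      refine strictAntiOn_of_hasDerivWithinAt_neg (convex_Icc τ τ')
        (fun t _ => (hS.deriv_k t).continuousAt.continuousWithinAt)
        (fun t _ => (hS.deriv_k t).hasDerivWithinAt) fun t ht => ?_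
      rw [interior_Icc] at ht
      exact mul_neg_of_pos_of_neg (Real.exp_pos _)
        (mul_neg_of_pos_of_neg hDp (hp t ⟨hzτ.trans ht.1, ht.2.le⟩))
    -- Past the first zero of `S` the signs are read off at the longer duration `τ'` only; both
    -- functions decrease, so they are positive on the rest of the interval.
    have hgτ : 0 ≤ 1 - R τ' + T * S τ' := by
      have h2 : h * (1 - R τ' + T * S τ') ≤ 0 := by
        have := mul_nonpos_of_nonneg_of_nonpos e'.start_nonneg hSτ'.le
        linarith [e'.zero]
      exact nonneg_of_mul_nonpos_right h2 hneg
    have hkτ : 0 ≤ 1 - Real.exp (-T * τ') * R τ' := by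
      have h2 : m₁' * S τ' = -(h * (Real.exp (T * τ') - R τ')) := by
        rw [h1']; field_simp
      have h3 := mul_nonneg_of_nonpos_of_nonpos e'.end_nonpos hSτ'.le
      have h4 : 0 ≤ Real.exp (T * τ') - R τ' :=
        nonneg_of_mul_nonpos_right (by linarith) hneg
      rw [IsFundamental.k_eq] at h4
      exact nonneg_of_mul_nonneg_right h4 (Real.exp_pos _)
    have hsgn : ∀ t ∈ Ioo τ τ', h * (1 - R t + T * S t) < 0 ∧ h * (Real.exp (T * t) - R t) < 0 := by
      intro t ht
      have a := hg ⟨ht.1.le, ht.2.le⟩ ⟨hlt.le, le_rfl⟩ ht.2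
      have b := hk ⟨ht.1.le, ht.2.le⟩ ⟨hlt.le, le_rfl⟩ ht.2
      simp only at a b
      refine ⟨mul_neg_of_neg_of_pos hneg (by linarith), mul_neg_of_neg_of_pos hneg ?_⟩
      rw [IsFundamental.k_eq]
      exact mul_pos (Real.exp_pos _) (by linarith)
    have hanti := strictAntiOn_of_hasDerivWithinAt_neg (convex_Icc τ τ')
      (fun t ht => (deriv_start hS h (hne t ht)).continuousAt.continuousWithinAt)
      (fun t ht => (deriv_start hS h (hne t (interior_subset ht))).hasDerivWithinAt)
      fun t ht => by
        have ht' := interior_subset ht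
        rw [interior_Icc] at ht
        exact div_neg_of_neg_of_pos (hsgn t ht).2 (by have := hne t ht'; positivity)
    have hmono := strictMonoOn_of_hasDerivWithinAt_pos (convex_Icc τ τ')
      (fun t ht => (deriv_end hS h (hne t ht)).continuousAt.continuousWithinAt)
      (fun t ht => (deriv_end hS h (hne t (interior_subset ht))).hasDerivWithinAt)
      fun t ht => by
        have ht' := interior_subset ht
        rw [interior_Icc] at ht
        exact neg_pos_of_neg (div_neg_of_neg_of_pos (mul_neg_of_pos_of_neg (Real.exp_pos _)
          (hsgn t ht).1) (by have := hne t ht'; positivity))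
    have a0 := hanti ⟨le_rfl, hlt.le⟩ ⟨hlt.le, le_rfl⟩ hlt
    have a1 := hmono ⟨le_rfl, hlt.le⟩ ⟨hlt.le, le_rfl⟩ hlt
    rw [h0, h0', h1, h1']
    exact ⟨a0, a1⟩

theorem duration_eq_of_start_eq (hS : IsFundamental T D S R) (hD : D ≠ 0) {τ' m₁' : ℝ}
    (e : IsExcursion T D h S R τ m₀ m₁) (e' : IsExcursion T D h S R τ' m₀ m₁') : τ = τ' := by
  rcases eq_or_ne h 0 with rfl | hh
  · exact first_zero_unique e.pos e'.pos (e.first_zero_of_h_eq_zero hS).1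
      (e'.first_zero_of_h_eq_zero hS).1 (e.first_zero_of_h_eq_zero hS).2
      (e'.first_zero_of_h_eq_zero hS).2
  · rcases lt_trichotomy τ τ' with h1 | h1 | h1
    · rcases e.slopes_of_lt hS hD hh e' h1 with h2 | h2 <;> exact absurd h2.1 (lt_irrefl _)
    · exact h1
    · rcases e'.slopes_of_lt hS hD hh e h1 with h2 | h2 <;> exact absurd h2.1 (lt_irrefl _)

/-- The plus half-map reverses order: for `h ≠ 0` the two end slopes are monotone in opposite
directions in the duration, and for `h = 0` the half-map is multiplication by `R τ < 0`. -/
theorem end_lt_of_start_lt (hS : IsFundamental T D S R) (hD : D ≠ 0) {τ' m₀' m₁' : ℝ}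
    (e : IsExcursion T D h S R τ m₀ m₁) (e' : IsExcursion T D h S R τ' m₀' m₁') (hlt : m₀ < m₀') :
    m₁' < m₁ := by
  rcases eq_or_ne h 0 with rfl | hh
  · have hτ := first_zero_unique e.pos e'.pos (e.first_zero_of_h_eq_zero hS).1
      (e'.first_zero_of_h_eq_zero hS).1 (e.first_zero_of_h_eq_zero hS).2
      (e'.first_zero_of_h_eq_zero hS).2
    have hR := hS.R_neg_of_first_zero e.pos (e.first_zero_of_h_eq_zero hS).1
      (e.first_zero_of_h_eq_zero hS).2
    rw [e.slope, e'.slope, ← hτ]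
    nlinarith
  · rcases lt_trichotomy τ τ' with h1 | h1 | h1
    · rcases e.slopes_of_lt hS hD hh e' h1 with h2 | h2
      · exact h2.2
      · exact absurd h2.1 hlt.not_gt
    · subst h1
      have hz := e.S_ne_zero hh
      rw [e.start_eq hz, e'.start_eq hz] at hlt
      exact absurd hlt (lt_irrefl _)
    · rcases e'.slopes_of_lt hS hD hh e h1 with h2 | h2
      · exact absurd h2.1 hlt.not_gt
      · exact h2.2

/-! ### The closing equation and the count of its zeros by Rolle's theorem -/

/-- The closing condition of a cycle, multiplied by `S`. -/
theorem closing_eq_zero (hS : IsFundamental T D S R) (hh : h ≠ 0)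
    (e : IsExcursion T D h S R τ m₀ m₁) {κ b : ℝ} (hc : m₀ + κ * m₁ = (1 + κ) * b) :
    h * (1 - R τ + T * S τ - κ * (Real.exp (T * τ) - R τ)) - (1 + κ) * b * S τ = 0 := by
  have hz := e.S_ne_zero hh
  rw [← hc, e.start_eq hz, e.end_eq hS hz]
  field_simp
  ring

theorem hasDerivAt_closing_quotient (hS : IsFundamental T D S R) (h κ b : ℝ) {t : ℝ}
    (ht : S t ≠ 0) :
    HasDerivAt (fun t => (h * (1 - R t + T * S t - κ * (Real.exp (T * t) - R t))
        - (1 + κ) * b * S t) / S t)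
      (((h * (D * S t - κ * (T * Real.exp (T * t) - (T * R t - D * S t))) - (1 + κ) * b * R t) * S t
        - (h * (1 - R t + T * S t - κ * (Real.exp (T * t) - R t)) - (1 + κ) * b * S t) * R t)
        / S t ^ 2) t :=
  ((((hS.deriv_g t).sub (((hasDerivAt_exp_mul T t).sub (hS.deriv_R t)).const_mul κ)).const_mul
    h).sub ((hS.deriv_S t).const_mul _)).div (hS.deriv_S t) ht

/-- For any `F`, the derivative of `exp (-T t) * (F' S - F S')` is `exp (-T t) * S * (F'' - T F' + D
F)`. The operator kills the `S` and `R` parts of `F` and multiplies `1` and `exp (T t)` by `D`. -/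
theorem hasDerivAt_closing_wronskian (hS : IsFundamental T D S R) (h κ b t : ℝ) :
    HasDerivAt (fun t => Real.exp (-T * t) *
      ((h * (D * S t - κ * (T * Real.exp (T * t) - (T * R t - D * S t))) - (1 + κ) * b * R t) * S t
        - (h * (1 - R t + T * S t - κ * (Real.exp (T * t) - R t)) - (1 + κ) * b * S t) * R t))
      (Real.exp (-T * t) * (h * D * S t * (1 - κ * Real.exp (T * t)))) t := by
  have hF := (((hS.deriv_g t).sub (((hasDerivAt_exp_mul T t).sub (hS.deriv_R t)).const_mul
    κ)).const_mul h).sub ((hS.deriv_S t).const_mul ((1 + κ) * b))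
  have hTR := ((hS.deriv_R t).const_mul T).sub ((hS.deriv_S t).const_mul D)
  have hF' := ((((hS.deriv_S t).const_mul D).sub ((((hasDerivAt_exp_mul T t).const_mul T).sub
    hTR).const_mul κ)).const_mul h).sub ((hS.deriv_R t).const_mul ((1 + κ) * b))
  refine HasDerivAt.congr_deriv ((hasDerivAt_exp_mul (-T) t).mul
    ((hF'.mul (hS.deriv_S t)).sub (hF.mul (hS.deriv_R t)))) ?_
  simp only [Pi.sub_apply]
  ring

/-- Four different excursions that close up exist only if the trace is zero and the other half-map
is an isometry. -/
theorem degenerate_of_four (hS : IsFundamental T D S R) (hD : D ≠ 0) (hh : h ≠ 0) {κ b : ℝ}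
    {τ m₀ m₁ : Fin 4 → ℝ} (e : ∀ i, IsExcursion T D h S R (τ i) (m₀ i) (m₁ i))
    (hc : ∀ i, m₀ i + κ * m₁ i = (1 + κ) * b) (hτ : StrictMono τ) : T = 0 ∧ κ = 1 := by
  have hne : ∀ t ∈ Icc (τ 0) (τ 3), S t ≠ 0 := by
    intro t ht
    rcases (e 0).S_sign hS hD hh (e 3) with hp | ⟨-, -, z, hz, hzτ, -, -, hp⟩
    · exact (hp t ⟨(e 0).pos.trans_le ht.1, ht.2⟩).ne'
    · exact (hp t ⟨hzτ.trans_le ht.1, ht.2⟩).ne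
  have hsub : ∀ i, τ i ∈ Icc (τ 0) (τ 3) := fun i =>
    ⟨hτ.monotone (Fin.zero_le i), hτ.monotone (Fin.le_last i)⟩
  -- `W` is the rescaled Wronskian of the closing function and `S`. Since `S` does not vanish
  -- between the durations, Rolle for the quotient gives a zero of `W` between any two of them.
  obtain ⟨W, hWd, hWs⟩ : ∃ W : ℝ → ℝ,
      (∀ t, HasDerivAt W (Real.exp (-T * t) * (h * D * S t * (1 - κ * Real.exp (T * t)))) t) ∧
      ∀ s, W s = Real.exp (-T * s) *
      ((h * (D * S s - κ * (T * Real.exp (T * s) - (T * R s - D * S s))) - (1 + κ) * b * R s) * S s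
        - (h * (1 - R s + T * S s - κ * (Real.exp (T * s) - R s)) - (1 + κ) * b * S s) * R s) :=
    ⟨_, hasDerivAt_closing_wronskian hS h κ b, fun _ => rfl⟩
  have hW : ∀ i j : Fin 4, i < j → ∃ s ∈ Ioo (τ i) (τ j), W s = 0 := by
    intro i j hij
    have hIcc : ∀ t ∈ Icc (τ i) (τ j), S t ≠ 0 := fun t ht =>
      hne t ⟨(hsub i).1.trans ht.1, ht.2.trans (hsub j).2⟩
    obtain ⟨s, hs, hs0⟩ := exists_hasDerivAt_eq_zero (hτ hij)
      (fun t ht => (hasDerivAt_closing_quotient hS h κ b (hIcc t ht)).continuousAt.continuousWithinAt)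
      (by rw [(e i).closing_eq_zero hS hh (hc i), (e j).closing_eq_zero hS hh (hc j)]; simp)
      (fun t ht => hasDerivAt_closing_quotient hS h κ b (hIcc t ⟨ht.1.le, ht.2.le⟩))
    refine ⟨s, hs, ?_⟩
    rw [hWs, (div_eq_zero_iff.1 hs0).resolve_right (pow_ne_zero 2 (hIcc s ⟨hs.1.le, hs.2.le⟩)), mul_zero]
  have hL : ∀ s t : ℝ, τ 0 ≤ s → t ≤ τ 3 → s < t → W s = 0 → W t = 0 → ∃ x ∈ Ioo s t,
      κ * Real.exp (T * x) = 1 := by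
    intro s t h0 h3 hst hs ht
    obtain ⟨x, hx, hx0⟩ := exists_hasDerivAt_eq_zero hst
      (fun u _ => (hWd u).continuousAt.continuousWithinAt)
      (hs.trans ht.symm) (fun u _ => hWd u)
    refine ⟨x, hx, ?_⟩
    have h1 := (mul_eq_zero.1 hx0).resolve_left (Real.exp_pos _).ne'
    have h2 := (mul_eq_zero.1 h1).resolve_left
      (mul_ne_zero (mul_ne_zero hh hD) (hne x ⟨h0.trans hx.1.le, hx.2.le.trans h3⟩))
    linarith
  obtain ⟨s₁, hs₁, hW₁⟩ := hW 0 1 (by decide)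
  obtain ⟨s₂, hs₂, hW₂⟩ := hW 1 2 (by decide)
  obtain ⟨s₃, hs₃, hW₃⟩ := hW 2 3 (by decide)
  obtain ⟨x, hx, hx1⟩ := hL s₁ s₂ hs₁.1.le (hs₂.2.le.trans (hsub 2).2) (hs₁.2.trans hs₂.1) hW₁ hW₂
  obtain ⟨y, hy, hy1⟩ := hL s₂ s₃ ((hsub 1).1.trans hs₂.1.le) hs₃.2.le (hs₂.2.trans hs₃.1) hW₂ hW₃
  have hκ : κ ≠ 0 := by rintro rfl; simp at hx1
  -- Two different solutions of `κ * exp (T x) = 1` exist only if `T = 0`, and then `κ = 1`.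
  have hxy : x < y := hx.2.trans hy.1
  have hexp : Real.exp (T * x) = Real.exp (T * y) := mul_left_cancel₀ hκ (hx1.trans hy1.symm)
  have hT : T = 0 := by
    have h1 := Real.exp_injective hexp
    have h2 : T * (x - y) = 0 := by linarith
    exact (mul_eq_zero.1 h2).resolve_right (by linarith)
  refine ⟨hT, ?_⟩
  rw [hT] at hx1
  simpa using hx1

/-- For `T = 0` and `κ = 1` the closing function collapses to `-2 * b * S`, and `S τ ≠ 0`. -/
theorem offset_eq_zero_of_degenerate (hS : IsFundamental 0 D S R) (hh : h ≠ 0)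
    (e : IsExcursion 0 D h S R τ m₀ m₁) {b : ℝ} (hc : m₀ + m₁ = (1 + 1) * b) : b = 0 := by
  have h1 := e.closing_eq_zero hS hh (κ := 1) (b := b) (by linarith)
  have hz := e.S_ne_zero hh
  simp only [zero_mul, Real.exp_zero] at h1
  have h2 : b * S τ = 0 := by linarith
  exact (mul_eq_zero.1 h2).resolve_right hz

end IsExcursion

/-! ### The flow of a planar linear system -/

/-- The flow of a linear system with equilibrium `q` in terms of a fundamental pair. -/
noncomputable def LinearSystem.flow (L : LinearSystem) (q : Plane) (S R : ℝ → ℝ) (t : ℝ)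
    (x : Plane) : Plane :=
  q + (S t • L.A *ᵥ (x - q) + (R t - L.A.trace * S t) • (x - q))

namespace LinearSystem

/-- Cayley–Hamilton; it is what makes `S • A + (R - trace * S) • 1` the exponential of `t • A`. -/
theorem mulVec_mulVec_eq (A : Matrix (Fin 2) (Fin 2) ℝ) (v : Plane) :
    A *ᵥ (A *ᵥ v) = A.trace • A *ᵥ v - A.det • v := by
  ext i
  fin_cases i <;>
    simp [mulVec, dotProduct, Fin.sum_univ_two, Matrix.trace_fin_two, Matrix.det_fin_two] <;> ring

theorem field_eq (L : LinearSystem) {q : Plane} (hq : L.field q = 0) (x : Plane) :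
    L.field x = L.A *ᵥ (x - q) := by
  unfold field at hq ⊢
  rw [mulVec_sub, eq_sub_iff_add_eq, add_assoc, add_comm L.b, hq, add_zero]

variable {L : LinearSystem} {q : Plane} {S R : ℝ → ℝ}

theorem field_flow (hq : L.field q = 0) (t : ℝ) (x : Plane) :
    L.field (L.flow q S R t x) = R t • L.A *ᵥ (x - q) - (L.A.det * S t) • (x - q) := by
  rw [L.field_eq hq, flow, add_sub_cancel_left, mulVec_add, mulVec_smul, mulVec_smul,
    mulVec_mulVec_eq]
  module

theorem flow_zero (hS : IsFundamental L.A.trace L.A.det S R) (x : Plane) :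
    L.flow q S R 0 x = x := by
  simp [flow, hS.S_zero, hS.R_zero]

theorem hasDerivAt_flow (hS : IsFundamental L.A.trace L.A.det S R) (hq : L.field q = 0)
    (x : Plane) (t : ℝ) :
    HasDerivAt (fun t => L.flow q S R t x) (L.field (L.flow q S R t x)) t := by
  rw [field_flow hq]
  refine HasDerivAt.congr_deriv ((((hS.deriv_S t).smul_const (L.A *ᵥ (x - q))).add
    (((hS.deriv_R t).sub ((hS.deriv_S t).const_mul L.A.trace)).smul_const (x - q))).const_add q) ?_
  module

theorem continuous_flow (hS : IsFundamental L.A.trace L.A.det S R) (q : Plane) :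
    Continuous fun y : ℝ × Plane => L.flow q S R y.1 y.2 := by
  have h1 := hS.continuous_S
  have h2 := hS.continuous_R
  unfold flow
  fun_prop

/-- A continuous curve that satisfies the equation off a countable set follows the flow. -/
theorem eq_flow (hS : IsFundamental L.A.trace L.A.det S R) (hq : L.field q = 0) {γ : ℝ → Plane}
    (hγ : Continuous γ) {a b : ℝ} {s : Set ℝ} (hs : s.Countable)
    (hd : ∀ t ∈ Ioo a b \ s, HasDerivAt γ (L.field (γ t)) t) :
    ∀ t ∈ Icc a b, γ t = L.flow q S R (t - a) (γ a) := by
  intro t ht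
  -- Variation of constants: `K u` is the flow for the remaining time `t - u` applied to `γ u - q`.
  -- Its derivative vanishes off `s`, and an integral ignores countably many exceptions, so `K a = K
  -- t`.
  set K : ℝ → Plane := fun u => S (t - u) • L.A *ᵥ (γ u - q) +
    (R (t - u) - L.A.trace * S (t - u)) • (γ u - q) with hK
  have hcont : Continuous K := by
    have h1 := hS.continuous_S
    have h2 := hS.continuous_R
    fun_prop
  have hder : ∀ u ∈ Ioo (min a t) (max a t) \ s, HasDerivAt K 0 u := by
    intro u hu
    rw [min_eq_left ht.1, max_eq_right ht.1] at hu
    have hγu := hd u ⟨⟨hu.1.1, hu.1.2.trans_le ht.2⟩, hu.2⟩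
    rw [L.field_eq hq] at hγu
    have hl : HasDerivAt (fun u => t - u) (-1) u := by simpa using (hasDerivAt_id u).const_sub t
    have h1 := (hS.deriv_S (t - u)).comp u hl
    have h2 := (hS.deriv_R (t - u)).comp u hl
    have h3 : HasDerivAt (fun u => γ u - q) (L.A *ᵥ (γ u - q)) u := hγu.sub_const q
    have h4 : HasDerivAt (fun u => L.A *ᵥ (γ u - q)) (L.A *ᵥ (L.A *ᵥ (γ u - q))) u :=
      (LinearMap.toContinuousLinearMap (Matrix.mulVecLin L.A)).hasFDerivAt.comp_hasDerivAt u h3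
    refine HasDerivAt.congr_deriv
      ((h1.smul h4).add ((h2.sub (h1.const_mul L.A.trace)).smul h3)) ?_
    rw [mulVec_mulVec_eq]
    simp only [Function.comp_apply, Pi.sub_apply]
    module
  have := MeasureTheory.integral_eq_of_hasDerivAt_off_countable K (fun _ => 0) hs
    hcont.continuousOn hder (by simp)
  simp only [intervalIntegral.integral_zero] at this
  have hKt : K t = γ t - q := by
    simp only [hK, sub_self, hS.S_zero, hS.R_zero, zero_smul, mul_zero, sub_zero, one_smul, zero_add]
  have h5 : γ t - q = K a := by rw [← hKt]; exact sub_eq_zero.1 this.symm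
  change γ t = q + K a
  rw [← h5]
  abel

end LinearSystem

/-! ### Level and slope along the flow; coordinates on the separation line -/

namespace PiecewiseLinearSystem

variable {Z : PiecewiseLinearSystem}

theorem continuous_level (Z : PiecewiseLinearSystem) : Continuous Z.level := by
  unfold level dotProduct
  fun_prop

theorem level_sub (Z : PiecewiseLinearSystem) (x q : Plane) :
    Z.n ⬝ᵥ (x - q) = Z.level x - Z.level q := by
  simp [level, dotProduct_sub]

section Flow

variable {L : LinearSystem} {q : Plane} {S R : ℝ → ℝ}

/-- This identifies the level along an arc with the function in `IsExcursion`, with `h = -Z.level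
q`. -/
theorem level_flow (hq : L.field q = 0) {x : Plane} (hx : Z.level x = 0) (t : ℝ) :
    Z.level (L.flow q S R t x) = (Z.n ⬝ᵥ L.field x) * S t +
      (-Z.level q) * (R t - L.A.trace * S t - 1) := by
  have h1 := Z.level_sub x q
  have h2 := Z.level_sub (L.flow q S R t x) q
  rw [LinearSystem.flow, add_sub_cancel_left, dotProduct_add, dotProduct_smul, dotProduct_smul,
    h1, hx] at h2
  rw [LinearSystem.flow, L.field_eq hq]
  simp only [smul_eq_mul] at h2
  linarith

theorem slope_flow (hq : L.field q = 0) {x : Plane} (hx : Z.level x = 0) (t : ℝ) :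
    Z.n ⬝ᵥ L.field (L.flow q S R t x) = (Z.n ⬝ᵥ L.field x) * R t -
      (-Z.level q) * L.A.det * S t := by
  rw [LinearSystem.field_flow hq, dotProduct_sub, dotProduct_smul, dotProduct_smul,
    ← L.field_eq hq, Z.level_sub, hx]
  simp only [smul_eq_mul]
  ring

end Flow

/-- A direction vector of the separation line. -/
def direction (Z : PiecewiseLinearSystem) : Plane := ![-Z.n 1, Z.n 0]

theorem exists_of_level_eq_zero {x p : Plane} (hx : Z.level x = 0) (hp : Z.level p = 0) :
    ∃ s : ℝ, x = p + s • Z.direction := by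
  have h := Z.level_sub x p
  rw [hx, hp] at h
  simp only [dotProduct, Fin.sum_univ_two, Pi.sub_apply] at h
  have hn : Z.n 0 ^ 2 + Z.n 1 ^ 2 ≠ 0 := by
    intro h0
    apply Z.n_ne_zero
    have h1 : Z.n 0 = 0 := by nlinarith [sq_nonneg (Z.n 0), sq_nonneg (Z.n 1)]
    have h2 : Z.n 1 = 0 := by nlinarith [sq_nonneg (Z.n 0), sq_nonneg (Z.n 1)]
    ext i; fin_cases i <;> simp [h1, h2]
  refine ⟨(-Z.n 1 * (x 0 - p 0) + Z.n 0 * (x 1 - p 1)) / (Z.n 0 ^ 2 + Z.n 1 ^ 2), ?_⟩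
  ext i
  fin_cases i
  · simp only [direction, Fin.zero_eta, Fin.isValue, Pi.add_apply, Pi.smul_apply, cons_val_zero,
      smul_eq_mul]
    field_simp
    linear_combination (Z.n 0) * h
  · simp only [direction, Fin.mk_one, Fin.isValue, Pi.add_apply, Pi.smul_apply, cons_val_one,
      smul_eq_mul]
    field_simp
    simp only [cons_val_fin_one]
    linear_combination (Z.n 1) * h

theorem n_direction : Z.n ⬝ᵥ Z.direction = 0 := by
  simp [direction, dotProduct, Fin.sum_univ_two]; ring

theorem level_add_smul_direction {p : Plane} (hp : Z.level p = 0) (s : ℝ) :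
    Z.level (p + s • Z.direction) = 0 := by
  have := Z.level_sub (p + s • Z.direction) p
  rw [add_sub_cancel_left, dotProduct_smul, n_direction, hp] at this
  simpa using this.symm

/-- The minus system has its equilibrium `p` on the separation line, the plus system has its
equilibrium at `q`, and `Sm`, `Rm`, `Sp`, `Rp` are the fundamental pairs of both systems. -/
structure IsFramed (Z : PiecewiseLinearSystem) (p q : Plane) (Sm Rm Sp Rp : ℝ → ℝ) : Prop where
  level_p : Z.level p = 0
  minus_p : Z.minus.field p = 0
  plus_q : Z.plus.field q = 0
  det_minus : Z.minus.A.det ≠ 0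
  det_plus : Z.plus.A.det ≠ 0
  fund_minus : IsFundamental Z.minus.A.trace Z.minus.A.det Sm Rm
  fund_plus : IsFundamental Z.plus.A.trace Z.plus.A.det Sp Rp

/-- The rate of change of the normal component of the minus field along the line. -/
noncomputable def minusRate (Z : PiecewiseLinearSystem) : ℝ :=
  Z.n ⬝ᵥ Z.minus.A *ᵥ Z.direction

/-- The ratio of the rates of change of the normal components of both fields along the line. -/
noncomputable def rateRatio (Z : PiecewiseLinearSystem) : ℝ :=
  (Z.n ⬝ᵥ Z.plus.A *ᵥ Z.direction) / Z.minusRate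

/-- The point of the line at which the minus field has normal component `μ`. -/
noncomputable def linePoint (Z : PiecewiseLinearSystem) (p : Plane) (μ : ℝ) : Plane :=
  p + (μ / Z.minusRate) • Z.direction

theorem continuous_linePoint (Z : PiecewiseLinearSystem) (p : Plane) :
    Continuous (Z.linePoint p) := by
  unfold linePoint
  fun_prop

namespace IsFramed

variable {p q : Plane} {Sm Rm Sp Rp : ℝ → ℝ}

theorem minus_slope (F : Z.IsFramed p q Sm Rm Sp Rp) (s : ℝ) :
    Z.n ⬝ᵥ Z.minus.field (p + s • Z.direction) = s * Z.minusRate := by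
  rw [Z.minus.field_eq F.minus_p, add_sub_cancel_left, mulVec_smul, dotProduct_smul, minusRate,
    smul_eq_mul]

theorem level_linePoint (F : Z.IsFramed p q Sm Rm Sp Rp) (μ : ℝ) :
    Z.level (Z.linePoint p μ) = 0 := level_add_smul_direction F.level_p _

theorem minus_linePoint (F : Z.IsFramed p q Sm Rm Sp Rp) (hr : Z.minusRate ≠ 0) (μ : ℝ) :
    Z.n ⬝ᵥ Z.minus.field (Z.linePoint p μ) = μ := by
  rw [linePoint, F.minus_slope, div_mul_cancel₀ _ hr]

theorem eq_linePoint (F : Z.IsFramed p q Sm Rm Sp Rp) (hr : Z.minusRate ≠ 0) {x : Plane}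
    (hx : Z.level x = 0) : x = Z.linePoint p (Z.n ⬝ᵥ Z.minus.field x) := by
  obtain ⟨s, rfl⟩ := exists_of_level_eq_zero hx F.level_p
  rw [F.minus_slope, linePoint, mul_div_cancel_right₀ _ hr]

theorem plus_linePoint (Z : PiecewiseLinearSystem) (p : Plane) (μ : ℝ) :
    Z.n ⬝ᵥ Z.plus.field (Z.linePoint p μ) = Z.rateRatio * μ + Z.n ⬝ᵥ Z.plus.field p := by
  have : Z.plus.field (Z.linePoint p μ) =
      (μ / Z.minusRate) • Z.plus.A *ᵥ Z.direction + Z.plus.field p := by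
    unfold LinearSystem.field linePoint
    rw [mulVec_add, mulVec_smul]; abel
  rw [this, dotProduct_add, dotProduct_smul, rateRatio, smul_eq_mul]
  ring

theorem minusRate_ne_zero (F : Z.IsFramed p q Sm Rm Sp Rp) {x : Plane} (hx : Z.level x = 0)
    (h : Z.n ⬝ᵥ Z.minus.field x ≠ 0) : Z.minusRate ≠ 0 := by
  obtain ⟨s, rfl⟩ := exists_of_level_eq_zero hx F.level_p
  rw [F.minus_slope] at h
  exact right_ne_zero_of_mul h

/-- If the plus field is tangent to the line everywhere, its equilibrium is on the line. -/
theorem level_q_eq_zero (F : Z.IsFramed p q Sm Rm Sp Rp) (hr : Z.minusRate ≠ 0)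
    (ha : Z.rateRatio = 0) (hb : Z.n ⬝ᵥ Z.plus.field p = 0) : Z.level q = 0 := by
  have h1 : Z.n ⬝ᵥ Z.plus.A *ᵥ Z.direction = 0 := (div_eq_zero_iff.1 ha).resolve_right hr
  rw [Z.plus.field_eq F.plus_q] at hb
  have h3 := Z.level_sub p q
  rw [F.level_p, zero_sub] at h3
  have hdet := F.det_plus
  rw [Matrix.det_fin_two] at hdet
  simp only [direction, mulVec, dotProduct, Fin.sum_univ_two, Pi.sub_apply, cons_val_zero,
    cons_val_one, cons_val_fin_one] at h1 hb h3
  set A := Z.plus.A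
  set c0 := Z.n 0 * A 0 0 + Z.n 1 * A 1 0 with hc0
  set c1 := Z.n 0 * A 0 1 + Z.n 1 * A 1 1 with hc1
  -- The row vector `c = n A` is parallel to `n` and annihilates `p - q`. Since `n ⬝ (p - q) =
  -- -level q`, a nonzero level would give `c = 0`, impossible for an invertible matrix.
  have e1 : c1 * Z.n 0 = c0 * Z.n 1 := by rw [hc0, hc1]; linarith
  have e2 : c0 * (p 0 - q 0) + c1 * (p 1 - q 1) = 0 := by rw [hc0, hc1]; linarith
  have e3 : c0 * Z.level q = 0 := by
    linear_combination (-Z.n 0) * e2 + (p 1 - q 1) * e1 + c0 * h3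
  have e4 : c1 * Z.level q = 0 := by
    linear_combination (-Z.n 1) * e2 - (p 0 - q 0) * e1 + c1 * h3
  by_contra hq
  have z0 := (mul_eq_zero.1 e3).resolve_right hq
  have z1 := (mul_eq_zero.1 e4).resolve_right hq
  apply Z.n_ne_zero
  have d0 : (A 0 0 * A 1 1 - A 0 1 * A 1 0) * Z.n 0 = 0 := by
    rw [hc0] at z0; rw [hc1] at z1
    linear_combination A 1 1 * z0 - A 1 0 * z1
  have d1 : (A 0 0 * A 1 1 - A 0 1 * A 1 0) * Z.n 1 = 0 := by
    rw [hc0] at z0; rw [hc1] at z1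
    linear_combination A 0 0 * z1 - A 0 1 * z0
  ext i
  fin_cases i
  · exact (mul_eq_zero.1 d0).resolve_left hdet
  · exact (mul_eq_zero.1 d1).resolve_left hdet

end IsFramed

end PiecewiseLinearSystem

/-! ### Decomposition of a periodic solution into turns -/

/-- A continuous function without zeros on an open interval has constant sign there. -/
theorem sign_on_Ioo {f : ℝ → ℝ} (hf : Continuous f) {a b : ℝ} (h : ∀ t ∈ Ioo a b, f t ≠ 0) :
    (∀ t ∈ Ioo a b, f t < 0) ∨ ∀ t ∈ Ioo a b, 0 < f t := by
  by_contra hcon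
  push Not at hcon
  obtain ⟨⟨s, hs, hs0⟩, t, ht, ht0⟩ := hcon
  obtain ⟨x, hx, hx0⟩ := isPreconnected_Ioo.intermediate_value ht hs hf.continuousOn ⟨ht0, hs0⟩
  exact h x hx hx0

namespace PiecewiseLinearSystem

namespace IsPeriodicSolution

variable {Z : PiecewiseLinearSystem} {γ : ℝ → Plane} {T : ℝ}

theorem zeros_finite (hγ : Z.IsPeriodicSolution γ T) (a b : ℝ) :
    {t | t ∈ Icc a b ∧ Z.level (γ t) = 0}.Finite := by
  have hT := hγ.period_pos
  refine ((finite_Icc ⌊a / T⌋ ⌊b / T⌋).biUnion fun j _ =>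
    hγ.finite_line.image fun t => t + j * T).subset ?_
  rintro t ⟨ht, h0⟩
  refine mem_iUnion₂.2 ⟨⌊t / T⌋, ⟨?_, ?_⟩, t - ⌊t / T⌋ * T, ⟨⟨?_, ?_⟩, ?_⟩, by ring⟩
  · exact Int.floor_mono (div_le_div_of_nonneg_right ht.1 hT.le)
  · exact Int.floor_mono (div_le_div_of_nonneg_right ht.2 hT.le)
  · have := (le_div_iff₀ hT).1 (Int.floor_le (t / T))
    linarith
  · have := (div_lt_iff₀ hT).1 (Int.lt_floor_add_one (t / T))
    linarith
  · rw [hγ.periodic.sub_int_mul_eq]; exact h0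

theorem zeros_countable (hγ : Z.IsPeriodicSolution γ T) :
    {t | Z.level (γ t) = 0}.Countable := by
  have : {t | Z.level (γ t) = 0} ⊆ ⋃ n : ℕ, {t | t ∈ Icc (-(n : ℝ)) n ∧ Z.level (γ t) = 0} := by
    intro t ht
    obtain ⟨n, hn⟩ := exists_nat_ge |t|
    exact mem_iUnion.2 ⟨n, abs_le.1 hn, ht⟩
  exact (countable_iUnion fun n => (hγ.zeros_finite _ _).countable).mono this

theorem continuous_level (hγ : Z.IsPeriodicSolution γ T) : Continuous fun t => Z.level (γ t) :=
  Z.continuous_level.comp hγ.continuous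

theorem right_sign (hγ : Z.IsPeriodicSolution γ T) (b : ℝ) : ∃ δ > 0,
    (∀ t ∈ Ioo b (b + δ), Z.level (γ t) < 0) ∨ ∀ t ∈ Ioo b (b + δ), 0 < Z.level (γ t) := by
  have hfin : ({t | t ∈ Icc b (b + 1) ∧ Z.level (γ t) = 0} \ {b}).Finite :=
    (hγ.zeros_finite b (b + 1)).subset sdiff_subset
  have hopen := hfin.isClosed.isOpen_compl
  obtain ⟨ε, hε, hball⟩ := Metric.isOpen_iff.1 hopen b (by simp)
  have hδ : 0 < min ε 1 := lt_min hε one_pos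
  refine ⟨min ε 1, hδ, sign_on_Ioo hγ.continuous_level fun t ht h0 => ?_⟩
  have hm : t ∈ Metric.ball b ε := by
    rw [Metric.mem_ball, Real.dist_eq, abs_lt]
    constructor <;> linarith [ht.1, ht.2, min_le_left ε 1]
  refine hball hm ⟨⟨⟨ht.1.le, ?_⟩, h0⟩, fun h => ht.1.ne' h⟩
  linarith [ht.2, min_le_right ε 1]

theorem exists_ge {P : Plane → Prop} (hγ : Z.IsPeriodicSolution γ T) (h : ∃ t, P (γ t)) (x : ℝ) :
    ∃ t, x ≤ t ∧ P (γ t) := by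
  obtain ⟨t, ht⟩ := h
  obtain ⟨n, hn⟩ := exists_nat_ge ((x - t) / T)
  refine ⟨t + n * T, ?_, by rwa [hγ.periodic.nat_mul n t]⟩
  have := (div_le_iff₀ hγ.period_pos).1 hn
  linarith

/-- The instant `a` is the beginning of an arc in the open minus half-plane. -/
def IsStart (Z : PiecewiseLinearSystem) (γ : ℝ → Plane) (a : ℝ) : Prop :=
  Z.level (γ a) = 0 ∧ ∃ δ > 0, ∀ t ∈ Ioo a (a + δ), Z.level (γ t) < 0

/-- The next start is the infimum of the later instants at negative level. Zeros touched from above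
on the way are not starts, which is why excursions are only required to stay at nonnegative level.
-/
theorem exists_next_start (hγ : Z.IsPeriodicSolution γ T) (hneg : ∃ t, Z.level (γ t) < 0) {x : ℝ}
    (hx : 0 < Z.level (γ x)) :
    ∃ c, x < c ∧ IsStart Z γ c ∧ ∀ t ∈ Icc x c, 0 ≤ Z.level (γ t) := by
  have hcont := hγ.continuous_level
  set E : Set ℝ := {t | x ≤ t ∧ Z.level (γ t) < 0} with hE
  have hne : E.Nonempty := hγ.exists_ge (P := fun y => Z.level y < 0) hneg x
  have hbdd : BddBelow E := ⟨x, fun t ht => ht.1⟩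
  set c := sInf E with hc
  have hxc' : x ≤ c := le_csInf hne fun t ht => ht.1
  have hc0 : Z.level (γ c) ≤ 0 := by
    have : c ∈ closure E := csInf_mem_closure hne hbdd
    exact closure_minimal (fun t ht => ht.2.le) (isClosed_le hcont continuous_const) this
  have hxc : x < c := lt_of_le_of_ne hxc' fun h => by rw [← h] at hc0; linarith
  have hnn : ∀ t ∈ Ico x c, 0 ≤ Z.level (γ t) := fun t ht => by
    by_contra hcon
    exact absurd (csInf_le hbdd ⟨ht.1, not_le.1 hcon⟩) (not_le.2 ht.2)
  have hc1 : 0 ≤ Z.level (γ c) := by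
    have : c ∈ closure (Ico x c) := by rw [closure_Ico hxc.ne]; exact right_mem_Icc.2 hxc'
    exact closure_minimal hnn (isClosed_le continuous_const hcont) this
  refine ⟨c, hxc, ⟨le_antisymm hc0 hc1, ?_⟩, fun t ht => ?_⟩
  · obtain ⟨δ, hδ, h | h⟩ := hγ.right_sign c
    · exact ⟨δ, hδ, h⟩
    · exfalso
      obtain ⟨t, ht, htc⟩ := exists_lt_of_csInf_lt hne (show c < c + δ by linarith)
      rcases (csInf_le hbdd ht).lt_or_eq with h1 | h1
      · exact absurd ht.2 (h t ⟨h1, htc⟩).not_gt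
      · have := ht.2
        rw [← h1] at this
        linarith
  · rcases ht.2.lt_or_eq with h1 | h1
    · exact hnn t ⟨ht.1, h1⟩
    · rw [h1]; exact hc1

theorem exists_minus_end (hγ : Z.IsPeriodicSolution γ T) (hpos : ∃ t, 0 < Z.level (γ t)) {a : ℝ}
    (ha : IsStart Z γ a) :
    ∃ b, a < b ∧ Z.level (γ b) = 0 ∧ ∀ t ∈ Ioo a b, Z.level (γ t) < 0 := by
  obtain ⟨-, δ, hδ, h⟩ := ha
  have hx := h (a + δ / 2) ⟨by linarith, by linarith⟩
  obtain ⟨t, hxt, ht⟩ := hγ.exists_ge (P := fun y => 0 < Z.level y) hpos (a + δ / 2)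
  obtain ⟨b, hb, -, hb0, hb1⟩ := exists_first_zero (f := fun t => -Z.level (γ t))
    hγ.continuous_level.neg (by linarith) hxt (by linarith)
  refine ⟨b, by linarith, by linarith, fun s hs => ?_⟩
  rcases lt_or_ge s (a + δ / 2) with h1 | h1
  · exact h s ⟨hs.1, by linarith⟩
  · linarith [hb1 s ⟨h1, hs.2⟩]

theorem minus_flow (hγ : Z.IsPeriodicSolution γ T) {q : Plane} {S R : ℝ → ℝ}
    (hS : IsFundamental Z.minus.A.trace Z.minus.A.det S R) (hq : Z.minus.field q = 0) {a b : ℝ}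
    (h : ∀ t ∈ Ioo a b, Z.level (γ t) ≤ 0) :
    ∀ t ∈ Icc a b, γ t = Z.minus.flow q S R (t - a) (γ a) :=
  LinearSystem.eq_flow hS hq hγ.continuous hγ.zeros_countable fun t ht =>
    hγ.minus_deriv t (lt_of_le_of_ne (h t ht.1) ht.2)

theorem plus_flow (hγ : Z.IsPeriodicSolution γ T) {q : Plane} {S R : ℝ → ℝ}
    (hS : IsFundamental Z.plus.A.trace Z.plus.A.det S R) (hq : Z.plus.field q = 0) {a b : ℝ}
    (h : ∀ t ∈ Ioo a b, 0 ≤ Z.level (γ t)) :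
    ∀ t ∈ Icc a b, γ t = Z.plus.flow q S R (t - a) (γ a) :=
  LinearSystem.eq_flow hS hq hγ.continuous hγ.zeros_countable fun t ht =>
    hγ.plus_deriv t (lt_of_le_of_ne (h t ht.1) (Ne.symm ht.2))

variable {p q : Plane} {Sm Rm Sp Rp : ℝ → ℝ}

/-- The minus equilibrium is on the line, so the level along the arc is `μ * Sm`: the duration is
the first zero of `Sm`, and the half-map multiplies slopes by `Rm`. -/
theorem minus_arc (hγ : Z.IsPeriodicSolution γ T) (F : Z.IsFramed p q Sm Rm Sp Rp) {a b : ℝ}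
    (hab : a < b) (ha : Z.level (γ a) = 0) (hb : Z.level (γ b) = 0)
    (h : ∀ t ∈ Ioo a b, Z.level (γ t) < 0) :
    Sm (b - a) = 0 ∧ (∀ t ∈ Ioo 0 (b - a), 0 < Sm t) ∧ Z.n ⬝ᵥ Z.minus.field (γ a) < 0 ∧
      Z.n ⬝ᵥ Z.minus.field (γ b) = Rm (b - a) * Z.n ⬝ᵥ Z.minus.field (γ a) := by
  have hfl := hγ.minus_flow F.fund_minus F.minus_p fun t ht => (h t ht).le
  set μ := Z.n ⬝ᵥ Z.minus.field (γ a) with hμ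
  have hlev : ∀ t ∈ Icc 0 (b - a), Z.level (γ (a + t)) = μ * Sm t := by
    intro t ht
    rw [hfl (a + t) ⟨by linarith [ht.1], by linarith [ht.2]⟩, add_sub_cancel_left,
      level_flow F.minus_p ha, F.level_p]
    ring
  have hlt : ∀ t ∈ Ioo 0 (b - a), μ * Sm t < 0 := by
    intro t ht
    rw [← hlev t ⟨ht.1.le, ht.2.le⟩]
    exact h _ ⟨by linarith [ht.1], by linarith [ht.2]⟩
  obtain ⟨ε, hε, hε1⟩ := F.fund_minus.exists_pos_near_zero
  have hμ0 : μ < 0 := by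
    have hm : 0 < min ε (b - a) := lt_min hε (by linarith)
    have hS := hε1 (min ε (b - a) / 2) ⟨by linarith, by linarith [min_le_left ε (b - a)]⟩
    have := hlt (min ε (b - a) / 2) ⟨by linarith, by linarith [min_le_right ε (b - a)]⟩
    exact neg_of_mul_neg_left this hS.le
  have hS0 : Sm (b - a) = 0 := by
    have := hlev (b - a) ⟨by linarith, le_rfl⟩
    rw [add_sub_cancel, hb] at this
    exact (mul_eq_zero.1 this.symm).resolve_left hμ0.ne
  refine ⟨hS0, fun t ht => pos_of_mul_neg_right (hlt t ht) hμ0.le, hμ0, ?_⟩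
  rw [hfl b ⟨hab.le, le_rfl⟩, slope_flow F.minus_p ha, hS0]
  ring

/-- The slope signs come from one-sided derivatives at the two ends. Equal slopes would both vanish;
`hne` then puts `q` on the line and the level is zero on the whole arc, against finiteness of the
instants on the line. -/
theorem plus_arc (hγ : Z.IsPeriodicSolution γ T) (F : Z.IsFramed p q Sm Rm Sp Rp) {a b : ℝ}
    (hab : a < b) (ha : Z.level (γ a) = 0) (hb : Z.level (γ b) = 0)
    (h : ∀ t ∈ Icc a b, 0 ≤ Z.level (γ t))
    (hne : Z.n ⬝ᵥ Z.plus.field (γ a) = Z.n ⬝ᵥ Z.plus.field (γ b) →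
      Z.n ⬝ᵥ Z.plus.field (γ a) = 0 → Z.level q = 0) :
    IsExcursion Z.plus.A.trace Z.plus.A.det (-Z.level q) Sp Rp (b - a)
      (Z.n ⬝ᵥ Z.plus.field (γ a)) (Z.n ⬝ᵥ Z.plus.field (γ b)) := by
  have hfl := hγ.plus_flow F.fund_plus F.plus_q fun t ht => h t ⟨ht.1.le, ht.2.le⟩
  have hlev : ∀ t ∈ Icc 0 (b - a), Z.level (γ (a + t)) = (Z.n ⬝ᵥ Z.plus.field (γ a)) * Sp t +
      (-Z.level q) * (Rp t - Z.plus.A.trace * Sp t - 1) := by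
    intro t ht
    rw [hfl (a + t) ⟨by linarith [ht.1], by linarith [ht.2]⟩, add_sub_cancel_left,
      level_flow F.plus_q ha]
  have hder : ∀ t, HasDerivAt (fun t => (Z.n ⬝ᵥ Z.plus.field (γ a)) * Sp t +
      (-Z.level q) * (Rp t - Z.plus.A.trace * Sp t - 1))
      ((Z.n ⬝ᵥ Z.plus.field (γ a)) * Rp t - (-Z.level q) * Z.plus.A.det * Sp t) t := fun t => by
    refine HasDerivAt.congr_deriv (((F.fund_plus.deriv_S t).const_mul _).add
      ((((F.fund_plus.deriv_R t).sub ((F.fund_plus.deriv_S t).const_mul _)).sub_const 1).const_mul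
        _)) ?_
    ring
  have hnn : ∀ t ∈ Icc 0 (b - a), 0 ≤ (Z.n ⬝ᵥ Z.plus.field (γ a)) * Sp t +
      (-Z.level q) * (Rp t - Z.plus.A.trace * Sp t - 1) := fun t ht => by
    rw [← hlev t ht]
    exact h _ ⟨by linarith [ht.1], by linarith [ht.2]⟩
  have hend : (Z.n ⬝ᵥ Z.plus.field (γ a)) * Sp (b - a) +
      (-Z.level q) * (Rp (b - a) - Z.plus.A.trace * Sp (b - a) - 1) = 0 := by
    rw [← hlev _ ⟨by linarith, le_rfl⟩, add_sub_cancel, hb]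
  have hslope : Z.n ⬝ᵥ Z.plus.field (γ b) = (Z.n ⬝ᵥ Z.plus.field (γ a)) * Rp (b - a) -
      (-Z.level q) * Z.plus.A.det * Sp (b - a) := by
    rw [hfl b ⟨hab.le, le_rfl⟩, slope_flow F.plus_q ha]
  have hstart : 0 ≤ Z.n ⬝ᵥ Z.plus.field (γ a) := by
    have := (hder 0).nonneg_of_nonneg_right (b := b - a) (by linarith)
      (by simp [F.fund_plus.S_zero, F.fund_plus.R_zero]) fun t ht => hnn t ⟨ht.1.le, ht.2.le⟩
    simpa [F.fund_plus.S_zero, F.fund_plus.R_zero] using this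
  have hfin : Z.n ⬝ᵥ Z.plus.field (γ b) ≤ 0 := by
    rw [hslope]
    exact (hder (b - a)).nonpos_of_nonneg_left (a := 0) (by linarith) hend
      fun t ht => hnn t ⟨ht.1.le, ht.2.le⟩
  refine ⟨by linarith, hnn, hend, hslope, hstart, hfin, fun heq => ?_⟩
  have h0 : Z.n ⬝ᵥ Z.plus.field (γ a) = 0 := le_antisymm (heq ▸ hfin) hstart
  have hq := hne heq h0
  refine (hγ.zeros_finite a b).not_infinite ((Icc_infinite hab).mono fun t ht => ⟨ht, ?_⟩)
  have := hlev (t - a) ⟨by linarith [ht.1], by linarith [ht.2]⟩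
  rw [add_sub_cancel, h0, hq] at this
  linarith

/-- One turn: an arc in the minus half-plane of duration `z` followed by an excursion of duration
`τ` into the plus half-plane. -/
structure IsTurn (Z : PiecewiseLinearSystem) (p q : Plane) (Sm Rm Sp Rp : ℝ → ℝ) (z : ℝ)
    (γ : ℝ → Plane) (a τ : ℝ) : Prop where
  slope_neg : Z.n ⬝ᵥ Z.minus.field (γ a) < 0
  start : γ a = Z.linePoint p (Z.n ⬝ᵥ Z.minus.field (γ a))
  middle : γ (a + z) = Z.linePoint p (Rm z * Z.n ⬝ᵥ Z.minus.field (γ a))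
  minus : ∀ t ∈ Icc a (a + z), γ t = Z.minus.flow p Sm Rm (t - a) (γ a)
  plus : ∀ t ∈ Icc (a + z) (a + z + τ), γ t = Z.plus.flow q Sp Rp (t - (a + z)) (γ (a + z))
  next : IsStart Z γ (a + (z + τ))
  excursion : IsExcursion Z.plus.A.trace Z.plus.A.det (-Z.level q) Sp Rp τ
    (Z.rateRatio * (Rm z * Z.n ⬝ᵥ Z.minus.field (γ a)) + Z.n ⬝ᵥ Z.plus.field p)
    (Z.rateRatio * (Z.n ⬝ᵥ Z.minus.field (γ (a + (z + τ)))) + Z.n ⬝ᵥ Z.plus.field p)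

theorem exists_turn (hγ : Z.IsPeriodicSolution γ T) (F : Z.IsFramed p q Sm Rm Sp Rp)
    (hneg : ∃ t, Z.level (γ t) < 0) (hpos : ∃ t, 0 < Z.level (γ t)) {z : ℝ} (hz : 0 < z)
    (hz0 : Sm z = 0) (hzp : ∀ t ∈ Ioo 0 z, 0 < Sm t) {a : ℝ} (ha : IsStart Z γ a) :
    ∃ τ, IsTurn Z p q Sm Rm Sp Rp z γ a τ := by
  obtain ⟨b, hab, hb, harc⟩ := hγ.exists_minus_end hpos ha
  obtain ⟨h1, h2, h3, h4⟩ := hγ.minus_arc F hab ha.1 hb harc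
  have hbz : b - a = z := first_zero_unique (by linarith) hz h1 hz0 h2 hzp
  obtain rfl : b = a + z := by linarith
  rw [add_sub_cancel_left] at h1 h2 h4
  have hr := F.minusRate_ne_zero ha.1 h3.ne
  have hRz := F.fund_minus.R_neg_of_first_zero hz hz0 hzp
  have hμ1 : 0 < Z.n ⬝ᵥ Z.minus.field (γ (a + z)) := by
    rw [h4]; exact mul_pos_of_neg_of_neg hRz h3
  -- The minus slope at the end of the arc is positive, while every minus arc starts with a negative
  -- one, so the orbit has to enter the plus side.
  obtain ⟨δ, hδ, hs | hs⟩ := hγ.right_sign (a + z)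
  · exfalso
    obtain ⟨b', hb', hb0', harc'⟩ := hγ.exists_minus_end hpos ⟨hb, δ, hδ, hs⟩
    have := (hγ.minus_arc F hb' hb hb0' harc').2.2.1
    linarith
  · obtain ⟨c, hc, hstart, hnn⟩ := hγ.exists_next_start hneg
      (hs (a + z + δ / 2) ⟨by linarith, by linarith⟩)
    have hnn' : ∀ t ∈ Icc (a + z) c, 0 ≤ Z.level (γ t) := by
      intro t ht
      rcases lt_or_ge t (a + z + δ / 2) with hlt | hge
      · rcases ht.1.lt_or_eq with hlt' | heq
        · exact (hs t ⟨hlt', by linarith⟩).le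
        · rw [← heq, hb]
      · exact hnn t ⟨hge, ht.2⟩
    have hc' : a + z < c := by linarith
    have hmid := F.eq_linePoint hr hb
    have hend := F.eq_linePoint hr hstart.1
    have hm0 : Z.n ⬝ᵥ Z.plus.field (γ (a + z)) =
        Z.rateRatio * (Rm z * Z.n ⬝ᵥ Z.minus.field (γ a)) + Z.n ⬝ᵥ Z.plus.field p := by
      rw [hmid, IsFramed.plus_linePoint, h4]
    have hm1 : Z.n ⬝ᵥ Z.plus.field (γ c) =
        Z.rateRatio * (Z.n ⬝ᵥ Z.minus.field (γ c)) + Z.n ⬝ᵥ Z.plus.field p := by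
      conv_lhs => rw [hend]
      rw [IsFramed.plus_linePoint]
    have hμc : Z.n ⬝ᵥ Z.minus.field (γ c) < 0 := by
      obtain ⟨b', hb', hb0', harc'⟩ := hγ.exists_minus_end hpos hstart
      exact (hγ.minus_arc F hb' hstart.1 hb0' harc').2.2.1
    have hexc := hγ.plus_arc F hc' hb hstart.1 hnn' (by
      intro heq h0
      have ha0 : Z.rateRatio = 0 := by
        rw [hm0, hm1, ← h4] at heq
        have : Z.rateRatio * (Z.n ⬝ᵥ Z.minus.field (γ (a + z)) -
          Z.n ⬝ᵥ Z.minus.field (γ c)) = 0 := by linarith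
        exact (mul_eq_zero.1 this).resolve_right (by linarith)
      rw [hm0, ha0, zero_mul, zero_add] at h0
      exact F.level_q_eq_zero hr ha0 h0)
    rw [hm0, hm1] at hexc
    refine ⟨c - (a + z), h3, F.eq_linePoint hr ha.1, by rw [hmid, h4], ?_, ?_, ?_, ?_⟩
    · refine hγ.minus_flow F.fund_minus F.minus_p fun t ht => (harc t ht).le
    · rw [add_sub_cancel]
      exact hγ.plus_flow F.fund_plus F.plus_q fun t ht => hnn' t ⟨ht.1.le, ht.2.le⟩
    · rwa [← add_assoc, add_sub_cancel]
    · rwa [← add_assoc a, add_sub_cancel]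

end IsPeriodicSolution

/-- The closed curve that consists of the minus arc from the line point `μ` of duration `z`
and of the plus arc of duration `τ` that follows it. -/
noncomputable def cycle (Z : PiecewiseLinearSystem) (p q : Plane) (Sm Rm Sp Rp : ℝ → ℝ)
    (z μ τ : ℝ) : Set Plane :=
  (fun t => Z.minus.flow p Sm Rm t (Z.linePoint p μ)) '' Icc 0 z ∪
    (fun t => Z.plus.flow q Sp Rp t (Z.linePoint p (Rm z * μ))) '' Icc 0 τ

namespace IsPeriodicSolution

variable {Z : PiecewiseLinearSystem} {γ : ℝ → Plane} {T : ℝ} {p q : Plane} {Sm Rm Sp Rp : ℝ → ℝ}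

/-- The offset `b` cancels in start slope minus end slope, leaving `m * (r * μ - μ') ≥ 0` with a
positive second factor; `m = 0` would make the slopes equal. -/
theorem rateRatio_pos {m b μ r μ' τ h D S R} (hr : r < 0) (hμ : μ < 0) (hμ' : μ' < 0)
    (e : IsExcursion T D h S R τ (m * (r * μ) + b) (m * μ' + b)) : 0 < m := by
  have h1 := e.start_nonneg
  have h2 := e.end_nonpos
  have h3 : 0 < r * μ := mul_pos_of_neg_of_neg hr hμ
  have h4 : 0 ≤ m * (r * μ - μ') := by linarith
  refine lt_of_le_of_ne (nonneg_of_mul_nonneg_left h4 (by linarith)) fun h0 => e.ne ?_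
  rw [← h0]; ring

/-- A periodic orbit that visits both open half-planes makes a single turn. -/
theorem exists_cycle (hγ : Z.IsPeriodicSolution γ T) (F : Z.IsFramed p q Sm Rm Sp Rp)
    (hneg : ∃ t, Z.level (γ t) < 0) (hpos : ∃ t, 0 < Z.level (γ t)) :
    ∃ z μ τ, 0 < z ∧ Sm z = 0 ∧ (∀ t ∈ Ioo 0 z, 0 < Sm t) ∧ μ < 0 ∧ Z.minusRate ≠ 0 ∧
      0 < Z.rateRatio ∧
      IsExcursion Z.plus.A.trace Z.plus.A.det (-Z.level q) Sp Rp τ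
        (Z.rateRatio * (Rm z * μ) + Z.n ⬝ᵥ Z.plus.field p)
        (Z.rateRatio * μ + Z.n ⬝ᵥ Z.plus.field p) ∧
      range γ = Z.cycle p q Sm Rm Sp Rp z μ τ := by
  obtain ⟨x, hx⟩ := hpos
  obtain ⟨a, -, ha, -⟩ := hγ.exists_next_start hneg hx
  have hpos : ∃ t, 0 < Z.level (γ t) := ⟨x, hx⟩
  obtain ⟨b, hab, hb, harc⟩ := hγ.exists_minus_end hpos ha
  obtain ⟨hz0, hzp, hμa, -⟩ := hγ.minus_arc F hab ha.1 hb harc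
  have hr := F.minusRate_ne_zero ha.1 hμa.ne
  have hz : 0 < b - a := by linarith
  set z := b - a with hzdef
  have hRz := F.fund_minus.R_neg_of_first_zero hz hz0 hzp
  have turn := fun (a : ℝ) (ha : IsStart Z γ a) => hγ.exists_turn F hneg hpos hz hz0 hzp ha
  choose τ hτ using turn
  set μ : ℝ → ℝ := fun t => Z.n ⬝ᵥ Z.minus.field (γ t) with hμ
  have hneg' : ∀ t, IsStart Z γ t → μ t < 0 := fun t ht => (hτ t ht).slope_neg
  have hapos : 0 < Z.rateRatio :=
    rateRatio_pos hRz (hτ a ha).slope_neg (hneg' _ (hτ a ha).next) (hτ a ha).excursion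
  -- By periodicity the slopes at all crossings are those of one period.
  have hfin : (μ '' {t | Z.level (γ t) = 0}).Finite := by
    refine (hγ.finite_line.image μ).subset ?_
    rintro _ ⟨t, ht, rfl⟩
    obtain ⟨s, hs, hst⟩ := hγ.periodic.exists_mem_Ico₀ hγ.period_pos t
    refine ⟨s, ⟨hs, ?_⟩, ?_⟩
    · change Z.level (γ s) = 0
      rw [← hst]; exact ht
    · simp only [hμ, hst]
  -- Both half-maps reverse order, so the return map on start slopes is increasing.
  have hmono : ∀ (s t : ℝ) (hs : IsStart Z γ s) (ht : IsStart Z γ t), μ s < μ t →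
      μ (s + (z + τ s hs)) < μ (t + (z + τ t ht)) := by
    intro s t hs ht hlt
    have h1 : Rm z * μ t < Rm z * μ s := mul_lt_mul_of_neg_left hlt hRz
    have h2 := mul_lt_mul_of_pos_left h1 hapos
    have h3 := IsExcursion.end_lt_of_start_lt F.fund_plus F.det_plus (hτ t ht).excursion
      (hτ s hs).excursion (by linarith)
    exact lt_of_mul_lt_mul_left (by linarith) hapos.le
  -- An increasing self-map of a finite set of values has only fixed points: a minimal value that
  -- decreases would have an image that is smaller and decreases as well, and dually for values that
  -- increase.
  have hconst : ∀ (s : ℝ) (hs : IsStart Z γ s), μ (s + (z + τ s hs)) = μ s := by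
    intro s hs
    rcases lt_trichotomy (μ (s + (z + τ s hs))) (μ s) with hlt | heq | hgt
    · exfalso
      set V := {v | ∃ t, ∃ ht : IsStart Z γ t, v = μ t ∧ μ (t + (z + τ t ht)) < μ t} with hV
      have hVfin : V.Finite := hfin.subset (by rintro v ⟨t, ht, rfl, -⟩; exact ⟨t, ht.1, rfl⟩)
      obtain ⟨v, ⟨t, ht, rfl, hlt'⟩, hmin⟩ := hVfin.exists_minimal ⟨_, s, hs, rfl, hlt⟩
      exact absurd (hmin ⟨_, (hτ t ht).next, rfl, hmono _ _ (hτ t ht).next ht hlt'⟩ hlt'.le)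
        hlt'.not_ge
    · exact heq
    · exfalso
      set V := {v | ∃ t, ∃ ht : IsStart Z γ t, v = μ t ∧ μ t < μ (t + (z + τ t ht))} with hV
      have hVfin : V.Finite := hfin.subset (by rintro v ⟨t, ht, rfl, -⟩; exact ⟨t, ht.1, rfl⟩)
      obtain ⟨v, ⟨t, ht, rfl, hlt'⟩, hmax⟩ := hVfin.exists_maximal ⟨_, s, hs, rfl, hgt⟩
      exact absurd (hmax ⟨_, (hτ t ht).next, rfl, hmono _ _ ht (hτ t ht).next hlt'⟩ hlt'.le)
        hlt'.not_ge
  set σ := τ a ha with hσ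
  have hσpos : 0 < σ := (hτ a ha).excursion.pos
  -- Equal start slopes give equal durations, so all turns are time translates of the first one.
  have hiter : ∀ n : ℕ, IsStart Z γ (a + n * (z + σ)) ∧ μ (a + n * (z + σ)) = μ a := by
    intro n
    induction n with
    | zero => simpa using ha
    | succ n ih =>
      obtain ⟨ih1, ih2⟩ := ih
      have h1 := (hτ _ ih1).excursion
      have h2 := (hτ a ha).excursion
      have h3 : τ _ ih1 = σ := by
        change IsExcursion _ _ _ _ _ _ (_ * (_ * μ (a + n * (z + σ))) + _) _ at h1
        rw [ih2] at h1
        exact h1.duration_eq_of_start_eq F.fund_plus F.det_plus h2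
      have h4 : a + ((n + 1 : ℕ) : ℝ) * (z + σ) = a + n * (z + σ) + (z + τ _ ih1) := by
        rw [h3]; push_cast; ring
      rw [h4]
      exact ⟨(hτ _ ih1).next, (hconst _ ih1).trans ih2⟩
  have hcover : ∀ n : ℕ, ∀ t ∈ Icc (a + n * (z + σ)) (a + n * (z + σ) + (z + σ)),
      γ t = γ (t - n * (z + σ)) := by
    intro n t ht
    obtain ⟨h1, h2⟩ := hiter n
    have e1 := hτ _ h1
    have e2 := hτ a ha
    have h3 : τ _ h1 = σ := by
      have h4 := e1.excursion
      change IsExcursion _ _ _ _ _ _ (_ * (_ * μ (a + n * (z + σ))) + _) _ at h4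
      rw [h2] at h4
      exact h4.duration_eq_of_start_eq F.fund_plus F.det_plus e2.excursion
    have h4 : γ (a + n * (z + σ)) = γ a := by
      rw [e1.start, e2.start]
      exact congrArg _ h2
    have h5 : γ (a + n * (z + σ) + z) = γ (a + z) := by
      rw [e1.middle, e2.middle]
      exact congrArg (fun m => Z.linePoint p (Rm z * m)) h2
    rcases le_total t (a + n * (z + σ) + z) with hle | hge
    · rw [e1.minus t ⟨ht.1, hle⟩, e2.minus (t - n * (z + σ)) ⟨by linarith [ht.1], by linarith⟩, h4]
      congr 1; ring
    · rw [e1.plus t ⟨hge, by rw [h3]; linarith [ht.2]⟩,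
        e2.plus (t - n * (z + σ)) ⟨by linarith, by linarith [ht.2]⟩, h5]
      congr 1; ring
  have e := hτ a ha
  refine ⟨z, μ a, σ, hz, hz0, hzp, hneg' a ha, hr, hapos, ?_, ?_⟩
  · have h1 := e.excursion
    change IsExcursion _ _ _ _ _ _ _ (_ * μ _ + _) at h1
    rw [hconst a ha] at h1
    exact h1
  · have hs : γ a = Z.linePoint p (μ a) := e.start
    have hm : γ (a + z) = Z.linePoint p (Rm z * μ a) := e.middle
    unfold cycle
    rw [← hs, ← hm]
    apply Subset.antisymm
    · rintro _ ⟨t, rfl⟩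
      obtain ⟨t', hat', ht'⟩ := hγ.exists_ge (P := fun y => y = γ t) ⟨t, rfl⟩ a
      rw [← ht']
      have hP : 0 < z + σ := by linarith
      have h1 := Nat.floor_le (div_nonneg (sub_nonneg.2 hat') hP.le)
      have h2 := Nat.lt_floor_add_one ((t' - a) / (z + σ))
      rw [le_div_iff₀ hP] at h1
      rw [div_lt_iff₀ hP] at h2
      set n := ⌊(t' - a) / (z + σ)⌋₊
      rw [hcover n t' ⟨by linarith, by linarith⟩]
      rcases le_total (t' - n * (z + σ)) (a + z) with hle | hge
      · left
        refine ⟨t' - n * (z + σ) - a, ⟨by linarith, by linarith⟩, ?_⟩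
        exact (e.minus _ ⟨by linarith, hle⟩).symm
      · right
        refine ⟨t' - n * (z + σ) - (a + z), ⟨by linarith, by linarith⟩, ?_⟩
        exact (e.plus _ ⟨hge, by linarith⟩).symm
    · rintro _ (⟨t, ht, rfl⟩ | ⟨t, ht, rfl⟩)
      · refine ⟨a + t, ?_⟩
        rw [e.minus (a + t) ⟨by linarith [ht.1], by linarith [ht.2]⟩, add_sub_cancel_left]
      · refine ⟨a + z + t, ?_⟩
        rw [e.plus (a + z + t) ⟨by linarith [ht.1], by linarith [ht.2]⟩, add_sub_cancel_left]

end IsPeriodicSolution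

end PiecewiseLinearSystem

/-! ### Periodic orbits that are not isolated: homotheties and exchange of sides -/

/-- Being contained in an open set is an open condition on the parameter of a family of images of
a compact set. -/
theorem IsCompact.eventually_image_subset {X : Type*} [TopologicalSpace X] {K : Set X}
    (hK : IsCompact K) {G : ℝ → X → Plane} {s₀ : ℝ}
    (hG : ∀ x ∈ K, ContinuousAt (fun y : ℝ × X => G y.1 y.2) (s₀, x)) {U : Set Plane}
    (hU : IsOpen U) (h : G s₀ '' K ⊆ U) : ∀ᶠ s in 𝓝 s₀, G s '' K ⊆ U := by
  have := hK.eventually_forall_of_forall_eventually (x₀ := s₀) (P := fun s x => G s x ∈ U)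
    fun x hx => (hG x hx).eventually_mem (hU.mem_nhds (h ⟨x, hx, rfl⟩))
  filter_upwards [this] with s hs
  rintro _ ⟨x, hx, rfl⟩
  exact hs x hx

namespace PiecewiseLinearSystem

variable {Z : PiecewiseLinearSystem}

/-- The same system with the roles of both sides exchanged. -/
def swap (Z : PiecewiseLinearSystem) : PiecewiseLinearSystem where
  n := -Z.n
  d := -Z.d
  n_ne_zero := neg_ne_zero.2 Z.n_ne_zero
  minus := Z.plus
  plus := Z.minus

theorem swap_swap (Z : PiecewiseLinearSystem) : Z.swap.swap = Z := by
  cases Z; simp [swap]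

theorem level_swap (Z : PiecewiseLinearSystem) (x : Plane) : Z.swap.level x = -Z.level x := by
  simp [level, swap, neg_dotProduct]; ring

theorem line_swap (Z : PiecewiseLinearSystem) : Z.swap.line = Z.line := by
  ext x; simp [line, level_swap]

theorem slidingSet_swap (Z : PiecewiseLinearSystem) : Z.swap.slidingSet = Z.slidingSet := by
  ext x
  simp only [slidingSet, escapingRegion, slidingRegion, line_swap, mem_union, mem_ofPred_eq]
  simp only [swap, neg_dotProduct, neg_pos, neg_lt_zero]
  tauto

theorem IsPeriodicSolution.swap {γ : ℝ → Plane} {T : ℝ} (h : Z.IsPeriodicSolution γ T) :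
    Z.swap.IsPeriodicSolution γ T where
  period_pos := h.period_pos
  continuous := h.continuous
  periodic := h.periodic
  nonconstant := h.nonconstant
  finite_line := by rw [line_swap]; exact h.finite_line
  minus_deriv := fun t ht => h.plus_deriv t (by rw [level_swap] at ht; linarith)
  plus_deriv := fun t ht => h.minus_deriv t (by rw [level_swap] at ht; linarith)
  avoids_sliding := by rw [slidingSet_swap]; exact h.avoids_sliding

theorem isPeriodicOrbit_swap {C : Set Plane} : Z.swap.IsPeriodicOrbit C ↔ Z.IsPeriodicOrbit C := by
  constructor
  · rintro ⟨γ, T, h, rfl⟩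
    exact ⟨γ, T, Z.swap_swap ▸ h.swap, rfl⟩
  · rintro ⟨γ, T, h, rfl⟩
    exact ⟨γ, T, h.swap, rfl⟩

theorem isLimitCycle_swap {C : Set Plane} : Z.swap.IsLimitCycle C ↔ Z.IsLimitCycle C := by
  simp only [IsLimitCycle, isPeriodicOrbit_swap]

namespace IsPeriodicSolution

variable {γ : ℝ → Plane} {T : ℝ}

theorem isCompact_range (hγ : Z.IsPeriodicSolution γ T) : IsCompact (range γ) := by
  rw [← hγ.periodic.image_Icc hγ.period_pos 0]
  exact isCompact_Icc.image hγ.continuous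

/-- A periodic orbit that stays periodic under homotheties of ratios close to one is no limit
cycle. -/
theorem not_isLimitCycle_of_homothety (hγ : Z.IsPeriodicSolution γ T) (q : Plane)
    (h : ∃ᶠ s : ℝ in 𝓝 1, 0 < s ∧ s ≠ 1 ∧
      Z.IsPeriodicSolution (fun t => q + s • (γ t - q)) T) : ¬ Z.IsLimitCycle (range γ) := by
  rintro ⟨-, U, hU, hCU, hiso⟩
  have hev := hγ.isCompact_range.eventually_image_subset (G := fun (s : ℝ) x => q + s • (x - q))
    (s₀ := 1) (fun x _ => by fun_prop) hU (by simpa using hCU)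
  obtain ⟨s, ⟨hs0, hs1, hs⟩, hsU⟩ := (h.and_eventually hev).exists
  have hr : range (fun t => q + s • (γ t - q)) = (fun x => q + s • (x - q)) '' range γ :=
    (range_comp (fun x => q + s • (x - q)) γ)
  have heq := hiso _ ⟨_, _, hs, rfl⟩ (by rw [hr]; exact hsU)
  rw [hr] at heq
  -- A homothety of ratio other than one cannot preserve a compact set with a point off the centre,
  -- as the maximal distance to the centre would change.
  obtain ⟨x, hx, hmax⟩ := hγ.isCompact_range.exists_isMaxOn (range_nonempty γ)
    (f := fun x => ‖x - q‖) (by fun_prop)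
  have hpos : 0 < ‖x - q‖ := by
    by_contra hcon
    have h0 : ∀ y ∈ range γ, y = q := fun y hy => by
      have h1 : ‖y - q‖ ≤ ‖x - q‖ := hmax hy
      exact sub_eq_zero.1 (norm_le_zero_iff.1 (h1.trans (not_lt.1 hcon)))
    obtain ⟨t, ht⟩ := hγ.nonconstant
    exact ht ((h0 _ ⟨t, rfl⟩).trans (h0 _ ⟨0, rfl⟩).symm)
  rcases lt_or_gt_of_ne hs1 with hlt | hgt
  · rw [← heq] at hx
    obtain ⟨y, hy, rfl⟩ := hx
    have h1 : ‖y - q‖ ≤ ‖q + s • (y - q) - q‖ := hmax hy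
    rw [add_sub_cancel_left, norm_smul, Real.norm_of_nonneg hs0.le] at h1 hpos
    have h2 : 0 < ‖y - q‖ := pos_of_mul_pos_right hpos hs0.le
    nlinarith
  · have h1 : q + s • (x - q) ∈ range γ := heq ▸ mem_image_of_mem _ hx
    have h2 : ‖q + s • (x - q) - q‖ ≤ ‖x - q‖ := hmax h1
    rw [add_sub_cancel_left, norm_smul, Real.norm_of_nonneg hs0.le] at h2
    nlinarith

theorem level_homothety (Z : PiecewiseLinearSystem) (q x : Plane) (s : ℝ) :
    Z.level (q + s • (x - q)) = (1 - s) * Z.level q + s * Z.level x := by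
  have h1 := Z.level_sub (q + s • (x - q)) q
  rw [add_sub_cancel_left, dotProduct_smul, Z.level_sub, smul_eq_mul] at h1
  linarith

theorem field_homothety {L : LinearSystem} {q : Plane} (hq : L.field q = 0) (x : Plane) (s : ℝ) :
    L.field (q + s • (x - q)) = s • L.field x := by
  rw [L.field_eq hq, L.field_eq hq, add_sub_cancel_left, mulVec_smul]

theorem hasDerivAt_homothety {q v : Plane} {t : ℝ} (h : HasDerivAt γ v t) (s : ℝ) :
    HasDerivAt (fun t => q + s • (γ t - q)) (s • v) t :=
  ((h.sub_const q).const_smul s).const_add q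

/-- A periodic orbit in the closed plus half-plane is no limit cycle. -/
theorem not_isLimitCycle_of_nonneg (hγ : Z.IsPeriodicSolution γ T) {q : Plane}
    (hq : Z.plus.field q = 0) (h : ∀ t, 0 ≤ Z.level (γ t)) : ¬ Z.IsLimitCycle (range γ) := by
  obtain ⟨S, R, hS⟩ := exists_isFundamental Z.plus.A.trace Z.plus.A.det
  have hder : ∀ t, HasDerivAt γ (Z.plus.field (γ t)) t := by
    intro t
    have hfl := hγ.plus_flow hS hq (a := t - 1) (b := t + 1) fun u _ => h u
    have h1 : HasDerivAt (fun u => Z.plus.flow q S R (u - (t - 1)) (γ (t - 1)))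
        (Z.plus.field (Z.plus.flow q S R (t - (t - 1)) (γ (t - 1)))) t :=
      (LinearSystem.hasDerivAt_flow hS hq (γ (t - 1)) (t - (t - 1))).comp_sub_const t (t - 1)
    rw [← hfl t ⟨by linarith, by linarith⟩] at h1
    refine h1.congr_of_eventuallyEq ?_
    filter_upwards [Icc_mem_nhds (show t - 1 < t by linarith) (show t < t + 1 by linarith)] with u hu
    exact hfl u hu
  -- At a contact with the line the level is minimal, so the plus field is tangent there. The
  -- homothetic curves are then tangent at their contacts too and avoid the sliding set.
  have hslope : ∀ t, Z.level (γ t) = 0 → Z.n ⬝ᵥ Z.plus.field (γ t) = 0 := by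
    intro t ht
    have h1 : HasDerivAt (fun u => Z.level (γ u)) (Z.n ⬝ᵥ Z.plus.field (γ t)) t := by
      have h2 := hasDerivAt_pi.1 (hder t)
      unfold level
      simp only [dotProduct, Fin.sum_univ_two]
      exact (((h2 0).const_mul _).add ((h2 1).const_mul _)).sub_const _
    refine IsLocalMin.hasDerivAt_eq_zero (Eventually.of_forall fun u => ?_) h1
    rw [ht]; exact h u
  have key : ∀ s : ℝ, 0 < s → 0 ≤ (1 - s) * Z.level q →
      Z.IsPeriodicSolution (fun t => q + s • (γ t - q)) T := by
    intro s hs hsq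
    have hlev : ∀ t, 0 ≤ Z.level (q + s • (γ t - q)) := fun t => by
      rw [level_homothety]
      exact add_nonneg hsq (mul_nonneg hs.le (h t))
    have hlev0 : ∀ t, Z.level (q + s • (γ t - q)) = 0 → Z.level (γ t) = 0 := fun t ht => by
      rw [level_homothety] at ht
      have h1 : s * Z.level (γ t) = 0 := le_antisymm (by linarith) (mul_nonneg hs.le (h t))
      exact (mul_eq_zero.1 h1).resolve_left hs.ne'
    have hcont := hγ.continuous
    refine ⟨hγ.period_pos, by fun_prop, fun t => ?_, ?_, ?_, fun t ht => ?_, fun t _ => ?_,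
      fun t ht => ?_⟩
    · rw [hγ.periodic t]
    · obtain ⟨t, ht⟩ := hγ.nonconstant
      refine ⟨t, fun heq => ht ?_⟩
      exact sub_left_injective (smul_right_injective Plane hs.ne' (add_left_cancel heq))
    · exact hγ.finite_line.subset fun t ht => ⟨ht.1, hlev0 t ht.2⟩
    · exact absurd ht (hlev t).not_gt
    · rw [field_homothety hq]
      exact hasDerivAt_homothety (hder t) s
    · have h0 : Z.n ⬝ᵥ Z.plus.field (q + s • (γ t - q)) = 0 → False := by
        intro h0
        rcases ht with ht | ht
        · exact ht.2.2.ne' h0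
        · exact ht.2.2.ne h0
      refine h0 ?_
      rw [field_homothety hq, dotProduct_smul, hslope t, smul_zero]
      refine hlev0 t ?_
      rcases ht with ht | ht <;> exact ht.1
  refine hγ.not_isLimitCycle_of_homothety q ?_
  have hpos : ∀ᶠ s : ℝ in 𝓝 1, 0 < s := lt_mem_nhds one_pos
  -- Shrinking towards an equilibrium in the closed plus side, or expanding from one in the closed
  -- minus side, keeps the curve in the plus half-plane.
  rcases le_total 0 (Z.level q) with hq0 | hq0
  · have : ∀ᶠ s : ℝ in 𝓝[<] 1, 0 < s ∧ s ≠ 1 ∧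
        Z.IsPeriodicSolution (fun t => q + s • (γ t - q)) T := by
      filter_upwards [nhdsWithin_le_nhds hpos, self_mem_nhdsWithin] with s hs hs1
      exact ⟨hs, ne_of_lt hs1, key s hs (mul_nonneg (sub_nonneg.2 (le_of_lt hs1)) hq0)⟩
    exact this.frequently.filter_mono nhdsWithin_le_nhds
  · have : ∀ᶠ s : ℝ in 𝓝[>] 1, 0 < s ∧ s ≠ 1 ∧
        Z.IsPeriodicSolution (fun t => q + s • (γ t - q)) T := by
      filter_upwards [nhdsWithin_le_nhds hpos, self_mem_nhdsWithin] with s hs hs1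
      exact ⟨hs, ne_of_gt hs1,
        key s hs (mul_nonneg_of_nonpos_of_nonpos (sub_nonpos.2 (le_of_lt hs1)) hq0)⟩
    exact this.frequently.filter_mono nhdsWithin_le_nhds

/-- If both systems have the same equilibrium on the line, there are no limit cycles. -/
theorem not_isLimitCycle_of_common_equilibrium (hγ : Z.IsPeriodicSolution γ T) {p : Plane}
    (hp : Z.level p = 0) (hm : Z.minus.field p = 0) (hq : Z.plus.field p = 0) :
    ¬ Z.IsLimitCycle (range γ) := by
  -- Both fields are homogeneous about `p` and the line passes through `p`, so every positive ratio
  -- preserves the system.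
  have key : ∀ s : ℝ, 0 < s → Z.IsPeriodicSolution (fun t => p + s • (γ t - p)) T := by
    intro s hs
    have hlev : ∀ t, Z.level (p + s • (γ t - p)) = s * Z.level (γ t) := fun t => by
      rw [level_homothety, hp]; ring
    have hcont := hγ.continuous
    refine ⟨hγ.period_pos, by fun_prop, fun t => ?_, ?_, ?_, fun t ht => ?_, fun t ht => ?_,
      fun t ht => hγ.avoids_sliding t ?_⟩
    · rw [hγ.periodic t]
    · obtain ⟨t, ht⟩ := hγ.nonconstant
      refine ⟨t, fun heq => ht ?_⟩
      exact sub_left_injective (smul_right_injective Plane hs.ne' (add_left_cancel heq))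
    · refine hγ.finite_line.subset fun t ht => ⟨ht.1, ?_⟩
      have h1 : Z.level (p + s • (γ t - p)) = 0 := ht.2
      rw [hlev] at h1
      exact (mul_eq_zero.1 h1).resolve_left hs.ne'
    · rw [field_homothety hm]
      rw [hlev] at ht
      exact hasDerivAt_homothety (hγ.minus_deriv t (neg_of_mul_neg_right ht hs.le)) s
    · rw [field_homothety hq]
      rw [hlev] at ht
      exact hasDerivAt_homothety (hγ.plus_deriv t (pos_of_mul_pos_right ht hs.le)) s
    · simp only [slidingSet, escapingRegion, slidingRegion, line, mem_union, mem_ofPred_eq, hlev,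
        field_homothety hm, field_homothety hq, dotProduct_smul, smul_eq_mul, mul_eq_zero, hs.ne',
        false_or, mul_pos_iff_of_pos_left hs] at ht ⊢
      have h2 : ∀ x : ℝ, s * x < 0 ↔ x < 0 := fun x =>
        ⟨fun h => neg_of_mul_neg_right h hs.le, fun h => mul_neg_of_pos_of_neg hs h⟩
      simpa only [h2] using ht
  refine hγ.not_isLimitCycle_of_homothety p ?_
  have hpos : ∀ᶠ s : ℝ in 𝓝 1, 0 < s := lt_mem_nhds one_pos
  have : ∀ᶠ s : ℝ in 𝓝[<] 1, 0 < s ∧ s ≠ 1 ∧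
      Z.IsPeriodicSolution (fun t => p + s • (γ t - p)) T := by
    filter_upwards [nhdsWithin_le_nhds hpos, self_mem_nhdsWithin] with s hs hs1
    exact ⟨hs, ne_of_lt hs1, key s hs⟩
  exact this.frequently.filter_mono nhdsWithin_le_nhds

end IsPeriodicSolution

theorem hasDerivAt_level {γ : ℝ → Plane} {v : Plane} {t : ℝ} (h : HasDerivAt γ v t) :
    HasDerivAt (fun t => Z.level (γ t)) (Z.n ⬝ᵥ v) t := by
  have h2 := hasDerivAt_pi.1 h
  unfold level
  simp only [dotProduct, Fin.sum_univ_two]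
  exact (((h2 0).const_mul _).add ((h2 1).const_mul _)).sub_const _

/-! ### Periodic orbits assembled from two arcs -/

/-- An orbit arc in the minus half-plane and one in the plus half-plane with the same end points
form a periodic orbit. -/
theorem isPeriodicOrbit_of_arcs {α β : ℝ → Plane} {z τ : ℝ} (hz : 0 < z) (hτ : 0 < τ)
    (hα : ∀ t, HasDerivAt α (Z.minus.field (α t)) t)
    (hβ : ∀ t, HasDerivAt β (Z.plus.field (β t)) t)
    (hα0 : Z.level (α 0) = 0) (hαz : Z.level (α z) = 0) (h0 : α z = β 0) (h1 : β τ = α 0)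
    (hαneg : ∀ t ∈ Ioo 0 z, Z.level (α t) < 0) (hβpos : ∀ t ∈ Ioo 0 τ, 0 < Z.level (β t)) :
    Z.IsPeriodicOrbit (α '' Icc 0 z ∪ β '' Icc 0 τ) := by
  have hP : 0 < z + τ := by linarith
  have : Fact (0 < z + τ) := ⟨hP⟩
  have hαc : Continuous α := continuous_iff_continuousAt.2 fun t => (hα t).continuousAt
  have hβc : Continuous β := continuous_iff_continuousAt.2 fun t => (hβ t).continuousAt
  set f : ℝ → Plane := fun t => if t ≤ z then α t else β (t - z) with hf
  have hfα : ∀ t ≤ z, f t = α t := fun t ht => if_pos ht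
  have hfβ : ∀ t, z ≤ t → f t = β (t - z) := fun t ht => by
    rcases ht.lt_or_eq with hlt | heq
    · exact if_neg (not_le.2 hlt)
    · rw [← heq, hfα z le_rfl, h0, sub_self]
  have hfc : Continuous f :=
    Continuous.if_le hαc (by fun_prop) continuous_id continuous_const
      (fun t ht => by rw [ht, h0, sub_self])
  have hf0 : f 0 = f (0 + (z + τ)) := by
    rw [hfα 0 hz.le, hfβ _ (by linarith), zero_add, add_sub_cancel_left, h1]
  -- Lifting to the circle gives continuity across the seam; derivatives are then transported from
  -- one period by `hshift`.
  set γ : ℝ → Plane := fun t => AddCircle.liftIco (z + τ) 0 f (t : AddCircle (z + τ)) with hγ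
  have hγc : Continuous γ :=
    (AddCircle.liftIco_continuous hf0 hfc.continuousOn).comp (AddCircle.continuous_mk' _)
  have hγf : ∀ t ∈ Ico 0 (z + τ), γ t = f t := fun t ht =>
    AddCircle.liftIco_coe_apply (by rwa [zero_add])
  have hper : Function.Periodic γ (z + τ) := fun t => by
    simp only [hγ, AddCircle.coe_add_period]
  have hcases : ∀ t ∈ Ico 0 (z + τ), (t = 0 ∧ γ t = α 0) ∨
      (t ∈ Ioo 0 z ∧ γ t = α t) ∨ (t = z ∧ γ t = α z) ∨
      (t - z ∈ Ioo 0 τ ∧ γ t = β (t - z)) := by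
    intro t ht
    rcases ht.1.lt_or_eq with hlt | heq
    · rcases lt_trichotomy t z with h | h | h
      · exact Or.inr (Or.inl ⟨⟨hlt, h⟩, by rw [hγf t ht, hfα t h.le]⟩)
      · exact Or.inr (Or.inr (Or.inl ⟨h, by rw [hγf t ht, hfα t h.le, h]⟩))
      · exact Or.inr (Or.inr (Or.inr ⟨⟨by linarith, by linarith [ht.2]⟩,
          by rw [hγf t ht, hfβ t h.le]⟩))
    · exact Or.inl ⟨heq.symm, by rw [hγf t ht, hfα t (by linarith), ← heq]⟩
  have hshift : ∀ t v, (∀ s ∈ Ico 0 (z + τ), γ s = γ t → HasDerivAt γ v s) →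
      HasDerivAt γ v t := by
    intro t v h
    have h2 := Int.floor_le (t / (z + τ))
    have h3 := Int.lt_floor_add_one (t / (z + τ))
    rw [le_div_iff₀ hP] at h2
    rw [div_lt_iff₀ hP] at h3
    set k := ⌊t / (z + τ)⌋
    have h4 := h (t - k * (z + τ)) ⟨by linarith, by linarith⟩ (hper.sub_int_mul_eq k)
    have h5 := h4.comp_sub_const t (k * (z + τ))
    refine h5.congr_of_eventuallyEq (Eventually.of_forall fun u => ?_)
    exact (hper.sub_int_mul_eq k).symm
  -- At each junction the normal components of the two fields have the same weak sign, so neither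
  -- junction lies in the sliding set.
  have hsl0 : Z.n ⬝ᵥ Z.minus.field (α 0) ≤ 0 := by
    have := (hasDerivAt_level (Z := Z) (hα 0)).neg.nonneg_of_nonneg_right hz (by simpa using hα0)
      fun t ht => by simpa using (hαneg t ht).le
    linarith
  have hslz : 0 ≤ Z.n ⬝ᵥ Z.minus.field (α z) := by
    have := (hasDerivAt_level (Z := Z) (hα z)).neg.nonpos_of_nonneg_left hz (by simpa using hαz)
      fun t ht => by simpa using (hαneg t ht).le
    linarith
  have hsp0 : Z.n ⬝ᵥ Z.plus.field (α 0) ≤ 0 := by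
    rw [← h1]
    exact (hasDerivAt_level (Z := Z) (hβ τ)).nonpos_of_nonneg_left hτ (by rw [h1, hα0])
      fun t ht => (hβpos t ht).le
  have hspz : 0 ≤ Z.n ⬝ᵥ Z.plus.field (α z) := by
    rw [h0]
    exact (hasDerivAt_level (Z := Z) (hβ 0)).nonneg_of_nonneg_right hτ (by rw [← h0, hαz])
      fun t ht => (hβpos t ht).le
  have hrep : ∀ t, ∃ s ∈ Ico 0 (z + τ), γ s = γ t := fun t => by
    obtain ⟨s, hs, hst⟩ := hper.exists_mem_Ico₀ hP t
    exact ⟨s, hs, hst.symm⟩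
  refine ⟨γ, z + τ, ⟨hP, hγc, hper, ⟨z / 2, fun heq => ?_⟩, ?_, fun t ht => ?_, fun t ht => ?_,
    fun t ht => ?_⟩, ?_⟩
  · have h2 := hαneg (z / 2) ⟨by linarith, by linarith⟩
    rw [hγf _ ⟨by linarith, by linarith⟩, hγf 0 ⟨le_rfl, hP⟩, hfα _ (by linarith),
      hfα 0 hz.le] at heq
    rw [heq, hα0] at h2
    exact lt_irrefl _ h2
  · refine (Set.toFinite {0, z}).subset ?_
    rintro t ⟨ht, hl⟩
    have hl' : Z.level (γ t) = 0 := hl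
    rcases hcases t ht with h | ⟨h, he⟩ | h | ⟨h, he⟩
    · exact Or.inl h.1
    · rw [he] at hl'
      exact absurd hl' (hαneg t h).ne
    · exact Or.inr h.1
    · rw [he] at hl'
      exact absurd hl' (hβpos _ h).ne'
  · refine hshift t _ fun s hs hst => ?_
    rw [← hst] at ht ⊢
    rcases hcases s hs with ⟨-, he⟩ | ⟨h, he⟩ | ⟨-, he⟩ | ⟨h, he⟩
    · rw [he, hα0] at ht; exact absurd ht (lt_irrefl _)
    · rw [he]
      refine (hα s).congr_of_eventuallyEq ?_
      filter_upwards [Ioo_mem_nhds h.1 h.2] with u hu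
      rw [hγf u ⟨hu.1.le, by linarith [hu.2]⟩, hfα u hu.2.le]
    · rw [he, hαz] at ht; exact absurd ht (lt_irrefl _)
    · rw [he] at ht; exact absurd ht (hβpos _ h).not_gt
  · refine hshift t _ fun s hs hst => ?_
    rw [← hst] at ht ⊢
    rcases hcases s hs with ⟨-, he⟩ | ⟨h, he⟩ | ⟨-, he⟩ | ⟨h, he⟩
    · rw [he, hα0] at ht; exact absurd ht (lt_irrefl _)
    · rw [he] at ht; exact absurd ht (hαneg _ h).not_gt
    · rw [he, hαz] at ht; exact absurd ht (lt_irrefl _)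
    · rw [he]
      refine ((hβ (s - z)).comp_sub_const s z).congr_of_eventuallyEq ?_
      filter_upwards [Ioo_mem_nhds (show z < s by linarith [h.1])
        (show s < z + τ by linarith [h.2])] with u hu
      rw [hγf u ⟨by linarith [hu.1], hu.2⟩, hfβ u hu.1.le]
  · obtain ⟨s, hs, hst⟩ := hrep t
    rw [← hst] at ht
    have hl : Z.level (γ s) = 0 := by rcases ht with h | h <;> exact h.1
    rcases hcases s hs with ⟨-, he⟩ | ⟨h, he⟩ | ⟨-, he⟩ | ⟨h, he⟩
    · rw [he] at ht
      rcases ht with h | h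
      · exact absurd h.2.2 hsp0.not_gt
      · exact absurd h.2.1 hsl0.not_gt
    · rw [he] at hl; exact absurd hl (hαneg s h).ne
    · rw [he] at ht
      rcases ht with h | h
      · exact absurd h.2.1 hslz.not_gt
      · exact absurd h.2.2 hspz.not_gt
    · rw [he] at hl; exact absurd hl (hβpos _ h).ne'
  · apply Subset.antisymm
    · rintro _ (⟨t, ht, rfl⟩ | ⟨t, ht, rfl⟩)
      · exact ⟨t, by rw [hγf t ⟨ht.1, by linarith [ht.2]⟩, hfα t ht.2]⟩
      · rcases ht.2.lt_or_eq with hlt | heq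
        · exact ⟨t + z, by rw [hγf _ ⟨by linarith [ht.1], by linarith⟩, hfβ _ (by linarith [ht.1]),
            add_sub_cancel_right]⟩
        · exact ⟨0, by rw [hγf 0 ⟨le_rfl, hP⟩, hfα 0 hz.le, heq, h1]⟩
    · rintro _ ⟨t, rfl⟩
      obtain ⟨s, hs, hst⟩ := hrep t
      rw [← hst, hγf s hs]
      rcases le_total s z with h | h
      · exact Or.inl ⟨s, ⟨hs.1, h⟩, (hfα s h).symm⟩
      · exact Or.inr ⟨s - z, ⟨by linarith, by linarith [hs.2]⟩, (hfβ s h).symm⟩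

end PiecewiseLinearSystem

/-! ### Families of cycles in reversible systems -/

namespace IsExcursion

variable {D h : ℝ} {S R : ℝ → ℝ} {τ m₀ m₁ : ℝ}

/-- For trace zero, every excursion belongs to a one-parameter family of excursions of shorter
durations `t`, starting with slope `h (1 - R t) / S t`. -/
theorem exists_family (hS : IsFundamental 0 D S R) (hD : D ≠ 0) (hh : h ≠ 0)
    (e : IsExcursion 0 D h S R τ m₀ m₁) :
    ∃ σ, 0 ≤ σ ∧ σ < τ ∧ InjOn (fun t => h * (1 - R t) / S t) (Ioo σ τ) ∧
      ∀ τ' ∈ Ioo σ τ, S τ' ≠ 0 ∧ 0 < h * (1 - R τ') / S τ' ∧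
        ∀ t ∈ Ioo 0 τ', 0 < h * (1 - R τ') / S τ' * S t + h * (R t - 1) := by
  have hder : ∀ t, S t ≠ 0 → HasDerivAt (fun t => h * (1 - R t) / S t)
      (h * (1 - R t) / S t ^ 2) t := by
    intro t ht
    simpa using deriv_start hS h ht
  rcases e.S_sign hS hD hh e with hp | ⟨hDp, hneg, z, hz, hzτ, hz0, hpz, hp⟩
  · have hp' : ∀ t ∈ Ioo 0 τ, 0 < S t := fun t ht => hp t ⟨ht.1, ht.2.le⟩
    have hsgn : ∀ t ∈ Ioc 0 τ, 0 < h * (1 - R t) := by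
      have hnn : 0 ≤ h * (1 - R τ + 0 * S τ) := by
        have := mul_nonneg e.start_nonneg (hp τ ⟨e.pos, le_rfl⟩).le
        linarith [e.zero]
      intro t ht
      rcases lt_or_gt_of_ne hD with hD | hD
      · have hneg : h < 0 := lt_of_le_of_ne
          (nonpos_of_mul_nonneg_left hnn (g_neg hS hD hp' ⟨e.pos, le_rfl⟩)) hh
        simpa using mul_pos_of_neg_of_neg hneg (g_neg hS hD hp' ht)
      · have hpos : 0 < h := lt_of_le_of_ne
          (nonneg_of_mul_nonneg_left hnn (g_pos hS hD hp' ⟨e.pos, le_rfl⟩)) hh.symm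
        simpa using mul_pos hpos (g_pos hS hD hp' ht)
    have hmono : StrictMonoOn (fun t => h * (1 - R t) / S t) (Ioo 0 τ) := by
      refine strictMonoOn_of_hasDerivWithinAt_pos (convex_Ioo 0 τ)
        (fun t ht => (hder t (hp' t ht).ne').continuousAt.continuousWithinAt)
        (fun t ht => (hder t (hp' t (interior_subset ht)).ne').hasDerivWithinAt) fun t ht => ?_
      have ht' := interior_subset ht
      exact div_pos (hsgn t ⟨ht'.1, ht'.2.le⟩) (pow_pos (hp' t ht') 2)
    refine ⟨0, le_rfl, e.pos, hmono.injOn, fun τ' hτ' => ⟨(hp' τ' hτ').ne',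
      div_pos (hsgn τ' ⟨hτ'.1, hτ'.2.le⟩) (hp' τ' hτ'), fun t ht => ?_⟩⟩
    have ht' : t ∈ Ioo 0 τ := ⟨ht.1, ht.2.trans hτ'.2⟩
    -- With `M t = h * (1 - R t) / S t`, the level at time `t` is `S t * (M τ' - M t)`, and `M` is
    -- monotone.
    have h1 := mul_lt_mul_of_pos_right (hmono ht' hτ' ht.2) (hp' t ht')
    simp only at h1
    rw [div_mul_cancel₀ _ (hp' t ht').ne'] at h1
    linarith
  · have hne : ∀ t ∈ Ioo z τ, S t < 0 := fun t ht => hp t ⟨ht.1, ht.2.le⟩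
    have hg : StrictAntiOn (fun t => 1 - R t + 0 * S t) (Icc z τ) := by
      refine strictAntiOn_of_hasDerivWithinAt_neg (convex_Icc z τ)
        (fun t _ => (hS.deriv_g t).continuousAt.continuousWithinAt)
        (fun t _ => (hS.deriv_g t).hasDerivWithinAt) fun t ht => ?_
      rw [interior_Icc] at ht
      exact mul_neg_of_pos_of_neg hDp (hne t ht)
    have hgτ : 0 ≤ 1 - R τ + 0 * S τ := by
      have h2 : h * (1 - R τ + 0 * S τ) ≤ 0 := by
        have := mul_nonpos_of_nonneg_of_nonpos e.start_nonneg (hp τ ⟨hzτ, le_rfl⟩).le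
        linarith [e.zero]
      exact nonneg_of_mul_nonpos_right h2 hneg
    have hgpos : ∀ t ∈ Ioo z τ, 0 < 1 - R t := by
      intro t ht
      have := hg ⟨ht.1.le, ht.2.le⟩ ⟨hzτ.le, le_rfl⟩ ht.2
      simp only at this
      linarith
    have hanti : StrictAntiOn (fun t => h * (1 - R t) / S t) (Ioo z τ) := by
      refine strictAntiOn_of_hasDerivWithinAt_neg (convex_Ioo z τ)
        (fun t ht => (hder t (hne t ht).ne).continuousAt.continuousWithinAt)
        (fun t ht => (hder t (hne t (interior_subset ht)).ne).hasDerivWithinAt) fun t ht => ?_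
      have ht' := interior_subset ht
      exact div_neg_of_neg_of_pos (mul_neg_of_neg_of_pos hneg (hgpos t ht'))
        (by have := (hne t ht').ne; positivity)
    refine ⟨z, hz.le, hzτ, hanti.injOn, fun τ' hτ' => ?_⟩
    have hM : 0 < h * (1 - R τ') / S τ' :=
      div_pos_of_neg_of_neg (mul_neg_of_neg_of_pos hneg (hgpos τ' hτ')) (hne τ' hτ')
    refine ⟨(hne τ' hτ').ne, hM, fun t ht => ?_⟩
    rcases lt_or_ge z t with hzt | hzt
    · have ht' : t ∈ Ioo z τ := ⟨hzt, ht.2.trans hτ'.2⟩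
      have h1 := mul_lt_mul_of_neg_right (hanti ht' hτ' ht.2) (hne t ht')
      simp only at h1
      rw [div_mul_cancel₀ _ (hne t ht').ne] at h1
      linarith
    -- Up to the first zero of `S` the level is a nonnegative multiple of `S` plus a positive term.
    · have hSt : 0 ≤ S t := by
        rcases hzt.lt_or_eq with h1 | h1
        · exact (hpz t ⟨ht.1, h1⟩).le
        · rw [h1, hz0]
      have h2 := mul_neg_of_neg_of_pos hneg (g_pos hS hDp hpz ⟨ht.1, hzt⟩)
      have h3 := mul_nonneg hM.le hSt
      linarith

end IsExcursion

namespace PiecewiseLinearSystem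

variable {Z : PiecewiseLinearSystem}

namespace IsFramed

variable {p q : Plane} {Sm Rm Sp Rp : ℝ → ℝ}

theorem isPeriodicOrbit_cycle (F : Z.IsFramed p q Sm Rm Sp Rp) {z μ τ : ℝ} (hz : 0 < z)
    (hz0 : Sm z = 0) (hzp : ∀ t ∈ Ioo 0 z, 0 < Sm t) (hμ : μ < 0) (hr : Z.minusRate ≠ 0)
    (ha : Z.rateRatio ≠ 0) (hτ : 0 < τ)
    (hpos : ∀ t ∈ Ioo 0 τ, 0 < (Z.rateRatio * (Rm z * μ) + Z.n ⬝ᵥ Z.plus.field p) * Sp t +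
      (-Z.level q) * (Rp t - Z.plus.A.trace * Sp t - 1))
    (hend : (Z.rateRatio * (Rm z * μ) + Z.n ⬝ᵥ Z.plus.field p) * Sp τ +
      (-Z.level q) * (Rp τ - Z.plus.A.trace * Sp τ - 1) = 0)
    (hslope : (Z.rateRatio * (Rm z * μ) + Z.n ⬝ᵥ Z.plus.field p) * Rp τ -
      (-Z.level q) * Z.plus.A.det * Sp τ = Z.rateRatio * μ + Z.n ⬝ᵥ Z.plus.field p) :
    Z.IsPeriodicOrbit (Z.cycle p q Sm Rm Sp Rp z μ τ) := by
  have hlα : ∀ t, Z.level (Z.minus.flow p Sm Rm t (Z.linePoint p μ)) = μ * Sm t := fun t => by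
    rw [level_flow F.minus_p (F.level_linePoint μ), F.minus_linePoint hr, F.level_p]; ring
  have hlβ : ∀ t, Z.level (Z.plus.flow q Sp Rp t (Z.linePoint p (Rm z * μ))) =
      (Z.rateRatio * (Rm z * μ) + Z.n ⬝ᵥ Z.plus.field p) * Sp t +
      (-Z.level q) * (Rp t - Z.plus.A.trace * Sp t - 1) := fun t => by
    rw [level_flow F.plus_q (F.level_linePoint _), plus_linePoint]
  refine isPeriodicOrbit_of_arcs hz hτ (LinearSystem.hasDerivAt_flow F.fund_minus F.minus_p _)
    (LinearSystem.hasDerivAt_flow F.fund_plus F.plus_q _) ?_ ?_ ?_ ?_ ?_ ?_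
  · rw [hlα, F.fund_minus.S_zero, mul_zero]
  · rw [hlα, hz0, mul_zero]
  · rw [LinearSystem.flow_zero F.fund_plus]
    have hl : Z.level (Z.minus.flow p Sm Rm z (Z.linePoint p μ)) = 0 := by
      rw [hlα, hz0, mul_zero]
    rw [F.eq_linePoint hr hl, slope_flow F.minus_p (F.level_linePoint μ), F.minus_linePoint hr, hz0]
    congr 1; ring
  · rw [LinearSystem.flow_zero F.fund_minus]
    have hl : Z.level (Z.plus.flow q Sp Rp τ (Z.linePoint p (Rm z * μ))) = 0 := by
      rw [hlβ, hend]
    have h1 := slope_flow (S := Sp) (R := Rp) F.plus_q (F.level_linePoint (Rm z * μ)) τ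
    rw [plus_linePoint, hslope] at h1
    rw [F.eq_linePoint hr hl] at h1 ⊢
    rw [plus_linePoint] at h1
    congr 1
    exact mul_left_cancel₀ ha (by linarith)
  · intro t ht
    rw [hlα]
    exact mul_neg_of_neg_of_pos hμ (hzp t ht)
  · intro t ht
    rw [hlβ]
    exact hpos t ht

/-- A cycle of a reversible system is no limit cycle. -/
theorem not_isLimitCycle_of_reversible (F : Z.IsFramed p q Sm Rm Sp Rp) {z μ τ : ℝ} (hz : 0 < z)
    (hz0 : Sm z = 0) (hzp : ∀ t ∈ Ioo 0 z, 0 < Sm t) (hr : Z.minusRate ≠ 0)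
    (ha : 0 < Z.rateRatio) (hq : -Z.level q ≠ 0) (htr : Z.plus.A.trace = 0) (hRz : Rm z = -1)
    (hb : Z.n ⬝ᵥ Z.plus.field p = 0)
    (e : IsExcursion Z.plus.A.trace Z.plus.A.det (-Z.level q) Sp Rp τ
        (Z.rateRatio * (Rm z * μ) + Z.n ⬝ᵥ Z.plus.field p)
        (Z.rateRatio * μ + Z.n ⬝ᵥ Z.plus.field p)) :
    ¬ Z.IsLimitCycle (Z.cycle p q Sm Rm Sp Rp z μ τ) := by
  rintro ⟨⟨γ, T, hγ, hrange⟩, U, hU, hCU, hiso⟩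
  have hS := F.fund_plus
  rw [htr] at e hS
  have hSτ := e.S_ne_zero hq
  have hμτ : μ = -(-Z.level q * (1 - Rp τ) / Sp τ) / Z.rateRatio := by
    have := e.start_eq hSτ
    rw [hRz, hb] at this
    simp only [zero_mul, add_zero] at this
    rw [← this]
    field_simp
  obtain ⟨σ, hσ0, hστ, hinj, hfam⟩ := e.exists_family hS F.det_plus hq
  -- `M t` is the minus slope from which a cycle with plus duration `t` has to start.
  set M : ℝ → ℝ := fun t => -(-Z.level q * (1 - Rp t) / Sp t) / Z.rateRatio with hM
  have hMc : ContinuousAt M τ := by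
    have h1 := (IsExcursion.deriv_start hS (-Z.level q) hSτ).continuousAt.neg.div_const Z.rateRatio
    simpa [hM] using h1
  have horb : ∀ t ∈ Ioo σ τ, Z.IsPeriodicOrbit (Z.cycle p q Sm Rm Sp Rp z (M t) t) := by
    intro t ht
    obtain ⟨hSt, hpos, hlev⟩ := hfam t ht
    have hm : Z.rateRatio * (Rm z * M t) + Z.n ⬝ᵥ Z.plus.field p =
        -Z.level q * (1 - Rp t) / Sp t := by
      rw [hRz, hb, hM]; field_simp; ring
    refine F.isPeriodicOrbit_cycle hz hz0 hzp (div_neg_of_neg_of_pos (neg_neg_of_pos hpos) ha) hr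
      ha.ne' (hσ0.trans_lt ht.1) ?_ ?_ ?_
    · intro s hs
      rw [hm, htr, zero_mul, sub_zero]
      exact hlev s hs
    · rw [hm, htr, zero_mul, sub_zero, div_mul_cancel₀ _ hSt]
      ring
    -- The closing condition holds for every duration of the family, because for trace zero the
    -- Wronskian identity is `R ^ 2 + D * S ^ 2 = 1`.
    · rw [hm, hb, add_zero]
      have hw := hS.wronskian t
      simp only [zero_mul, sub_zero, Real.exp_zero] at hw
      rw [hM]
      field_simp
      linear_combination (Z.level q) * hw
  have hsub : ∀ᶠ t in 𝓝[<] τ, Z.cycle p q Sm Rm Sp Rp z (M t) t ⊆ U := by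
    refine nhdsWithin_le_nhds ?_
    have hMτ : M τ = μ := hμτ.symm
    rw [cycle, union_subset_iff] at hCU
    have e1 := isCompact_Icc.eventually_image_subset (K := Icc 0 z)
      (G := fun s t => Z.minus.flow p Sm Rm t (Z.linePoint p (M s))) (s₀ := τ) (fun t _ => by
        have h1 : ContinuousAt (fun y : ℝ × ℝ => M y.1) (τ, t) :=
          ContinuousAt.comp (g := M) (f := (Prod.fst : ℝ × ℝ → ℝ)) (x := (τ, t))
            hMc continuousAt_fst
        have h2 := (Z.continuous_linePoint p).continuousAt.comp h1
        exact (LinearSystem.continuous_flow F.fund_minus p).continuousAt.comp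
          (continuousAt_snd.prodMk h2)) hU (by rw [hMτ]; exact hCU.1)
    -- Time on the plus arc is rescaled to the fixed interval `Icc 0 1`, as its duration varies with
    -- the parameter.
    have e2 := isCompact_Icc.eventually_image_subset (K := Icc 0 1)
      (G := fun s t => Z.plus.flow q Sp Rp (s * t) (Z.linePoint p (Rm z * M s))) (s₀ := τ)
      (fun t _ => by
        have h1 : ContinuousAt (fun y : ℝ × ℝ => Rm z * M y.1) (τ, t) :=
          continuousAt_const.mul (ContinuousAt.comp (g := M) (f := (Prod.fst : ℝ × ℝ → ℝ)) (x := (τ, t))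
            hMc continuousAt_fst)
        have h2 := (Z.continuous_linePoint p).continuousAt.comp h1
        exact (LinearSystem.continuous_flow F.fund_plus q).continuousAt.comp
          ((continuousAt_fst.mul continuousAt_snd).prodMk h2)) hU (by
        rw [hMτ]
        refine Subset.trans ?_ hCU.2
        rintro _ ⟨t, ht, rfl⟩
        exact ⟨τ * t, ⟨mul_nonneg e.pos.le ht.1, mul_le_of_le_one_right e.pos.le ht.2⟩, rfl⟩)
    filter_upwards [e1, e2, lt_mem_nhds e.pos] with t h1 h2 h3
    rw [cycle, union_subset_iff]
    refine ⟨h1, Subset.trans ?_ h2⟩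
    rintro _ ⟨s, hs, rfl⟩
    refine ⟨s / t, ⟨div_nonneg hs.1 h3.le, (div_le_one h3).2 hs.2⟩, ?_⟩
    simp only [mul_div_cancel₀ s h3.ne']
  obtain ⟨ρ, hρτ, hρ⟩ := (mem_nhdsLT_iff_exists_Ioo_subset).1 hsub
  have hρτ' : max σ ρ < τ := max_lt hστ hρτ
  -- Isolation would make all nearby cycles equal to the given orbit, which would then meet the line
  -- in infinitely many points `M t`.
  have hmem : ∀ t ∈ Ioo (max σ ρ) τ, Z.linePoint p (M t) ∈ γ '' {t | t ∈ Ico 0 T ∧ γ t ∈ Z.line} := by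
    intro t ht
    have htσ : t ∈ Ioo σ τ := ⟨(le_max_left _ _).trans_lt ht.1, ht.2⟩
    have heq := hiso _ (horb t htσ) (hρ ⟨(le_max_right _ _).trans_lt ht.1, ht.2⟩)
    have h1 : Z.linePoint p (M t) ∈ Z.cycle p q Sm Rm Sp Rp z (M t) t :=
      Or.inl ⟨0, ⟨le_rfl, hz.le⟩, LinearSystem.flow_zero F.fund_minus _⟩
    rw [heq, hrange] at h1
    obtain ⟨s, hs⟩ := h1
    obtain ⟨s', hs', hss⟩ := hγ.periodic.exists_mem_Ico₀ hγ.period_pos s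
    refine ⟨s', ⟨hs', ?_⟩, by rw [← hss, hs]⟩
    change Z.level (γ s') = 0
    rw [← hss, hs, F.level_linePoint]
  refine (infinite_of_injOn_mapsTo (f := fun t => Z.linePoint p (M t)) ?_ hmem
    (Ioo_infinite hρτ')) (hγ.finite_line.image γ)
  intro s hs t ht hst
  have h1 := congrArg (fun x => Z.n ⬝ᵥ Z.minus.field x) hst
  simp only [F.minus_linePoint hr] at h1
  refine hinj ⟨(le_max_left _ _).trans_lt hs.1, hs.2⟩ ⟨(le_max_left _ _).trans_lt ht.1, ht.2⟩ ?_
  have h2 := (div_left_inj' ha.ne').1 h1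
  exact neg_injective h2

/-- The normal component of the plus field is affine and not constant along the line, so it vanishes
at one point only; it vanishes at both `p` and `q`. -/
theorem eq_of_level_q_eq_zero (F : Z.IsFramed p q Sm Rm Sp Rp) (hr : Z.minusRate ≠ 0)
    (ha : Z.rateRatio ≠ 0) (hq : Z.level q = 0) (hb : Z.n ⬝ᵥ Z.plus.field p = 0) : q = p := by
  have h1 := F.eq_linePoint hr hq
  have h2 := plus_linePoint Z p (Z.n ⬝ᵥ Z.minus.field q)
  rw [← h1, F.plus_q, dotProduct_zero, hb, add_zero] at h2
  rw [h1, (mul_eq_zero.1 h2.symm).resolve_left ha]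
  simp [linePoint]

/-- The data of a limit cycle. -/
theorem exists_cycle_of_isLimitCycle (F : Z.IsFramed p q Sm Rm Sp Rp) {C : Set Plane}
    (hC : Z.IsLimitCycle C) :
    ∃ z μ τ, 0 < z ∧ Sm z = 0 ∧ (∀ t ∈ Ioo 0 z, 0 < Sm t) ∧ μ < 0 ∧ Z.minusRate ≠ 0 ∧
      0 < Z.rateRatio ∧
      IsExcursion Z.plus.A.trace Z.plus.A.det (-Z.level q) Sp Rp τ
        (Z.rateRatio * (Rm z * μ) + Z.n ⬝ᵥ Z.plus.field p)
        (Z.rateRatio * μ + Z.n ⬝ᵥ Z.plus.field p) ∧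
      C = Z.cycle p q Sm Rm Sp Rp z μ τ := by
  obtain ⟨γ, T, hγ, rfl⟩ := hC.1
  refine hγ.exists_cycle F ?_ ?_
  · by_contra hcon
    push Not at hcon
    exact hγ.not_isLimitCycle_of_nonneg F.plus_q hcon hC
  · by_contra hcon
    push Not at hcon
    refine hγ.swap.not_isLimitCycle_of_nonneg (q := p) F.minus_p (fun t => ?_)
      (isLimitCycle_swap.2 hC)
    rw [level_swap]
    linarith [hcon t]

/-! ### At most three limit cycles -/

theorem encard_isLimitCycle_le (F : Z.IsFramed p q Sm Rm Sp Rp) :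
    {C | Z.IsLimitCycle C}.encard ≤ 3 := by
  rcases eq_or_ne (Z.level q) 0 with hq | hq
  · have hsub : {C | Z.IsLimitCycle C}.Subsingleton := by
      intro C hC C' hC'
      obtain ⟨z, μ, τ, hz, hz0, hzp, hμ, hr, ha, e, rfl⟩ := F.exists_cycle_of_isLimitCycle hC
      obtain ⟨z', μ', τ', hz', hz0', hzp', hμ', -, -, e', rfl⟩ := F.exists_cycle_of_isLimitCycle hC'
      obtain rfl := first_zero_unique hz hz' hz0 hz0' hzp hzp'
      rw [hq, neg_zero] at e e'
      obtain ⟨hs0, hsp⟩ := e.first_zero_of_h_eq_zero F.fund_plus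
      obtain ⟨hs0', hsp'⟩ := e'.first_zero_of_h_eq_zero F.fund_plus
      obtain rfl := first_zero_unique e.pos e'.pos hs0 hs0' hsp hsp'
      have hRp := F.fund_plus.R_neg_of_first_zero e.pos hs0 hsp
      have s1 := e.slope
      have s2 := e'.slope
      simp only [zero_mul, sub_zero] at s1 s2
      -- Both half-maps are affine here, so the closing condition is linear in `μ` with this factor.
      -- If it vanished, the offset would vanish and the two equilibria would coincide.
      have hne : 1 - Rp τ * Rm z ≠ 0 := by
        intro h0
        have hb : Z.n ⬝ᵥ Z.plus.field p = 0 := by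
          have h1 : (1 - Rp τ) * Z.n ⬝ᵥ Z.plus.field p = 0 := by
            linear_combination s1 - Z.rateRatio * μ * h0
          exact (mul_eq_zero.1 h1).resolve_left (by linarith)
        have hqp := F.eq_of_level_q_eq_zero hr ha.ne' hq hb
        obtain ⟨γ, T, hγ, hrange⟩ := hC.1
        rw [hrange] at hC
        exact hγ.not_isLimitCycle_of_common_equilibrium F.level_p F.minus_p (hqp ▸ F.plus_q) hC
      have hμμ : μ = μ' := by
        have h1 : Z.rateRatio * (1 - Rp τ * Rm z) * (μ - μ') = 0 := by
          linear_combination s1 - s2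
        have := (mul_eq_zero.1 h1).resolve_left (mul_ne_zero ha.ne' hne)
        linarith
      rw [hμμ]
    exact (encard_le_one_iff_subsingleton.2 hsub).trans (by norm_num)
  · have hh : -Z.level q ≠ 0 := neg_ne_zero.2 hq
    choose! z μ τ hz hz0 hzp hμ hr ha e hC using
      fun (C : Set Plane) (hC : C ∈ {C | Z.IsLimitCycle C}) => F.exists_cycle_of_isLimitCycle hC
    have hzz : ∀ C ∈ {C | Z.IsLimitCycle C}, ∀ C' ∈ {C | Z.IsLimitCycle C}, z C = z C' :=
      fun C h C' h' => first_zero_unique (hz C h) (hz C' h') (hz0 C h) (hz0 C' h') (hzp C h)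
        (hzp C' h')
    -- The plus duration determines the end slope, hence `μ`, hence the cycle; counting cycles
    -- amounts to counting durations.
    have hinj : InjOn τ {C | Z.IsLimitCycle C} := by
      intro C h C' h' hττ
      have hS := (e C h).S_ne_zero hh
      have h1 := (e C h).end_eq F.fund_plus hS
      have h2 := (e C' h').end_eq F.fund_plus ((e C' h').S_ne_zero hh)
      rw [← hττ, ← h1] at h2
      have hμμ : μ C' = μ C := mul_left_cancel₀ (ha C h).ne' (add_right_cancel h2)
      rw [hC C h, hC C' h', hμμ, hττ, hzz C h C' h']
    rw [← hinj.encard_image]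
    by_contra hcon
    have hfour : ((4 : ℕ) : ℕ∞) ≤ (τ '' {C | Z.IsLimitCycle C}).encard := by
      have := Order.add_one_le_of_lt (not_le.1 hcon)
      simpa [show (3 : ℕ∞) + 1 = 4 by norm_num] using this
    obtain ⟨E, hE, hcard⟩ := exists_subset_encard_eq hfour
    have hEfin : E.Finite := finite_of_encard_eq_coe hcard
    have hcard' : hEfin.toFinset.card = 4 := by
      rw [hEfin.encard_eq_coe_toFinset_card] at hcard
      exact_mod_cast hcard
    have hmem : ∀ i, ∃ C ∈ {C | Z.IsLimitCycle C},
        τ C = hEfin.toFinset.orderEmbOfFin hcard' i := fun i =>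
      hE (hEfin.mem_toFinset.1 (hEfin.toFinset.orderEmbOfFin_mem hcard' i))
    choose c hc hcτ using hmem
    have hmono : StrictMono fun i => τ (c i) := by
      simp only [hcτ]
      exact (hEfin.toFinset.orderEmbOfFin hcard').strictMono
    -- Eliminating `μ` from the two end slopes of a cycle gives `m₀ - Rm z * m₁ = (1 - Rm z) * b`,
    -- so `κ = -Rm z`.
    obtain ⟨htr, hκ⟩ := IsExcursion.degenerate_of_four F.fund_plus F.det_plus hh
      (κ := -Rm (z (c 0))) (b := Z.n ⬝ᵥ Z.plus.field p) (fun i => e (c i) (hc i))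
      (fun i => by rw [hzz _ (hc i) _ (hc 0)]; ring) hmono
    have hRz : Rm (z (c 0)) = -1 := by linarith
    have hb : Z.n ⬝ᵥ Z.plus.field p = 0 := by
      have e0 := e (c 0) (hc 0)
      have hS := F.fund_plus
      rw [htr] at e0 hS
      exact e0.offset_eq_zero_of_degenerate hS hh (by rw [hRz]; ring)
    have h0 := hc 0
    have hC0 := hC _ h0
    refine F.not_isLimitCycle_of_reversible (hz _ h0) (hz0 _ h0) (hzp _ h0) (hr _ h0) (ha _ h0) hh
      htr hRz hb (e _ h0) ?_
    rw [← hC0]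
    exact h0

end IsFramed

theorem exists_isFramed {p : Plane} (hp : Z.level p = 0) (hm : Z.minus.field p = 0)
    (hd : Z.minus.A.det ≠ 0) (hd' : Z.plus.A.det ≠ 0) :
    ∃ q Sm Rm Sp Rp, Z.IsFramed p q Sm Rm Sp Rp := by
  obtain ⟨Sm, Rm, h1⟩ := exists_isFundamental Z.minus.A.trace Z.minus.A.det
  obtain ⟨Sp, Rp, h2⟩ := exists_isFundamental Z.plus.A.trace Z.plus.A.det
  refine ⟨-(Z.plus.A⁻¹ *ᵥ Z.plus.b), Sm, Rm, Sp, Rp, hp, hm, ?_, hd, hd', h1, h2⟩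
  rw [LinearSystem.field, mulVec_neg, mulVec_mulVec,
    Matrix.mul_nonsing_inv _ (isUnit_iff_ne_zero.2 hd'), one_mulVec, neg_add_cancel]

/-- At most three limit cycles exist if one of the equilibria is on the line. -/
theorem encard_isLimitCycle_le (hZ : Z.Nondegenerate) (h : Z.HasEquilibriumOnLine) :
    {C | Z.IsLimitCycle C}.encard ≤ 3 := by
  obtain ⟨p, hp, hm | hq⟩ := h
  · obtain ⟨q, Sm, Rm, Sp, Rp, F⟩ := exists_isFramed hp hm hZ.1 hZ.2
    exact F.encard_isLimitCycle_le
  · have hp' : Z.swap.level p = 0 := by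
      have h0 : Z.level p = 0 := hp
      rw [level_swap, h0, neg_zero]
    obtain ⟨q, Sm, Rm, Sp, Rp, F⟩ := exists_isFramed (Z := Z.swap) hp' hq hZ.2 hZ.1
    have := F.encard_isLimitCycle_le
    simpa only [isLimitCycle_swap] using this

end PiecewiseLinearSystem

/-! ### An example and its cycles -/

namespace PiecewiseLinearSystem

/-- The growth rate of the focus of the example: half a turn divides distances by eight. -/
noncomputable def exampleRate : ℝ := -Real.log 8 / Real.pi

theorem exampleRate_neg : exampleRate < 0 :=
  div_neg_of_neg_of_pos (neg_neg_of_pos (Real.log_pos (by norm_num))) Real.pi_pos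

theorem exp_exampleRate_mul_pi : Real.exp (exampleRate * Real.pi) = 1 / 8 := by
  rw [exampleRate, div_mul_cancel₀ _ Real.pi_ne_zero, Real.exp_neg, Real.exp_log (by norm_num)]
  norm_num

/-- A focus on the line and a virtual node with eigenvalues one and two. -/
noncomputable def exampleSystem : PiecewiseLinearSystem where
  n := ![1, 0]
  d := 0
  n_ne_zero := fun h => by simpa using congrFun h 0
  minus := ⟨!![exampleRate, -1; 1, exampleRate], 0⟩
  -- The eigenvalues `1` and `2` make all closing data rational in `exp t`. With the offset `1 / 3`
  -- and the focus factor `1 / 8` the closing equation has the roots `2` and `4`.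
  plus := ⟨!![0, -1; 2, 3], ![1 / 3, 1]⟩

theorem exampleSystem_level (v : Plane) : exampleSystem.level v = v 0 := by
  simp [exampleSystem, level, dotProduct, Fin.sum_univ_two]

theorem exampleSystem_minus (v : Plane) : exampleSystem.minus.field v =
    ![exampleRate * v 0 - v 1, v 0 + exampleRate * v 1] := by
  ext i
  fin_cases i <;> simp [exampleSystem, LinearSystem.field, dotProduct, Fin.sum_univ_two]
  ring

theorem exampleSystem_plus (v : Plane) : exampleSystem.plus.field v =
    ![1 / 3 - v 1, 2 * v 0 + 3 * v 1 + 1] := by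
  ext i
  fin_cases i <;> simp [exampleSystem, LinearSystem.field, dotProduct, Fin.sum_univ_two]
  ring

theorem exampleSystem_n_dot (v : Plane) : exampleSystem.n ⬝ᵥ v = v 0 := by
  simp [exampleSystem, dotProduct, Fin.sum_univ_two]

theorem exampleSystem_direction : exampleSystem.direction = ![0, 1] := by
  simp [direction, exampleSystem]

theorem exampleSystem_minusRate : exampleSystem.minusRate = -1 := by
  rw [minusRate, exampleSystem_direction, exampleSystem_n_dot]
  simp [exampleSystem, mulVec, dotProduct, Fin.sum_univ_two]

theorem exampleSystem_rateRatio : exampleSystem.rateRatio = 1 := by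
  rw [rateRatio, exampleSystem_direction, exampleSystem_n_dot, exampleSystem_minusRate]
  simp [exampleSystem, mulVec, dotProduct, Fin.sum_univ_two]

theorem exampleSystem_linePoint (μ : ℝ) : exampleSystem.linePoint 0 μ = ![0, -μ] := by
  rw [linePoint, exampleSystem_direction, exampleSystem_minusRate]
  ext i
  fin_cases i <;> simp [div_neg]

theorem exampleSystem_offset : exampleSystem.n ⬝ᵥ exampleSystem.plus.field 0 = 1 / 3 := by
  rw [exampleSystem_n_dot, exampleSystem_plus]; simp

theorem exampleSystem_trace_plus : exampleSystem.plus.A.trace = 3 := by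
  simp [exampleSystem, Matrix.trace_fin_two]

theorem exampleSystem_det_plus : exampleSystem.plus.A.det = 2 := by
  simp [exampleSystem, Matrix.det_fin_two]

theorem exampleSystem_trace_minus : exampleSystem.minus.A.trace = 2 * exampleRate := by
  simp [exampleSystem, Matrix.trace_fin_two]; ring

theorem exampleSystem_det_minus : exampleSystem.minus.A.det = exampleRate ^ 2 + 1 := by
  simp [exampleSystem, Matrix.det_fin_two]; ring

/-- The fundamental pair of the focus. -/
noncomputable def focusS (t : ℝ) : ℝ := Real.exp (exampleRate * t) * Real.sin t

/-- The derivative of `focusS`. -/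
noncomputable def focusR (t : ℝ) : ℝ :=
  Real.exp (exampleRate * t) * (Real.cos t + exampleRate * Real.sin t)

/-- The fundamental pair of the node. -/
noncomputable def nodeS (t : ℝ) : ℝ := Real.exp (2 * t) - Real.exp t

/-- The derivative of `nodeS`. -/
noncomputable def nodeR (t : ℝ) : ℝ := 2 * Real.exp (2 * t) - Real.exp t

theorem exp_two_mul (t : ℝ) : Real.exp (2 * t) = Real.exp t ^ 2 := by
  rw [two_mul, Real.exp_add, sq]

theorem focusS_pos {t : ℝ} (ht : t ∈ Ioo 0 Real.pi) : 0 < focusS t :=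
  mul_pos (Real.exp_pos _) (Real.sin_pos_of_pos_of_lt_pi ht.1 ht.2)

theorem focusS_pi : focusS Real.pi = 0 := by simp [focusS]

theorem focusR_pi : focusR Real.pi = -(1 / 8) := by
  simp [focusR, exp_exampleRate_mul_pi]

theorem exampleSystem_isFramed :
    exampleSystem.IsFramed 0 ![-1, 1 / 3] focusS focusR nodeS nodeR where
  level_p := by simp [exampleSystem_level]
  minus_p := by rw [exampleSystem_minus]; simp
  plus_q := by rw [exampleSystem_plus]; ext i; fin_cases i <;> norm_num
  det_minus := by rw [exampleSystem_det_minus]; positivity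
  det_plus := by rw [exampleSystem_det_plus]; norm_num
  fund_minus := by
    rw [exampleSystem_trace_minus, exampleSystem_det_minus]
    refine ⟨fun t => ?_, fun t => ?_, by simp [focusS], by simp [focusR]⟩
    · refine HasDerivAt.congr_deriv
        ((hasDerivAt_exp_mul exampleRate t).mul (Real.hasDerivAt_sin t)) ?_
      rw [focusR]; ring
    · refine HasDerivAt.congr_deriv ((hasDerivAt_exp_mul exampleRate t).mul
        ((Real.hasDerivAt_cos t).add ((Real.hasDerivAt_sin t).const_mul exampleRate))) ?_
      simp only [focusR, focusS]; ring
  fund_plus := by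
    rw [exampleSystem_trace_plus, exampleSystem_det_plus]
    refine ⟨fun t => ?_, fun t => ?_, by simp [nodeS], by simp [nodeR]; norm_num⟩
    · exact (hasDerivAt_exp_mul 2 t).sub (Real.hasDerivAt_exp t)
    · refine HasDerivAt.congr_deriv (((hasDerivAt_exp_mul 2 t).const_mul 2).sub
        (Real.hasDerivAt_exp t)) ?_
      simp only [nodeR, nodeS]; ring

/-- The cycle of the example whose plus arc has duration `log w`. -/
noncomputable def exampleCycle (w : ℝ) : Set Plane :=
  (fun t => ![-((w - 2 / 3) * Real.exp (exampleRate * t) * Real.sin t),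
    (w - 2 / 3) * Real.exp (exampleRate * t) * Real.cos t]) '' Icc 0 Real.pi ∪
  (fun x => ![((w + 1) * x - x ^ 2) / w - 1, (2 * x ^ 2 - (w + 1) * x) / w + 1 / 3]) '' Icc 1 w

theorem exampleSystem_cycle {w : ℝ} (hw : 1 < w) (hw2 : w ^ 2 - 6 * w + 8 = 0) :
    exampleSystem.cycle 0 ![-1, 1 / 3] focusS focusR nodeS nodeR Real.pi (-(w - 2 / 3))
      (Real.log w) = exampleCycle w := by
  have hw0 : w ≠ 0 := by linarith
  have h1 : ∀ t, exampleSystem.minus.flow 0 focusS focusR t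
      (exampleSystem.linePoint 0 (-(w - 2 / 3))) =
      ![-((w - 2 / 3) * Real.exp (exampleRate * t) * Real.sin t),
        (w - 2 / 3) * Real.exp (exampleRate * t) * Real.cos t] := by
    intro t
    rw [LinearSystem.flow, ← LinearSystem.field_eq _ exampleSystem_isFramed.minus_p,
      exampleSystem_minus, exampleSystem_trace_minus, exampleSystem_linePoint]
    ext i
    fin_cases i <;> simp [focusS, focusR] <;> ring
  have h2 : ∀ t, exampleSystem.plus.flow ![-1, 1 / 3] nodeS nodeR t
      (exampleSystem.linePoint 0 (focusR Real.pi * -(w - 2 / 3))) =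
      ![((w + 1) * Real.exp t - Real.exp t ^ 2) / w - 1,
        (2 * Real.exp t ^ 2 - (w + 1) * Real.exp t) / w + 1 / 3] := by
    intro t
    rw [LinearSystem.flow, ← LinearSystem.field_eq _ exampleSystem_isFramed.plus_q,
      exampleSystem_plus, exampleSystem_trace_plus, exampleSystem_linePoint, focusR_pi]
    -- The quadratic equation for `w` turns division by `w` into a polynomial expression.
    have hm : 1 / w = 3 / 4 - w / 8 := by field_simp; linarith
    have hd : ∀ y : ℝ, y / w = y * (3 / 4 - w / 8) := fun y => by rw [div_eq_mul_one_div, hm]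
    rw [hd, hd]
    ext i
    fin_cases i
    · simp [nodeS, nodeR, exp_two_mul]
      linear_combination (Real.exp t / 8) * hw2
    · simp [nodeS, nodeR, exp_two_mul]
      linear_combination (-Real.exp t / 8) * hw2
  rw [cycle, exampleCycle]
  simp only [h1, h2]
  congr 1
  apply Subset.antisymm
  · rintro _ ⟨t, ht, rfl⟩
    refine ⟨Real.exp t, ⟨Real.one_le_exp ht.1, ?_⟩, rfl⟩
    exact (Real.le_log_iff_exp_le (by linarith)).1 ht.2
  · rintro _ ⟨x, hx, rfl⟩
    have hx0 : 0 < x := by linarith [hx.1]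
    refine ⟨Real.log x, ⟨Real.log_nonneg hx.1, Real.log_le_log hx0 hx.2⟩, ?_⟩
    simp only [Real.exp_log hx0]

theorem isPeriodicOrbit_exampleCycle {w : ℝ} (hw : 1 < w) (hw2 : w ^ 2 - 6 * w + 8 = 0) :
    exampleSystem.IsPeriodicOrbit (exampleCycle w) := by
  have hw0 : 0 < w := by linarith
  rw [← exampleSystem_cycle hw hw2]
  have hq : -exampleSystem.level ![-1, 1 / 3] = 1 := by simp [exampleSystem_level]
  have hm : 1 * (focusR Real.pi * -(w - 2 / 3)) + 1 / 3 = (w - 1) / w := by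
    rw [focusR_pi]
    field_simp
    linarith
  refine exampleSystem_isFramed.isPeriodicOrbit_cycle Real.pi_pos focusS_pi
    (fun t ht => focusS_pos ht) (by linarith) (by rw [exampleSystem_minusRate]; norm_num)
    (by rw [exampleSystem_rateRatio]; norm_num) (Real.log_pos hw) ?_ ?_ ?_
  · intro t ht
    rw [exampleSystem_rateRatio, exampleSystem_offset, hq, exampleSystem_trace_plus, hm]
    have h1 : 1 < Real.exp t := Real.one_lt_exp_iff.2 ht.1
    have h2 : Real.exp t < w := (Real.lt_log_iff_exp_lt hw0).1 ht.2
    -- In the variable `exp t` the level on the plus arc is a quadratic with roots `1` and `w`.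
    have h3 : (w - 1) / w * nodeS t + 1 * (nodeR t - 3 * nodeS t - 1) =
        (Real.exp t - 1) * (w - Real.exp t) / w := by
      rw [nodeS, nodeR, exp_two_mul]; field_simp; ring
    rw [h3]
    exact div_pos (mul_pos (by linarith) (by linarith)) hw0
  · rw [exampleSystem_rateRatio, exampleSystem_offset, hq, exampleSystem_trace_plus, hm, nodeS,
      nodeR, exp_two_mul, Real.exp_log hw0]
    field_simp; ring
  · rw [exampleSystem_rateRatio, exampleSystem_offset, hq, exampleSystem_det_plus, hm, nodeS,
      nodeR, exp_two_mul, Real.exp_log hw0]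
    field_simp; ring

/-- A curve that follows the flow of a linear system and closes up after the time `T` is constant
if the flow at time `T` fixes only the equilibrium. -/
theorem _root_.LinearSystem.const_of_flow {L : LinearSystem} {q : Plane} {S R : ℝ → ℝ}
    {γ : ℝ → Plane} {T : ℝ} (hT : 0 < T) (hper : Function.Periodic γ T)
    (hfl : ∀ t ∈ Icc 0 T, γ t = L.flow q S R (t - 0) (γ 0))
    (hfix : ∀ v : Plane, S T • L.A *ᵥ v + (R T - L.A.trace * S T) • v = v → v = 0) (t : ℝ) :
    γ t = γ 0 := by
  have h1 := hfl T ⟨hT.le, le_rfl⟩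
  have h2 : γ T = γ 0 := by simpa using hper 0
  rw [h2, LinearSystem.flow, sub_zero] at h1
  have h3 : γ 0 = q := sub_eq_zero.1 (hfix _ (by nth_rewrite 3 [h1]; abel))
  obtain ⟨s, hs, hst⟩ := hper.exists_mem_Ico₀ hT t
  rw [hst, hfl s ⟨hs.1, hs.2.le⟩, LinearSystem.flow, h3, sub_self, mulVec_zero, smul_zero,
    smul_zero, add_zero, add_zero]

/-- An orbit in one closed half-plane would need a vector other than zero fixed by a time-`T` flow
of the node or the focus, and neither flow has the eigenvalue one. All others are cycles with a
polynomial closing equation. -/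
theorem exampleSystem_periodicOrbit {C : Set Plane} (hC : exampleSystem.IsPeriodicOrbit C) :
    C = exampleCycle 2 ∨ C = exampleCycle 4 := by
  obtain ⟨γ, T, hγ, rfl⟩ := hC
  have F := exampleSystem_isFramed
  have hT := hγ.period_pos
  have hneg : ∃ t, exampleSystem.level (γ t) < 0 := by
    by_contra hcon
    push Not at hcon
    obtain ⟨t, ht⟩ := hγ.nonconstant
    refine ht (LinearSystem.const_of_flow hT hγ.periodic
      (hγ.plus_flow F.fund_plus F.plus_q fun t _ => hcon t) (fun v hv => ?_) t)
    have h0 := congrFun hv 0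
    have h1 := congrFun hv 1
    have hx : 1 < Real.exp T := Real.one_lt_exp_iff.2 hT
    rw [exampleSystem_trace_plus] at h0 h1
    simp only [exampleSystem, nodeS, nodeR, exp_two_mul, mulVec, dotProduct, Fin.sum_univ_two,
      Pi.add_apply, Pi.smul_apply, smul_eq_mul, of_apply, cons_val', cons_val_zero, cons_val_one,
      cons_val_fin_one] at h0 h1
    -- `(1, 1)` and `(2, 1)` are left eigenvectors of the node matrix for the eigenvalues `2` and
    -- `1`.
    have e1 : (Real.exp T ^ 2 - 1) * (v 0 + v 1) = 0 := by linear_combination h0 + h1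
    have e2 : (Real.exp T - 1) * (2 * v 0 + v 1) = 0 := by linear_combination 2 * h0 + h1
    have e3 := (mul_eq_zero.1 e1).resolve_left (by nlinarith)
    have e4 := (mul_eq_zero.1 e2).resolve_left (by linarith)
    ext i
    fin_cases i
    · change v 0 = 0; linarith
    · change v 1 = 0; linarith
  have hpos : ∃ t, 0 < exampleSystem.level (γ t) := by
    by_contra hcon
    push Not at hcon
    obtain ⟨t, ht⟩ := hγ.nonconstant
    refine ht (LinearSystem.const_of_flow hT hγ.periodic
      (hγ.minus_flow F.fund_minus F.minus_p fun t _ => hcon t) (fun v hv => ?_) t)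
    have h0 := congrFun hv 0
    have h1 := congrFun hv 1
    have hx : Real.exp (exampleRate * T) < 1 :=
      Real.exp_zero ▸ Real.exp_lt_exp.2 (mul_neg_of_neg_of_pos exampleRate_neg hT)
    have hx0 := Real.exp_pos (exampleRate * T)
    rw [exampleSystem_trace_minus] at h0 h1
    simp only [exampleSystem, focusS, focusR, mulVec, dotProduct, Fin.sum_univ_two,
      Pi.add_apply, Pi.smul_apply, smul_eq_mul, of_apply, cons_val', cons_val_zero, cons_val_one,
      cons_val_fin_one] at h0 h1
    set E := Real.exp (exampleRate * T)
    have e0 : E * (Real.cos T * v 0 - Real.sin T * v 1) = v 0 := by linear_combination h0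
    have e1 : E * (Real.sin T * v 0 + Real.cos T * v 1) = v 1 := by linear_combination h1
    -- The focus flow is a rotation times `E < 1`, so comparing squared lengths suffices.
    have e2 : (1 - E ^ 2) * (v 0 ^ 2 + v 1 ^ 2) = 0 := by
      have hsc := Real.sin_sq_add_cos_sq T
      linear_combination (-(E * (Real.cos T * v 0 - Real.sin T * v 1)) - v 0) * e0 +
        (-(E * (Real.sin T * v 0 + Real.cos T * v 1)) - v 1) * e1 +
        (E ^ 2 * (v 0 ^ 2 + v 1 ^ 2)) * hsc
    have e3 := (mul_eq_zero.1 e2).resolve_left (by nlinarith)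
    ext i
    fin_cases i
    · change v 0 = 0; nlinarith [sq_nonneg (v 0), sq_nonneg (v 1)]
    · change v 1 = 0; nlinarith [sq_nonneg (v 0), sq_nonneg (v 1)]
  obtain ⟨z, μ, τ, hz, hz0, hzp, hμ, -, -, e, hC⟩ := hγ.exists_cycle F hneg hpos
  obtain rfl := first_zero_unique hz Real.pi_pos hz0 focusS_pi hzp fun t ht => focusS_pos ht
  have hq : -exampleSystem.level ![-1, 1 / 3] = 1 := by simp [exampleSystem_level]
  rw [exampleSystem_rateRatio, exampleSystem_offset, hq, exampleSystem_trace_plus,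
    exampleSystem_det_plus, focusR_pi] at e
  have hw : 1 < Real.exp τ := Real.one_lt_exp_iff.2 e.pos
  have h1 := e.zero
  have h2 := e.slope
  simp only [nodeS, nodeR, exp_two_mul] at h1 h2
  have hτ : τ = Real.log (Real.exp τ) := (Real.log_exp τ).symm
  rw [hτ] at hC
  set w := Real.exp τ
  -- The factor `w - 1` that is divided out is the trivial zero at duration zero.
  have h3 : (-(μ / 8) + 1 / 3) * w - (w - 1) = 0 := by
    have : (w - 1) * ((-(μ / 8) + 1 / 3) * w - (w - 1)) = 0 := by linear_combination h1
    exact (mul_eq_zero.1 this).resolve_left (by linarith)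
  have h4 : μ = -(w - 2 / 3) := by
    linear_combination h2 + (2 * w - 1) * h3
  have h5 : w ^ 2 - 6 * w + 8 = 0 := by
    rw [h4] at h3
    linear_combination 8 * h3
  rw [h4, exampleSystem_cycle hw h5] at hC
  have h6 : (w - 2) * (w - 4) = 0 := by linear_combination h5
  rcases mul_eq_zero.1 h6 with h | h
  · left; rw [hC, show w = 2 by linarith]
  · right; rw [hC, show w = 4 by linarith]

theorem mem_exampleCycle_self {w : ℝ} : ![0, w - 2 / 3] ∈ exampleCycle w :=
  Or.inl ⟨0, ⟨le_rfl, Real.pi_pos.le⟩, by simp⟩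

theorem eq_of_mem_exampleCycle {w y : ℝ} (hw : 1 < w) (h : ![0, y] ∈ exampleCycle w) :
    y = w - 2 / 3 ∨ y < 0 ∨ y = 1 / w - 2 / 3 := by
  have hw0 : w ≠ 0 := by linarith
  rcases h with ⟨t, ht, h⟩ | ⟨x, hx, h⟩
  · have h0 := congrFun h 0
    have h1 := congrFun h 1
    simp only [cons_val_zero, cons_val_one, cons_val_fin_one] at h0 h1
    have hpos : 0 < (w - 2 / 3) * Real.exp (exampleRate * t) :=
      mul_pos (by linarith) (Real.exp_pos _)
    have hs : Real.sin t = 0 := (mul_eq_zero.1 (neg_eq_zero.1 h0)).resolve_left hpos.ne'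
    rcases ht.1.lt_or_eq with h3 | h3
    · rcases ht.2.lt_or_eq with h4 | h4
      · exact absurd hs (Real.sin_pos_of_pos_of_lt_pi h3 h4).ne'
      · right; left
        rw [← h1, h4, Real.cos_pi]
        rw [h4] at hpos
        linarith
    · left
      rw [← h1, ← h3]; simp
  · have h0 := congrFun h 0
    have h1 := congrFun h 1
    simp only [cons_val_zero, cons_val_one, cons_val_fin_one] at h0 h1
    have h2 : (x - 1) * (x - w) = 0 := by
      field_simp at h0
      linear_combination -h0
    rcases mul_eq_zero.1 h2 with h3 | h3
    · right; right
      rw [← h1, show x = 1 by linarith]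
      field_simp; ring
    · left
      rw [← h1, show x = w by linarith]
      field_simp; ring

/-- As only two periodic orbits exist, the complement of a single point of the other one is an
isolating neighbourhood. -/
theorem isLimitCycle_exampleCycle {w w' : ℝ} (hw : 1 < w) (hw2 : w ^ 2 - 6 * w + 8 = 0)
    (hw' : 1 < w') (hne : w' ≠ w)
    (h : ∀ C, exampleSystem.IsPeriodicOrbit C → C = exampleCycle w ∨ C = exampleCycle w') :
    exampleSystem.IsLimitCycle (exampleCycle w) := by
  refine ⟨isPeriodicOrbit_exampleCycle hw hw2, {![0, w' - 2 / 3]}ᶜ, isOpen_compl_singleton, ?_, ?_⟩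
  · rw [subset_compl_singleton_iff]
    intro hmem
    have h1 : 1 / w < 1 := (div_lt_one (by linarith)).2 hw
    rcases eq_of_mem_exampleCycle hw hmem with h2 | h2 | h2
    · exact hne (by linarith)
    · linarith
    · linarith
  · intro C' hC' hsub
    rcases h C' hC' with rfl | rfl
    · rfl
    · exact absurd (hsub mem_exampleCycle_self) (by simp)

/-! ### The origin lies inside the cycles -/

/-- A function that is continuous in the plane and vanishes on a spiral arc. -/
noncomputable def spiralLevel (v : Plane) : ℝ :=
  Real.sqrt (v 0 ^ 2 + v 1 ^ 2) *
    Real.exp (-exampleRate * Real.arccos (v 1 / Real.sqrt (v 0 ^ 2 + v 1 ^ 2)))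

/-- Only the origin needs care: the arccosine is at most `π`, so the exponential factor is bounded
while the radius tends to zero. -/
theorem continuous_spiralLevel : Continuous spiralLevel := by
  rw [continuous_iff_continuousAt]
  intro v
  by_cases hv : Real.sqrt (v 0 ^ 2 + v 1 ^ 2) = 0
  · have h0 : spiralLevel v = 0 := by rw [spiralLevel, hv, zero_mul]
    rw [ContinuousAt, h0]
    have hb : Tendsto (fun u : Plane => Real.sqrt (u 0 ^ 2 + u 1 ^ 2) *
        Real.exp (-exampleRate * Real.pi)) (𝓝 v) (𝓝 0) := by
      have hc : Continuous fun u : Plane => Real.sqrt (u 0 ^ 2 + u 1 ^ 2) *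
        Real.exp (-exampleRate * Real.pi) := by fun_prop
      have := hc.tendsto v
      rwa [hv, zero_mul] at this
    refine squeeze_zero (fun u => ?_) (fun u => ?_) hb
    · exact mul_nonneg (Real.sqrt_nonneg _) (Real.exp_pos _).le
    · refine mul_le_mul_of_nonneg_left (Real.exp_le_exp.2 ?_) (Real.sqrt_nonneg _)
      exact mul_le_mul_of_nonneg_left (Real.arccos_le_pi _) (by linarith [exampleRate_neg])
  · have h1 : ContinuousAt (fun u : Plane => Real.sqrt (u 0 ^ 2 + u 1 ^ 2)) v := by fun_prop
    have h2 : ContinuousAt (fun u : Plane => u 1) v := (continuous_apply 1).continuousAt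
    have h3 := Real.continuous_arccos.continuousAt.comp (h2.div h1 hv)
    exact h1.mul (Real.continuous_exp.continuousAt.comp (continuousAt_const.mul h3))

/-- A quadratic function that vanishes on the parabola that contains the plus arc. -/
noncomputable def parabolaLevel (w : ℝ) (v : Plane) : ℝ :=
  w / (w + 1) ^ 2 * (2 * v 0 + v 1 + 5 / 3) ^ 2 - (v 0 + v 1 + 2 / 3)

theorem continuous_parabolaLevel (w : ℝ) : Continuous (parabolaLevel w) := by
  unfold parabolaLevel
  fun_prop

theorem parabolaLevel_line {w : ℝ} (hw : 0 < w) {v : Plane} (hv : v 0 = 0) :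
    parabolaLevel w v * (w + 1) ^ 2 = w * (v 1 - (w - 2 / 3)) * (v 1 - (1 / w - 2 / 3)) := by
  rw [parabolaLevel, hv]
  field_simp
  ring

theorem spiralLevel_line_nonneg {v : Plane} (hv : v 0 = 0) (h : 0 ≤ v 1) :
    spiralLevel v = v 1 := by
  rw [spiralLevel, hv]
  rcases h.lt_or_eq with h | h
  · simp [Real.sqrt_sq h.le, div_self h.ne']
  · simp [← h]

theorem spiralLevel_line_neg {v : Plane} (hv : v 0 = 0) (h : v 1 < 0) :
    spiralLevel v = -8 * v 1 := by
  have hs : Real.sqrt (v 0 ^ 2 + v 1 ^ 2) = -v 1 := by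
    rw [hv, show (0 : ℝ) ^ 2 + v 1 ^ 2 = (-v 1) ^ 2 by ring, Real.sqrt_sq (by linarith)]
  have h2 : Real.exp (-exampleRate * Real.pi) = 8 := by
    rw [neg_mul, Real.exp_neg, exp_exampleRate_mul_pi]; norm_num
  rw [spiralLevel, hs, div_neg, div_self h.ne, Real.arccos_neg_one, h2]
  ring

/-- On the line `parabolaLevel` has the roots `w - 2 / 3` and `-(w - 2 / 3) / 8`, and `spiralLevel`
takes the value `w - 2 / 3` exactly there. The two descriptions of the interior therefore glue along
the line. -/
theorem signs_agree {w : ℝ} (hw : 1 < w) (hw2 : w ^ 2 - 6 * w + 8 = 0) {v : Plane}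
    (hv : v 0 = 0) :
    (0 ≤ parabolaLevel w v → w - 2 / 3 ≤ spiralLevel v) ∧
      (parabolaLevel w v ≤ 0 → spiralLevel v ≤ w - 2 / 3) := by
  have hw0 : 0 < w := by linarith
  have h1 := parabolaLevel_line hw0 hv
  have hm : 1 / w - 2 / 3 = -(w - 2 / 3) / 8 := by field_simp; linarith
  rw [hm] at h1
  have hs : 0 < (w + 1) ^ 2 := by positivity
  constructor
  · intro h
    have h2 : 0 ≤ w * ((v 1 - (w - 2 / 3)) * (v 1 - -(w - 2 / 3) / 8)) := by
      rw [← mul_assoc, ← h1]; exact mul_nonneg h hs.le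
    have h3 := nonneg_of_mul_nonneg_right h2 hw0
    rcases lt_or_ge (v 1) 0 with hn | hn
    · rw [spiralLevel_line_neg hv hn]
      by_contra hcon
      push Not at hcon
      nlinarith
    · rw [spiralLevel_line_nonneg hv hn]
      by_contra hcon
      push Not at hcon
      nlinarith
  · intro h
    have h2 : w * ((v 1 - (w - 2 / 3)) * (v 1 - -(w - 2 / 3) / 8)) ≤ 0 := by
      rw [← mul_assoc, ← h1]; exact mul_nonpos_of_nonpos_of_nonneg h hs.le
    have h3 := nonpos_of_mul_nonpos_right h2 hw0
    rcases lt_or_ge (v 1) 0 with hn | hn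
    · rw [spiralLevel_line_neg hv hn]
      by_contra hcon
      push Not at hcon
      nlinarith
    · rw [spiralLevel_line_nonneg hv hn]
      by_contra hcon
      push Not at hcon
      nlinarith

theorem mem_exampleCycle_of_spiralLevel {w : ℝ} (hw : 1 < w) {v : Plane} (hv : v 0 ≤ 0)
    (h : spiralLevel v = w - 2 / 3) : v ∈ exampleCycle w := by
  left
  set r := Real.sqrt (v 0 ^ 2 + v 1 ^ 2) with hr
  have hr2 : r ^ 2 = v 0 ^ 2 + v 1 ^ 2 := Real.sq_sqrt (by positivity)
  have hr0 : 0 < r := by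
    refine lt_of_le_of_ne (Real.sqrt_nonneg _) fun h0 => ?_
    rw [spiralLevel, ← hr, ← h0, zero_mul] at h
    linarith
  have habs : |v 1 / r| ≤ 1 := by
    rw [abs_div, abs_of_pos hr0, div_le_one hr0]
    exact abs_le_of_sq_le_sq (by nlinarith [sq_nonneg (v 0)]) hr0.le
  have hcos : Real.cos (Real.arccos (v 1 / r)) = v 1 / r :=
    Real.cos_arccos (abs_le.1 habs).1 (abs_le.1 habs).2
  have hsin : Real.sin (Real.arccos (v 1 / r)) = -v 0 / r := by
    rw [Real.sin_arccos]
    rw [show 1 - (v 1 / r) ^ 2 = (-v 0 / r) ^ 2 by field_simp; linarith]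
    exact Real.sqrt_sq (div_nonneg (by linarith) hr0.le)
  have hE : (w - 2 / 3) * Real.exp (exampleRate * Real.arccos (v 1 / r)) = r := by
    rw [← h, spiralLevel, ← hr, mul_assoc, ← Real.exp_add]
    simp
  refine ⟨Real.arccos (v 1 / r), ⟨Real.arccos_nonneg _, Real.arccos_le_pi _⟩, ?_⟩
  simp only [hE, hcos, hsin]
  ext i
  fin_cases i
  · change -(r * (-v 0 / r)) = v 0
    field_simp
  · change r * (v 1 / r) = v 1
    field_simp

/-- With `a = 2 * v 0 + v 1 + 5 / 3`, the condition `0 ≤ v 0` reads `v 0 + v 1 + 2 / 3 ≤ a - 1`.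
Together with `h` this is a quadratic inequality in `a` with roots `(w + 1) / w` and `w + 1`. -/
theorem bounds_of_parabolaLevel {w : ℝ} (hw : 1 < w) {v : Plane} (hv : 0 ≤ v 0)
    (h : parabolaLevel w v ≤ 0) :
    w + 1 ≤ (2 * v 0 + v 1 + 5 / 3) * w ∧ 2 * v 0 + v 1 + 5 / 3 ≤ w + 1 := by
  rw [parabolaLevel] at h
  set a := 2 * v 0 + v 1 + 5 / 3 with ha
  have hw0 : 0 < w := by linarith
  have h1 : (a * w - (w + 1)) * (a - (w + 1)) ≤ 0 := by
    have h2 : w / (w + 1) ^ 2 * a ^ 2 ≤ a - 1 := by linarith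
    rw [div_mul_eq_mul_div, div_le_iff₀ (by positivity)] at h2
    nlinarith
  constructor
  · by_contra hcon
    have h2 := nonneg_of_mul_nonpos_right h1 (by linarith)
    nlinarith
  · by_contra hcon
    have h2 := nonpos_of_mul_nonpos_left h1 (by linarith)
    nlinarith

theorem mem_exampleCycle_of_parabolaLevel {w : ℝ} (hw : 1 < w) {v : Plane} (hv : 0 ≤ v 0)
    (h : parabolaLevel w v = 0) : v ∈ exampleCycle w := by
  right
  have hw0 : 0 < w := by linarith
  obtain ⟨h1, h2⟩ := bounds_of_parabolaLevel hw hv h.le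
  rw [parabolaLevel] at h
  set a := 2 * v 0 + v 1 + 5 / 3 with ha
  have hb : v 0 + v 1 + 2 / 3 = w / (w + 1) ^ 2 * a ^ 2 := by linarith
  -- On the plus arc with parameter `x` one has `a = (w + 1) * x / w`, so this recovers `x`.
  refine ⟨a * w / (w + 1), ⟨?_, ?_⟩, ?_⟩
  · rw [le_div_iff₀ (by linarith)]; linarith
  · rw [div_le_iff₀ (by linarith)]; nlinarith
  · ext i
    fin_cases i
    · change ((w + 1) * (a * w / (w + 1)) - (a * w / (w + 1)) ^ 2) / w - 1 = v 0
      have : ((w + 1) * (a * w / (w + 1)) - (a * w / (w + 1)) ^ 2) / w =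
        a - w / (w + 1) ^ 2 * a ^ 2 := by field_simp
      rw [this, ← hb, ha]; ring
    · change (2 * (a * w / (w + 1)) ^ 2 - (w + 1) * (a * w / (w + 1))) / w + 1 / 3 = v 1
      have : (2 * (a * w / (w + 1)) ^ 2 - (w + 1) * (a * w / (w + 1))) / w =
        2 * (w / (w + 1) ^ 2 * a ^ 2) - a := by field_simp
      rw [this, ← hb, ha]; ring

/-- No Jordan curve theorem is needed: two closed sets `A` and `B` cover the plane and meet only in
the cycle. A connected set off the cycle that contains the origin, a point of `A`, stays in the
bounded set `A`. -/
theorem zero_mem_inside_exampleCycle {w : ℝ} (hw : 1 < w) (hw2 : w ^ 2 - 6 * w + 8 = 0) :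
    (0 : Plane) ∈ inside (exampleCycle w) := by
  have hw0 : 0 < w := by linarith
  have hm : 1 / w - 2 / 3 = -(w - 2 / 3) / 8 := by field_simp; linarith
  have h0 : (0 : Plane) ∉ exampleCycle w := by
    intro hmem
    rcases hmem with ⟨t, -, h⟩ | hmem
    · have h0 := congrFun h 0
      have h1 := congrFun h 1
      simp only [cons_val_zero, cons_val_one, cons_val_fin_one, Pi.zero_apply] at h0 h1
      have hpos : 0 < (w - 2 / 3) * Real.exp (exampleRate * t) :=
        mul_pos (by linarith) (Real.exp_pos _)
      have hs := (mul_eq_zero.1 (neg_eq_zero.1 h0)).resolve_left hpos.ne'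
      have hc := (mul_eq_zero.1 h1).resolve_left hpos.ne'
      have := Real.sin_sq_add_cos_sq t
      rw [hs, hc] at this
      norm_num at this
    · have h1 : ![0, (0 : ℝ)] ∈ exampleCycle w := by
        have : ![0, (0 : ℝ)] = (0 : Plane) := by ext i; fin_cases i <;> rfl
        rw [this]; exact Or.inr hmem
      rcases eq_of_mem_exampleCycle hw h1 with h2 | h2 | h2
      · linarith
      · exact lt_irrefl _ h2
      · rw [hm] at h2; linarith
  refine ⟨h0, ?_⟩
  set A : Set Plane := {v | v 0 ≤ 0 ∧ spiralLevel v ≤ w - 2 / 3} ∪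
    {v | 0 ≤ v 0 ∧ parabolaLevel w v ≤ 0} with hA
  set B : Set Plane := {v | v 0 ≤ 0 ∧ w - 2 / 3 ≤ spiralLevel v} ∪
    {v | 0 ≤ v 0 ∧ 0 ≤ parabolaLevel w v} with hB
  have hc0 : Continuous fun v : Plane => v 0 := continuous_apply 0
  have hAc : IsClosed A :=
    ((isClosed_le hc0 continuous_const).inter
      (isClosed_le continuous_spiralLevel continuous_const)).union
    ((isClosed_le continuous_const hc0).inter
      (isClosed_le (continuous_parabolaLevel w) continuous_const))
  have hBc : IsClosed B :=
    ((isClosed_le hc0 continuous_const).inter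
      (isClosed_le continuous_const continuous_spiralLevel)).union
    ((isClosed_le continuous_const hc0).inter
      (isClosed_le continuous_const (continuous_parabolaLevel w)))
  have hAB : ∀ v : Plane, v ∈ A ∪ B := by
    intro v
    rcases le_total (v 0) 0 with h | h
    · rcases le_total (spiralLevel v) (w - 2 / 3) with h' | h'
      · exact Or.inl (Or.inl ⟨h, h'⟩)
      · exact Or.inr (Or.inl ⟨h, h'⟩)
    · rcases le_total (parabolaLevel w v) 0 with h' | h'
      · exact Or.inl (Or.inr ⟨h, h'⟩)
      · exact Or.inr (Or.inr ⟨h, h'⟩)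
  have hinter : A ∩ B ⊆ exampleCycle w := by
    rintro v ⟨⟨h1, h2⟩ | ⟨h1, h2⟩, ⟨h3, h4⟩ | ⟨h3, h4⟩⟩
    · exact mem_exampleCycle_of_spiralLevel hw h1 (le_antisymm h2 h4)
    · exact mem_exampleCycle_of_spiralLevel hw h1
        (le_antisymm h2 ((signs_agree hw hw2 (le_antisymm h1 h3)).1 h4))
    · exact mem_exampleCycle_of_spiralLevel hw h3
        (le_antisymm ((signs_agree hw hw2 (le_antisymm h3 h1)).2 h2) h4)
    · exact mem_exampleCycle_of_parabolaLevel hw h1 (le_antisymm h2 h4)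
  have hAbdd : A ⊆ Icc (fun _ => -(3 * w + 3)) fun _ => 3 * w + 3 := by
    have hcoord : ∀ v : Plane, |v 0| ≤ 3 * w + 3 → |v 1| ≤ 3 * w + 3 →
        v ∈ Icc (fun _ => -(3 * w + 3)) fun _ => 3 * w + 3 := by
      intro v h1 h2
      rw [abs_le] at h1 h2
      constructor <;> intro i <;> fin_cases i
      exacts [h1.1, h2.1, h1.2, h2.2]
    rintro v (⟨h1, h2⟩ | ⟨h1, h2⟩)
    · have hexp : 1 ≤ Real.exp (-exampleRate *
          Real.arccos (v 1 / Real.sqrt (v 0 ^ 2 + v 1 ^ 2))) :=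
        Real.one_le_exp (mul_nonneg (by linarith [exampleRate_neg]) (Real.arccos_nonneg _))
      have hr : Real.sqrt (v 0 ^ 2 + v 1 ^ 2) ≤ w - 2 / 3 := by
        rw [spiralLevel] at h2
        nlinarith [Real.sqrt_nonneg (v 0 ^ 2 + v 1 ^ 2)]
      refine hcoord v ?_ ?_
      · have : |v 0| ≤ Real.sqrt (v 0 ^ 2 + v 1 ^ 2) :=
          Real.abs_le_sqrt (by nlinarith [sq_nonneg (v 1)])
        linarith
      · have : |v 1| ≤ Real.sqrt (v 0 ^ 2 + v 1 ^ 2) :=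
          Real.abs_le_sqrt (by nlinarith [sq_nonneg (v 0)])
        linarith
    · obtain ⟨h3, h4⟩ := bounds_of_parabolaLevel hw h1 h2
      rw [parabolaLevel] at h2
      have h5 : 0 ≤ w / (w + 1) ^ 2 * (2 * v 0 + v 1 + 5 / 3) ^ 2 := by positivity
      have h6 : 0 ≤ 2 * v 0 + v 1 + 5 / 3 := by
        by_contra hcon
        push Not at hcon
        nlinarith
      refine hcoord v ?_ ?_ <;> rw [abs_le] <;> constructor <;> linarith
  have hK : IsPreconnected (connectedComponentIn (exampleCycle w)ᶜ 0) :=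
    isPreconnected_connectedComponentIn
  have hKsub : connectedComponentIn (exampleCycle w)ᶜ 0 ⊆ (exampleCycle w)ᶜ :=
    connectedComponentIn_subset _ _
  have h0K : (0 : Plane) ∈ connectedComponentIn (exampleCycle w)ᶜ 0 :=
    mem_connectedComponentIn h0
  have h0A : (0 : Plane) ∈ A := by
    left
    refine ⟨le_rfl, ?_⟩
    simp [spiralLevel]
    linarith
  have hKA : connectedComponentIn (exampleCycle w)ᶜ 0 ⊆ A := by
    intro v hv
    by_contra hvA
    have hvB : v ∈ B := (hAB v).resolve_left hvA
    obtain ⟨u, huK, hu⟩ := isPreconnected_closed_iff.1 hK A B hAc hBc (fun u _ => hAB u)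
      ⟨0, h0K, h0A⟩ ⟨v, hv, hvB⟩
    exact hKsub huK (hinter hu)
  exact (Metric.isBounded_Icc _ _).subset (hKA.trans hAbdd)

theorem exampleSystem_isEquilibrium (v : Plane) : exampleSystem.IsEquilibrium v ↔ v = 0 := by
  rw [IsEquilibrium, exampleSystem_level, exampleSystem_minus, exampleSystem_plus]
  constructor
  · rintro (⟨-, h⟩ | ⟨h0, h⟩)
    · have h1 := congrFun h 0
      have h2 := congrFun h 1
      simp only [cons_val_zero, cons_val_one, cons_val_fin_one, Pi.zero_apply] at h1 h2
      have h3 : (exampleRate ^ 2 + 1) * v 1 = 0 := by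
        linear_combination exampleRate * h2 - h1
      have h4 := (mul_eq_zero.1 h3).resolve_left (by positivity)
      rw [h4] at h2
      ext i
      fin_cases i
      · change v 0 = 0; linarith
      · exact h4
    · have h1 := congrFun h 0
      have h2 := congrFun h 1
      simp only [cons_val_zero, cons_val_one, cons_val_fin_one, Pi.zero_apply] at h1 h2
      linarith
  · rintro rfl
    left
    simp

theorem surroundsUniqueEquilibrium_exampleCycle {w : ℝ} (hw : 1 < w)
    (hw2 : w ^ 2 - 6 * w + 8 = 0) : exampleSystem.SurroundsUniqueEquilibrium (exampleCycle w) :=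
  ⟨0, ⟨(exampleSystem_isEquilibrium 0).2 rfl, zero_mem_inside_exampleCycle hw hw2⟩,
    fun v hv => (exampleSystem_isEquilibrium v).1 hv.1⟩

theorem two_le_encard_exampleSystem : 2 ≤ exampleSystem.limitCycles.encard := by
  have hne : exampleCycle 2 ≠ exampleCycle 4 := by
    intro h
    have h1 : ![0, (4 : ℝ) - 2 / 3] ∈ exampleCycle 2 := h ▸ mem_exampleCycle_self
    rcases eq_of_mem_exampleCycle (by norm_num) h1 with h2 | h2 | h2 <;> norm_num at h2
  rw [← encard_pair hne]
  refine encard_le_encard ?_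
  rintro C (rfl | rfl)
  · exact ⟨isLimitCycle_exampleCycle (w' := 4) (by norm_num) (by norm_num) (by norm_num)
      (by norm_num) fun C hC => exampleSystem_periodicOrbit hC,
      Or.inl (surroundsUniqueEquilibrium_exampleCycle (by norm_num) (by norm_num))⟩
  · exact ⟨isLimitCycle_exampleCycle (w' := 2) (by norm_num) (by norm_num) (by norm_num)
      (by norm_num) fun C hC => (exampleSystem_periodicOrbit hC).symm,
      Or.inl (surroundsUniqueEquilibrium_exampleCycle (by norm_num) (by norm_num))⟩

theorem exampleSystem_admissible : exampleSystem.Nondegenerate ∧ exampleSystem.Discontinuous ∧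
    exampleSystem.HasEquilibriumOnLine := by
  have h0 : (0 : Plane) ∈ exampleSystem.line := exampleSystem_isFramed.level_p
  refine ⟨⟨exampleSystem_isFramed.det_minus, exampleSystem_isFramed.det_plus⟩, ⟨0, h0, ?_⟩,
    ⟨0, h0, Or.inl exampleSystem_isFramed.minus_p⟩⟩
  rw [exampleSystem_isFramed.minus_p]
  intro h
  have h1 := exampleSystem_offset
  rw [← h, dotProduct_zero] at h1
  norm_num at h1

end PiecewiseLinearSystem

/-! ### The maximum -/

theorem theorem1 :
    ∃ N : ℕ,
      IsGreatest
        {k : ℕ∞ | ∃ Z : PiecewiseLinearSystem,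
          Z.Nondegenerate ∧ Z.Discontinuous ∧ Z.HasEquilibriumOnLine ∧
            k = Z.limitCycles.encard}
        (N : ℕ∞) ∧
      2 ≤ N ∧ N ≤ 3 := by
  set K : Set ℕ∞ := {k : ℕ∞ | ∃ Z : PiecewiseLinearSystem,
    Z.Nondegenerate ∧ Z.Discontinuous ∧ Z.HasEquilibriumOnLine ∧ k = Z.limitCycles.encard} with hK
  have hle : ∀ k ∈ K, k ≤ 3 := by
    rintro _ ⟨Z, hZ, -, hE, rfl⟩
    exact (encard_le_encard fun C hC => hC.1).trans
      (PiecewiseLinearSystem.encard_isLimitCycle_le hZ hE)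
  have hmem : PiecewiseLinearSystem.exampleSystem.limitCycles.encard ∈ K := by
    obtain ⟨h1, h2, h3⟩ := PiecewiseLinearSystem.exampleSystem_admissible
    exact ⟨_, h1, h2, h3, rfl⟩
  have h2 := PiecewiseLinearSystem.two_le_encard_exampleSystem
  -- Whether three is attained is left undecided: either it is the maximum, or every count is at
  -- most two and the example attains two.
  by_cases h3 : (3 : ℕ∞) ∈ K
  · exact ⟨3, ⟨by exact_mod_cast h3, fun k hk => by exact_mod_cast hle k hk⟩, by norm_num, le_rfl⟩
  · have hle2 : ∀ k ∈ K, k ≤ 2 := by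
      intro k hk
      have hlt : k < 3 := lt_of_le_of_ne (hle k hk) fun h => h3 (h ▸ hk)
      rw [show (3 : ℕ∞) = 2 + 1 by norm_num] at hlt
      exact Order.le_of_lt_add_one hlt
    have heq : PiecewiseLinearSystem.exampleSystem.limitCycles.encard = 2 :=
      le_antisymm (hle2 _ hmem) h2
    rw [heq] at hmem
    exact ⟨2, ⟨by exact_mod_cast hmem, fun k hk => by exact_mod_cast hle2 k hk⟩, le_rfl, by norm_num⟩
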